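/- Let $0<q<1$ and $[z]:=(q^z-q^{-z})/(q-q^{-1})$. Let $\mathcal A(S^4_q)$ be the unital complex $*$-algebra generated by $x_0=x_0^*,x_1,x_1^*,x_2,x_2^*$ with relations $$x_ix_j=q^2x_jx_i\ (0\le i<j\le 2),\quad x_i^*x_j=q^2x_jx_i^*\ (i\ne j),\quad [x_1^*,x_1]=(1-q^4)x_0^2,$$ $$[x_2^*,x_2]=x_1^*x_1-q^4x_1x_1^*,\quad x_0^2+x_1x_1^*+x_2x_2^*=1 .$$ Let $\mathcal H_\pm$ be Hilbert spaces with orthonormal bases $|l,m_1,m_2;j\rangle_\pm$, where $l\in\mathbb N+\frac12$, $j\in\{\frac12,\frac32,\dots,l\}$, $j-|m_1|\in\mathbb N$ and $l+\frac12-j-|m_2|\in\mathbb N$ (vectors with inadmissible labels are read as $0$). For $l,j,m_2\in\mathbb Z+\frac12$ let $\epsilon=\epsilon(l,j,m_2)=\pm\frac12$ be the sign with $l+\epsilon-j-m_2\in2\mathbb Z$, and put $$A^+_{j,m_1}=q^{m_1-1}\tfrac{\sqrt{[j+m_1+1][j-m_1+1]}}{[2j+2]},\quad A^0_{j,m_1}=q^{-2}\tfrac{q^{j+m_1+1}[2][j-m_1]-[2j]}{[2j][2j+2]},$$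 $$B^+_{j,m_1}=q^{-j+m_1-\frac12}\tfrac{\sqrt{[j+m_1+1][j+m_1+2]}}{[2j+2]},\quad B^0_{j,m_1}=(1+q^2)q^{m_1-\frac12}\tfrac{\sqrt{[j-m_1][j+m_1+1]}}{[2j][2j+2]},\quad B^-_{j,m_1}=-q^{j+m_1+\frac12}\tfrac{\sqrt{[j-m_1][j-m_1-1]}}{[2j]},$$ $$C^+_{l,j,m_2}=-q^{m_2-1-\epsilon}\tfrac{\sqrt{[l+j+m_2+3+\epsilon][l+j-m_2+3-\epsilon]}}{[2l+4]},\quad C^-_{l,j,m_2}=-q^{m_2-1+\epsilon}\tfrac{\sqrt{[l-j+m_2-\epsilon][l-j-m_2+\epsilon]}}{[2l+2]},$$ $$C^0_{l,j,m_2}=[4\epsilon]\,q^{2\epsilon l+m_2-1+3\epsilon}\tfrac{\sqrt{[l+\frac12+j-2\epsilon m_2+2][l+\frac12-j-2\epsilon m_2]}}{[2l+2][2l+4]},$$ $$H^+_{l,j,m_2}=q^{m_2-1+\epsilon(2j+1)}\tfrac{\sqrt{[l+2\epsilon j-m_2+2+\epsilon][l-2\epsilon j+m_2+2-\epsilon]}}{[2l+4]},$$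 $$H^0_{l,j,m_2}=\tfrac{[l-\epsilon(2j+1)-m_2+1][l-\epsilon(2j+1)+m_2+2]-q^{-2}[l+\epsilon(2j+1)-m_2+2][l+\epsilon(2j+1)+m_2+1]}{[2l+2][2l+4]},$$ $$D^+_{l,j,m_2}=q^{-l+m_2-\frac32}\tfrac{\sqrt{[l+j+m_2+3+\epsilon][l-j+m_2+2-\epsilon]}}{[2l+4]},\quad D^-_{l,j,m_2}=-q^{l+m_2+\frac32}\tfrac{\sqrt{[l-j-m_2+\epsilon][l+j-m_2+1-\epsilon]}}{[2l+2]},$$ $$D^0_{l,j,m_2}=[2]q^{m_2+\frac12}\tfrac{\sqrt{[l-2\epsilon j-m_2+1-\epsilon][l-2\epsilon j+m_2+2-\epsilon]}}{[2l+2][2l+4]}.$$ Then there are unique bounded unital $*$-representations of $\mathcal A(S^4_q)$ on $\mathcal H_+$ and on $\mathcal H_-$ such that $$\begin{aligned}x_0|l,m_1,m_2;j\rangle_\pm=\ &A^+_{j,m_1}\big(C^+_{l,j,m_2}|l+1,m_1,m_2;j+1\rangle_\pm\mp C^0_{l,j,m_2}|l,m_1,m_2;j+1\rangle_\pm+C^-_{l,j,m_2}|l-1,m_1,m_2;j+1\rangle_\pm\big)\\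 +&A^0_{j,m_1}\big(H^+_{l,j,m_2}|l+1,m_1,m_2;j\rangle_\pm\pm H^0_{l,j,m_2}|l,m_1,m_2;j\rangle_\pm+H^+_{l-1,j,m_2}|l-1,m_1,m_2;j\rangle_\pm\big)\\ +&A^+_{j-1,m_1}\big(C^-_{l+1,j-1,m_2}|l+1,m_1,m_2;j-1\rangle_\pm\mp C^0_{l,j-1,m_2}|l,m_1,m_2;j-1\rangle_\pm+C^+_{l-1,j-1,m_2}|l-1,m_1,m_2;j-1\rangle_\pm\big),\end{aligned}$$ $x_1|l,m_1,m_2;j\rangle_\pm$ is given by the same expression with $A^+_{j,m_1},A^0_{j,m_1},A^+_{j-1,m_1}$ replaced by $B^+_{j,m_1},B^0_{j,m_1},B^-_{j,m_1}$ and with $m_1$ replaced by $m_1+1$ in all the vectors on the right, and $$x_2|l,m_1,m_2;j\rangle_\pm=D^+_{l,j,m_2}|l+1,m_1,m_2+1;j\rangle_\pm\pm D^0_{l,j,m_2}|l,m_1,m_2+1;j\rangle_\pm+D^-_{l,j,m_2}|l-1,m_1,m_2+1;j\rangle_\pm .$$ Let $\mathcal H=\mathcal H_+\oplus\mathcal H_-$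 carry the direct sum of these representations, let $\gamma=\pm1$ on $\mathcal H_\pm$, and let $F|l,m_1,m_2;j\rangle_\pm:=|l,m_1,m_2;j\rangle_\mp$. Then $(\mathcal A(S^4_q),\mathcal H,F,\gamma)$ is a $1$-summable even Fredholm module: $F=F^*$, $F^2=1$, $\gamma=\gamma^*$, $\gamma^2=1$, $\gamma F=-F\gamma$, $\gamma$ commutes with $\mathcal A(S^4_q)$, and $[F,a]$ is compact and of trace class for every $a\in\mathcal A(S^4_q)$. This Fredholm module is non-trivial: its index pairing with some idempotent matrix over $\mathcal A(S^4_q)$ is non-zero. In particular, the matrix $$e=\frac12\begin{pmatrix}1+x_0&q^3x_2&-qx_1&0\\ q^{-3}x_2^*&1-q^2x_0&0&q^3x_1\\ -q^{-1}x_1^*&0&1-q^2x_0&q^3x_2\\ 0&qx_1^*&q^{-3}x_2^*&1+q^4x_0\end{pmatrix}\in\mathrm{Mat}_4(\mathcal A(S^4_q))$$ is idempotent, the operator $F_e^+:e(\mathcal H_+\otimes\mathbb C^4)\to e(\mathcal H_-\otimes\mathbb C^4)$ obtained by restricting $\frac14(1-\gamma)eFe(1+\gamma)$ is Fredholm, $\gamma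 F[F,e]$ is of trace class on $\mathcal H\otimes\mathbb C^4$, and $$\mathrm{Index}(F_e^+)=\tfrac12\,\mathrm{Tr}_{\mathcal H\otimes\mathbb C^4}(\gamma F[F,e])=1 .$$ -/

import Mathlib

open scoped InnerProductSpace

noncomputable section

/-! ### Schatten ideals, trace and Fredholm index -/

section Operators

variable {H : Type*} [NormedAddCommGroup H] [InnerProductSpace ℂ H]

/-- The singular value `μ_{n+1}(T)`: the infimum over the `n`-dimensional subspaces `V` of the
norm of the restriction of `T` to the orthogonal complement of `V`. -/
def singularValue (T : H →L[ℂ] H) (n : ℕ) : ℝ :=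
  sInf {r : ℝ | ∃ V : Submodule ℂ H, FiniteDimensional ℂ V ∧ Module.finrank ℂ V = n ∧
    r = ‖T ∘L Vᗮ.subtypeL‖}

/-- Membership in the Schatten-von Neumann ideal `𝓛^p(H)`. -/
def IsSchatten (p : ℝ) (T : H →L[ℂ] H) : Prop :=
  IsCompactOperator T ∧ Summable (fun n : ℕ => singularValue T n ^ p)

/-- `T` is of trace class and its trace, computed in any orthonormal basis, is `t`. -/
def HasTrace {H : Type} [NormedAddCommGroup H] [InnerProductSpace ℂ H]
    (T : H →L[ℂ] H) (t : ℂ) : Prop :=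
  IsSchatten 1 T ∧ ∀ (ι : Type) (b : HilbertBasis ι ℂ H), HasSum (fun i => ⟪b i, T (b i)⟫_ℂ) t

/-- The index `dim ker T - dim coker T` (meaningful for Fredholm operators). -/
def fredholmIndex {X Y : Type*} [NormedAddCommGroup X] [NormedSpace ℂ X]
    [NormedAddCommGroup Y] [NormedSpace ℂ Y] (T : X →L[ℂ] Y) : ℤ :=
  (Module.finrank ℂ T.ker : ℤ) - (Module.finrank ℂ (Y ⧸ T.range) : ℤ)

/-- The Hilbert space `H ⊗ ℂ^N`. -/
abbrev Amplified (H : Type*) (N : ℕ) : Type _ := PiLp 2 (fun _ : Fin N => H)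

/-- The operator on `H ⊗ ℂ^N` with a given matrix of operators on `H`:
`(M v)_i = ∑ j, M_{ij} v_j`. -/
def blockOp {N : ℕ} (M : Matrix (Fin N) (Fin N) (H →L[ℂ] H)) :
    Amplified H N →L[ℂ] Amplified H N :=
  (PiLp.continuousLinearEquiv 2 ℂ (fun _ : Fin N => H)).symm.toContinuousLinearMap ∘L
    (ContinuousLinearMap.pi fun i => ∑ j, M i j ∘L ContinuousLinearMap.proj j) ∘L
    (PiLp.continuousLinearEquiv 2 ℂ (fun _ : Fin N => H)).toContinuousLinearMap

/-- `T ⊗ 1` on `H ⊗ ℂ^N`. -/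
def ampOp (N : ℕ) (T : H →L[ℂ] H) : Amplified H N →L[ℂ] Amplified H N :=
  blockOp (Matrix.diagonal fun _ => T)

end Operators

/-! ### Fredholm modules and the index pairing -/

section FredholmModules

variable {A : Type*} [Ring A] [StarRing A] [Algebra ℂ A]
variable {H : Type*} [NormedAddCommGroup H] [InnerProductSpace ℂ H] [CompleteSpace H]

/-- `(H, π, F)` is a Fredholm module over `A`. -/
structure IsFredholmModule (π : A →⋆ₐ[ℂ] (H →L[ℂ] H)) (F : H →L[ℂ] H) : Prop where
  selfAdjoint : star F = F
  sq_eq_one : F * F = 1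
  compact_commutator : ∀ a, IsCompactOperator (F * π a - π a * F)

/-- `(H, π, F, γ)` is an even Fredholm module over `A`. -/
structure IsEvenFredholmModule (π : A →⋆ₐ[ℂ] (H →L[ℂ] H)) (F γ : H →L[ℂ] H) : Prop
    extends IsFredholmModule π F where
  grading_selfAdjoint : star γ = γ
  grading_sq : γ * γ = 1
  grading_commute : ∀ a, γ * π a = π a * γ
  grading_anticommute : γ * F = -(F * γ)

/-- `p`-summability: `p ≥ 1` and all commutators `[F, π(a)]` lie in `𝓛^p(H)`. -/
def IsPSummable (p : ℝ) (π : A →⋆ₐ[ℂ] (H →L[ℂ] H)) (F : H →L[ℂ] H) : Prop :=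
  1 ≤ p ∧ ∀ a, IsSchatten p (F * π a - π a * F)

/-- The lift `π̃` of `π` to `Mat_N(A)`, acting on `H ⊗ ℂ^N`. -/
def matRep (π : A →⋆ₐ[ℂ] (H →L[ℂ] H)) {N : ℕ} (e : Matrix (Fin N) (Fin N) A) :
    Amplified H N →L[ℂ] Amplified H N :=
  blockOp (e.map fun a => π a)

/-- The operator `¼ (1 - γ) π̃(e) F π̃(e) (1 + γ)` on all of `H ⊗ ℂ^N`. -/
def cornerOp (π : A →⋆ₐ[ℂ] (H →L[ℂ] H)) (F γ : H →L[ℂ] H) {N : ℕ}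
    (e : Matrix (Fin N) (Fin N) A) : Amplified H N →L[ℂ] Amplified H N :=
  (1 / 4 : ℂ) • ((1 - ampOp N γ) * matRep π e * ampOp N F * matRep π e * (1 + ampOp N γ))

/-- The subspace `π̃(e)(H₊ ⊗ ℂ^N)`, where `H₊ = (1 + γ)H`. -/
def plusCorner (π : A →⋆ₐ[ℂ] (H →L[ℂ] H)) (γ : H →L[ℂ] H) {N : ℕ}
    (e : Matrix (Fin N) (Fin N) A) : Submodule ℂ (Amplified H N) :=
  (matRep π e * (1 + ampOp N γ)).range

/-- The subspace `π̃(e)(H₋ ⊗ ℂ^N)`, where `H₋ = (1 - γ)H`. It is written as the range of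
`(1 - γ) π̃(e)`, which is the same operator as `π̃(e) (1 - γ)` since `γ` commutes with `π(A)`. -/
def minusCorner (π : A →⋆ₐ[ℂ] (H →L[ℂ] H)) (γ : H →L[ℂ] H) {N : ℕ}
    (e : Matrix (Fin N) (Fin N) A) : Submodule ℂ (Amplified H N) :=
  ((1 - ampOp N γ) * matRep π e).range

theorem cornerOp_mem (π : A →⋆ₐ[ℂ] (H →L[ℂ] H)) (F γ : H →L[ℂ] H) {N : ℕ}
    (e : Matrix (Fin N) (Fin N) A) (x : Amplified H N) :
    cornerOp π F γ e x ∈ minusCorner π γ e :=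
  Submodule.smul_mem _ _ ⟨(ampOp N F * matRep π e * (1 + ampOp N γ)) x, rfl⟩

/-- `F_e⁺ : π̃(e)(H₊ ⊗ ℂ^N) → π̃(e)(H₋ ⊗ ℂ^N)`, `F_e⁺ = ¼ (1 - γ) π̃(e) F π̃(e) (1 + γ)`. -/
def fredholmPlus (π : A →⋆ₐ[ℂ] (H →L[ℂ] H)) (F γ : H →L[ℂ] H) {N : ℕ}
    (e : Matrix (Fin N) (Fin N) A) : plusCorner π γ e →L[ℂ] minusCorner π γ e :=
  (cornerOp π F γ e ∘L (plusCorner π γ e).subtypeL).codRestrict (minusCorner π γ e)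
    fun x => cornerOp_mem π F γ e x

/-- The operator `γ F [F, π̃(e)]` on `H ⊗ ℂ^N`. -/
def pairingOp (π : A →⋆ₐ[ℂ] (H →L[ℂ] H)) (F γ : H →L[ℂ] H) {N : ℕ}
    (e : Matrix (Fin N) (Fin N) A) : Amplified H N →L[ℂ] Amplified H N :=
  ampOp N γ * ampOp N F * (ampOp N F * matRep π e - matRep π e * ampOp N F)

/-- Non-triviality of the index pairing with the `K₀`-group of `A`. -/
def IsNontrivialModule (π : A →⋆ₐ[ℂ] (H →L[ℂ] H)) (F γ : H →L[ℂ] H) : Prop :=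
  ∃ (N : ℕ) (e : Matrix (Fin N) (Fin N) A), IsIdempotentElem e ∧
    (fredholmPlus π F γ e).IsFredholm ∧ fredholmIndex (fredholmPlus π F γ e) ≠ 0

end FredholmModules

/-! ### Direct sums of two copies of a Hilbert space -/

section DirectSum

variable {E : Type*} [NormedAddCommGroup E] [InnerProductSpace ℂ E]

/-- The operator on `E ⊕ E` with matrix `(S 0; 0 T)`. -/
def diagOp (S T : E →L[ℂ] E) : WithLp 2 (E × E) →L[ℂ] WithLp 2 (E × E) :=
  (WithLp.prodContinuousLinearEquiv 2 ℂ E E).symm.toContinuousLinearMap ∘L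
    (S.prodMap T) ∘L (WithLp.prodContinuousLinearEquiv 2 ℂ E E).toContinuousLinearMap

/-- The flip `(x, y) ↦ (y, x)` of `E ⊕ E`. -/
def flipOp (E : Type*) [NormedAddCommGroup E] [InnerProductSpace ℂ E] :
    WithLp 2 (E × E) →L[ℂ] WithLp 2 (E × E) :=
  (WithLp.prodContinuousLinearEquiv 2 ℂ E E).symm.toContinuousLinearMap ∘L
    ((ContinuousLinearMap.snd ℂ E E).prod (ContinuousLinearMap.fst ℂ E E)) ∘L
    (WithLp.prodContinuousLinearEquiv 2 ℂ E E).toContinuousLinearMap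

/-- The natural grading `(x, y) ↦ (x, -y)` of `E ⊕ E`. -/
def gradingOp (E : Type*) [NormedAddCommGroup E] [InnerProductSpace ℂ E] :
    WithLp 2 (E × E) →L[ℂ] WithLp 2 (E × E) :=
  diagOp 1 (-1)

theorem diagOp_apply (S T : E →L[ℂ] E) (v : WithLp 2 (E × E)) :
    diagOp S T v = WithLp.toLp 2 (S v.fst, T v.snd) := rfl

theorem star_diagOp [CompleteSpace E] (S T : E →L[ℂ] E) :
    star (diagOp S T) = diagOp (star S) (star T) := by
  symm
  rw [ContinuousLinearMap.star_eq_adjoint (diagOp S T), ContinuousLinearMap.eq_adjoint_iff]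
  intro v w
  simp [diagOp_apply, WithLp.prod_inner_apply, ContinuousLinearMap.star_eq_adjoint,
    ContinuousLinearMap.adjoint_inner_left]

/-- The direct sum `ρ₁ ⊕ ρ₂` of two `*`-representations. -/
def directSumRep [CompleteSpace E] {A : Type*} [Ring A] [StarRing A] [Algebra ℂ A]
    (ρ₁ ρ₂ : A →⋆ₐ[ℂ] (E →L[ℂ] E)) :
    A →⋆ₐ[ℂ] (WithLp 2 (E × E) →L[ℂ] WithLp 2 (E × E)) where
  toFun a := diagOp (ρ₁ a) (ρ₂ a)
  map_one' := by
    ext v : 1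
    simp only [diagOp_apply, map_one]
    rfl
  map_mul' a b := by ext v; simp [diagOp_apply]
  map_zero' := by ext v; simp [diagOp_apply]
  map_add' a b := by
    ext v : 1
    simp only [diagOp_apply, map_add, add_apply]
    rfl
  commutes' c := by
    ext v : 1
    simp only [diagOp_apply, AlgHomClass.commutes]
    rfl
  map_star' a := by rw [map_star, map_star, star_diagOp]

end DirectSum

/-! ### The coordinate algebra of the quantum orthogonal 4-sphere -/

namespace QuantumSphere

/-- The generators `x₀ = x₀*, x₁, x₁*, x₂, x₂*`. -/
inductive Gen : Type
  | x0 | x1 | x1s | x2 | x2s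

/-- The involution on generators. -/
def Gen.adj : Gen → Gen
  | .x0 => .x0
  | .x1 => .x1s
  | .x1s => .x1
  | .x2 => .x2s
  | .x2s => .x2

/-- `x_i` in the free algebra. -/
def fx (i : Fin 3) : FreeAlgebra ℂ Gen := FreeAlgebra.ι ℂ (![Gen.x0, Gen.x1, Gen.x2] i)

/-- `x_i*` in the free algebra. -/
def fxs (i : Fin 3) : FreeAlgebra ℂ Gen := FreeAlgebra.ι ℂ (![Gen.x0, Gen.x1s, Gen.x2s] i)

/-- The defining relations, together with their adjoints. -/
inductive Rel (q : ℝ) : FreeAlgebra ℂ Gen → FreeAlgebra ℂ Gen → Prop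
  | comm (i j : Fin 3) : i < j → Rel q (fx i * fx j) ((q : ℂ) ^ 2 • (fx j * fx i))
  | comm_adj (i j : Fin 3) : i < j → Rel q (fxs j * fxs i) ((q : ℂ) ^ 2 • (fxs i * fxs j))
  | cross (i j : Fin 3) : i ≠ j → Rel q (fxs i * fx j) ((q : ℂ) ^ 2 • (fx j * fxs i))
  | u1 : Rel q (fxs 1 * fx 1 - fx 1 * fxs 1) ((1 - (q : ℂ) ^ 4) • (fx 0 * fx 0))
  | u2 : Rel q (fxs 2 * fx 2 - fx 2 * fxs 2) (fxs 1 * fx 1 - (q : ℂ) ^ 4 • (fx 1 * fxs 1))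
  | radius : Rel q (fx 0 * fx 0 + fx 1 * fxs 1 + fx 2 * fxs 2) 1

/-- The algebra `A(S⁴_q)`. -/
def S4 (q : ℝ) : Type := RingQuot (Rel q)

instance (q : ℝ) : Ring (S4 q) := inferInstanceAs (Ring (RingQuot (Rel q)))

instance (q : ℝ) : Algebra ℂ (S4 q) := inferInstanceAs (Algebra ℂ (RingQuot (Rel q)))

/-- The quotient map from the free algebra. -/
def mk (q : ℝ) : FreeAlgebra ℂ Gen →ₐ[ℂ] S4 q := RingQuot.mkAlgHom ℂ (Rel q)

theorem mk_rel {q : ℝ} {a b : FreeAlgebra ℂ Gen} (h : Rel q a b) : mk q a = mk q b :=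
  RingQuot.mkAlgHom_rel ℂ h

theorem mk_surjective (q : ℝ) : Function.Surjective (mk q) :=
  RingQuot.mkAlgHom_surjective ℂ (Rel q)

/-- The opposite algebra of `A(S⁴_q)` with complex-conjugate scalar multiplication. -/
@[reducible] def conjAlg (q : ℝ) : Algebra ℂ (S4 q)ᵐᵒᵖ :=
  RingHom.toAlgebra' ((algebraMap ℂ (S4 q)ᵐᵒᵖ).comp (starRingEnd ℂ))
    fun c x => Algebra.commutes (starRingEnd ℂ c) x

/-- The conjugate-linear antihomomorphism from the free algebra to `A(S⁴_q)` that exchanges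
`x_i` and `x_i*`. -/
def preStar (q : ℝ) : FreeAlgebra ℂ Gen →+* (S4 q)ᵐᵒᵖ :=
  letI := conjAlg q
  (FreeAlgebra.lift ℂ fun g => MulOpposite.op (mk q (FreeAlgebra.ι ℂ g.adj))).toRingHom

theorem preStar_ι (q : ℝ) (g : Gen) :
    preStar q (FreeAlgebra.ι ℂ g) = MulOpposite.op (mk q (FreeAlgebra.ι ℂ g.adj)) :=
  letI := conjAlg q
  FreeAlgebra.lift_ι_apply (R := ℂ)
    (fun g => MulOpposite.op (mk q (FreeAlgebra.ι ℂ g.adj)) : Gen → (S4 q)ᵐᵒᵖ) g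

theorem preStar_algebraMap (q : ℝ) (c : ℂ) :
    preStar q (algebraMap ℂ _ c) = MulOpposite.op (algebraMap ℂ (S4 q) (starRingEnd ℂ c)) :=
  letI := conjAlg q
  AlgHom.commutes (FreeAlgebra.lift ℂ fun g : Gen =>
    (MulOpposite.op (mk q (FreeAlgebra.ι ℂ g.adj)) : (S4 q)ᵐᵒᵖ)) c

theorem preStar_smul (q : ℝ) (c : ℂ) (a : FreeAlgebra ℂ Gen) :
    preStar q (c • a) = MulOpposite.op (starRingEnd ℂ c • (preStar q a).unop) := by
  rw [Algebra.smul_def, map_mul, preStar_algebraMap, Algebra.smul_def, Algebra.commutes]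
  rfl

theorem preStar_fx (q : ℝ) (i : Fin 3) : preStar q (fx i) = MulOpposite.op (mk q (fxs i)) := by
  fin_cases i <;> exact preStar_ι q _

theorem fxs_zero : fxs 0 = fx 0 := rfl

theorem preStar_fxs (q : ℝ) (i : Fin 3) : preStar q (fxs i) = MulOpposite.op (mk q (fx i)) := by
  fin_cases i <;> exact preStar_ι q _

theorem preStar_rel (q : ℝ) ⦃a b : FreeAlgebra ℂ Gen⦄ (h : Rel q a b) :
    preStar q a = preStar q b := by
  apply MulOpposite.unop_injective
  cases h with
  | comm i j hij =>
    simpa [preStar_smul, preStar_fx] using mk_rel (Rel.comm_adj (q := q) i j hij)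
  | comm_adj i j hij =>
    simpa [preStar_smul, preStar_fxs] using mk_rel (Rel.comm (q := q) i j hij)
  | cross i j hij =>
    simpa [preStar_smul, preStar_fx, preStar_fxs] using mk_rel (Rel.cross (q := q) j i hij.symm)
  | u1 => simpa [preStar_smul, preStar_fx, preStar_fxs, fxs_zero] using mk_rel (Rel.u1 (q := q))
  | u2 => simpa [preStar_smul, preStar_fx, preStar_fxs] using mk_rel (Rel.u2 (q := q))
  | radius => simpa [preStar_fx, preStar_fxs, fxs_zero] using mk_rel (Rel.radius (q := q))

/-- The involution of `A(S⁴_q)` as a ring antihomomorphism. -/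
def starHom (q : ℝ) : S4 q →+* (S4 q)ᵐᵒᵖ := RingQuot.lift ⟨preStar q, preStar_rel q⟩

theorem starHom_mk (q : ℝ) (a : FreeAlgebra ℂ Gen) : starHom q (mk q a) = preStar q a := by
  have h : mk q a = RingQuot.mkRingHom (Rel q) a := by
    rw [← RingQuot.mkAlgHom_coe ℂ (Rel q)]; rfl
  rw [h]
  exact RingQuot.lift_mkRingHom_apply (preStar q) (preStar_rel q) a

theorem starHom_starHom (q : ℝ) (a : S4 q) :
    (starHom q (starHom q a).unop).unop = a := by
  obtain ⟨a, rfl⟩ := mk_surjective q a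
  rw [starHom_mk]
  induction a using FreeAlgebra.induction with
  | grade0 c =>
    rw [preStar_algebraMap, MulOpposite.unop_op, ← AlgHom.commutes (mk q), starHom_mk,
      preStar_algebraMap]
    simp
  | grade1 g =>
    rw [preStar_ι, MulOpposite.unop_op, starHom_mk, preStar_ι]
    cases g <;> rfl
  | mul a b ha hb => simp [ha, hb]
  | add a b ha hb => simp [ha, hb]

instance (q : ℝ) : StarRing (S4 q) where
  star a := (starHom q a).unop
  star_involutive := starHom_starHom q
  star_mul a b := by simp
  star_add a b := by simp

instance (q : ℝ) : StarModule ℂ (S4 q) where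
  star_smul c a := by
    obtain ⟨a, rfl⟩ := mk_surjective q a
    change (starHom q (c • mk q a)).unop = star c • (starHom q (mk q a)).unop
    rw [← map_smul, starHom_mk, starHom_mk, preStar_smul]
    rfl

/-- The generator `x_i` of `A(S⁴_q)`; its adjoint is `star (x q i)`. -/
def x (q : ℝ) (i : Fin 3) : S4 q := mk q (fx i)

theorem star_x (q : ℝ) (i : Fin 3) : star (x q i) = mk q (fxs i) := by
  change (starHom q (mk q (fx i))).unop = _
  rw [starHom_mk, preStar_fx]
  rfl

/-- The idempotent `e ∈ Mat₄(A(S⁴_q))`. -/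
def e (q : ℝ) : Matrix (Fin 4) (Fin 4) (S4 q) :=
  let c : ℤ → ℂ := fun k => (q : ℂ) ^ k
  (1 / 2 : ℂ) •
    !![1 + x q 0, c 3 • x q 2, -(c 1 • x q 1), 0;
       c (-3) • star (x q 2), 1 - c 2 • x q 0, 0, c 3 • x q 1;
       -(c (-1) • star (x q 1)), 0, 1 - c 2 • x q 0, c 3 • x q 2;
       0, c 1 • star (x q 1), c (-3) • star (x q 2), 1 + c 4 • x q 0]

/-! ### The chiral representations

The basis vector `|l, m₁, m₂; j⟩` is labelled by the integers `(L, M₁, M₂, J)` with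
`l = L + 1/2`, `m₁ = M₁ + 1/2`, `m₂ = M₂ + 1/2`, `j = J + 1/2`. -/

/-- `j ∈ {1/2, …, l}`, `j - |m₁| ∈ ℕ` and `l + 1/2 - j - |m₂| ∈ ℕ`. -/
def Admissible (L M₁ M₂ J : ℤ) : Prop :=
  0 ≤ J ∧ J ≤ L ∧ (-J - 1 ≤ M₁ ∧ M₁ ≤ J) ∧ (-(L - J) - 1 ≤ M₂ ∧ M₂ ≤ L - J)

/-- The set of labels of the orthonormal basis. -/
abbrev Label : Type := {v : ℤ × ℤ × ℤ × ℤ // Admissible v.1 v.2.1 v.2.2.1 v.2.2.2}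

/-- The Hilbert space with orthonormal basis `|l, m₁, m₂; j⟩`. -/
abbrev Spinors : Type := lp (fun _ : Label => ℂ) 2

open Classical in
/-- The basis vector `|l, m₁, m₂; j⟩`, read as zero if the label is not admissible. -/
def ket (L M₁ M₂ J : ℤ) : Spinors :=
  if h : Admissible L M₁ M₂ J then lp.single 2 (⟨(L, M₁, M₂, J), h⟩ : Label) 1 else 0

/-- The `q`-number `[z]`. -/
def qnum (q z : ℝ) : ℝ := (q ^ z - q ^ (-z)) / (q - q⁻¹)

/-- The half-integer `k + 1/2`. -/
def half (k : ℤ) : ℝ := (k : ℝ) + 1 / 2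

/-- The sign `ε = ±1/2` such that `l + ε - j - m₂` is an even integer. -/
def eps (L J M₂ : ℤ) : ℝ := if Even (L - J - M₂) then 1 / 2 else -(1 / 2)

section Coefficients

variable (q : ℝ)

def Ap (J M₁ : ℤ) : ℝ :=
  let j := half J
  let m := half M₁
  q ^ (m - 1) * √(qnum q (j + m + 1) * qnum q (j - m + 1)) / qnum q (2 * j + 2)

def A0 (J M₁ : ℤ) : ℝ :=
  let j := half J
  let m := half M₁
  q ^ (-2 : ℝ) * (q ^ (j + m + 1) * qnum q 2 * qnum q (j - m) - qnum q (2 * j)) /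
    (qnum q (2 * j) * qnum q (2 * j + 2))

def Bp (J M₁ : ℤ) : ℝ :=
  let j := half J
  let m := half M₁
  q ^ (-j + m - 1 / 2) * √(qnum q (j + m + 1) * qnum q (j + m + 2)) / qnum q (2 * j + 2)

def B0 (J M₁ : ℤ) : ℝ :=
  let j := half J
  let m := half M₁
  (1 + q ^ 2) * q ^ (m - 1 / 2) * √(qnum q (j - m) * qnum q (j + m + 1)) /
    (qnum q (2 * j) * qnum q (2 * j + 2))

def Bm (J M₁ : ℤ) : ℝ :=
  let j := half J
  let m := half M₁;
  -(q ^ (j + m + 1 / 2) * √(qnum q (j - m) * qnum q (j - m - 1)) / qnum q (2 * j))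

def Cp (L J M₂ : ℤ) : ℝ :=
  let l := half L
  let j := half J
  let m := half M₂
  let ε := eps L J M₂;
  -(q ^ (m - 1 - ε) * √(qnum q (l + j + m + 3 + ε) * qnum q (l + j - m + 3 - ε)) /
    qnum q (2 * l + 4))

def C0 (L J M₂ : ℤ) : ℝ :=
  let l := half L
  let j := half J
  let m := half M₂
  let ε := eps L J M₂
  qnum q (4 * ε) * q ^ (2 * ε * l + m - 1 + 3 * ε) *
    √(qnum q (l + 1 / 2 + j - 2 * ε * m + 2) * qnum q (l + 1 / 2 - j - 2 * ε * m)) /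
    (qnum q (2 * l + 2) * qnum q (2 * l + 4))

def Cm (L J M₂ : ℤ) : ℝ :=
  let l := half L
  let j := half J
  let m := half M₂
  let ε := eps L J M₂;
  -(q ^ (m - 1 + ε) * √(qnum q (l - j + m - ε) * qnum q (l - j - m + ε)) / qnum q (2 * l + 2))

def Hp (L J M₂ : ℤ) : ℝ :=
  let l := half L
  let j := half J
  let m := half M₂
  let ε := eps L J M₂
  q ^ (m - 1 + ε * (2 * j + 1)) *
    √(qnum q (l + 2 * ε * j - m + 2 + ε) * qnum q (l - 2 * ε * j + m + 2 - ε)) /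
    qnum q (2 * l + 4)

def H0 (L J M₂ : ℤ) : ℝ :=
  let l := half L
  let j := half J
  let m := half M₂
  let ε := eps L J M₂
  (qnum q (l - ε * (2 * j + 1) - m + 1) * qnum q (l - ε * (2 * j + 1) + m + 2) -
      q ^ (-2 : ℝ) *
        (qnum q (l + ε * (2 * j + 1) - m + 2) * qnum q (l + ε * (2 * j + 1) + m + 1))) /
    (qnum q (2 * l + 2) * qnum q (2 * l + 4))

def Dp (L J M₂ : ℤ) : ℝ :=
  let l := half L
  let j := half J
  let m := half M₂
  let ε := eps L J M₂
  q ^ (-l + m - 3 / 2) * √(qnum q (l + j + m + 3 + ε) * qnum q (l - j + m + 2 - ε)) /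
    qnum q (2 * l + 4)

def D0 (L J M₂ : ℤ) : ℝ :=
  let l := half L
  let j := half J
  let m := half M₂
  let ε := eps L J M₂
  qnum q 2 * q ^ (m + 1 / 2) *
    √(qnum q (l - 2 * ε * j - m + 1 - ε) * qnum q (l - 2 * ε * j + m + 2 - ε)) /
    (qnum q (2 * l + 2) * qnum q (2 * l + 4))

def Dm (L J M₂ : ℤ) : ℝ :=
  let l := half L
  let j := half J
  let m := half M₂
  let ε := eps L J M₂;
  -(q ^ (l + m + 3 / 2) * √(qnum q (l - j - m + ε) * qnum q (l + j - m + 1 - ε)) /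
    qnum q (2 * l + 2))

/-- `r |l, m₁, m₂; j⟩` with a real coefficient `r`. -/
def termKet (r : ℝ) (L M₁ M₂ J : ℤ) : Spinors := (r : ℂ) • ket L M₁ M₂ J

/-- `ρ` is the chiral `*`-representation of `A(S⁴_q)` with sign `s = ±1`. -/
structure IsChiralRep (s : ℝ) (ρ : S4 q →⋆ₐ[ℂ] (Spinors →L[ℂ] Spinors)) : Prop where
  x0_ket : ∀ L M₁ M₂ J : ℤ, Admissible L M₁ M₂ J → ρ (x q 0) (ket L M₁ M₂ J) =
      termKet (Ap q J M₁ * Cp q L J M₂) (L + 1) M₁ M₂ (J + 1)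
    + termKet (-s * (Ap q J M₁ * C0 q L J M₂)) L M₁ M₂ (J + 1)
    + termKet (Ap q J M₁ * Cm q L J M₂) (L - 1) M₁ M₂ (J + 1)
    + termKet (A0 q J M₁ * Hp q L J M₂) (L + 1) M₁ M₂ J
    + termKet (s * (A0 q J M₁ * H0 q L J M₂)) L M₁ M₂ J
    + termKet (A0 q J M₁ * Hp q (L - 1) J M₂) (L - 1) M₁ M₂ J
    + termKet (Ap q (J - 1) M₁ * Cm q (L + 1) (J - 1) M₂) (L + 1) M₁ M₂ (J - 1)
    + termKet (-s * (Ap q (J - 1) M₁ * C0 q L (J - 1) M₂)) L M₁ M₂ (J - 1)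
    + termKet (Ap q (J - 1) M₁ * Cp q (L - 1) (J - 1) M₂) (L - 1) M₁ M₂ (J - 1)
  x1_ket : ∀ L M₁ M₂ J : ℤ, Admissible L M₁ M₂ J → ρ (x q 1) (ket L M₁ M₂ J) =
      termKet (Bp q J M₁ * Cp q L J M₂) (L + 1) (M₁ + 1) M₂ (J + 1)
    + termKet (-s * (Bp q J M₁ * C0 q L J M₂)) L (M₁ + 1) M₂ (J + 1)
    + termKet (Bp q J M₁ * Cm q L J M₂) (L - 1) (M₁ + 1) M₂ (J + 1)
    + termKet (B0 q J M₁ * Hp q L J M₂) (L + 1) (M₁ + 1) M₂ J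
    + termKet (s * (B0 q J M₁ * H0 q L J M₂)) L (M₁ + 1) M₂ J
    + termKet (B0 q J M₁ * Hp q (L - 1) J M₂) (L - 1) (M₁ + 1) M₂ J
    + termKet (Bm q J M₁ * Cm q (L + 1) (J - 1) M₂) (L + 1) (M₁ + 1) M₂ (J - 1)
    + termKet (-s * (Bm q J M₁ * C0 q L (J - 1) M₂)) L (M₁ + 1) M₂ (J - 1)
    + termKet (Bm q J M₁ * Cp q (L - 1) (J - 1) M₂) (L - 1) (M₁ + 1) M₂ (J - 1)
  x2_ket : ∀ L M₁ M₂ J : ℤ, Admissible L M₁ M₂ J → ρ (x q 2) (ket L M₁ M₂ J) =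
      termKet (Dp q L J M₂) (L + 1) M₁ (M₂ + 1) J
    + termKet (s * D0 q L J M₂) L M₁ (M₂ + 1) J
    + termKet (Dm q L J M₂) (L - 1) M₁ (M₂ + 1) J

end Coefficients

/-- `F |l, m₁, m₂; j⟩_± = |l, m₁, m₂; j⟩_∓` on `H = H₊ ⊕ H₋`. -/
abbrev F : WithLp 2 (Spinors × Spinors) →L[ℂ] WithLp 2 (Spinors × Spinors) := flipOp Spinors

/-- The natural grading of `H = H₊ ⊕ H₋`. -/
abbrev γ : WithLp 2 (Spinors × Spinors) →L[ℂ] WithLp 2 (Spinors × Spinors) := gradingOp Spinors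

end QuantumSphere

end

/-! The square roots in the matrix coefficients come only from normalising the basis. After
rescaling the basis vectors (`Phi`, with weights built from `q`-factorials in `N1` and `N2`), every
coefficient is a rational function of `q` and of integer powers of `q`. The operators then make
sense on the free module `Lat` on all integer labels, and the relations of the algebra become
identities between rational functions.

These identities are organised as in the Wigner–Eckart theorem. Each of `x₀, x₁, x₁*` is a sum of a
coefficient in `(j, m₁)` times a reduced operator `Vp`, `Vz` or `Vm`, which acts on `(l, m₂, j)` and
raises, keeps or lowers `j`. The operator `x₂` acts on `(l, m₂, j)` alone. Every relation follows
from a few identities between the reduced operators: `Vz` commutes with `Vp` and `Vm`, all three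
`q²`-commute with `x₂`, and `Vp_Vm`, `Vm_Vp` express the mixed products through `1 - x₂x₂*` and
`Vz²`.

On admissible labels a coefficient that would lead outside the admissible region vanishes, so the
admissible span is invariant; the rescaling also makes the operators adjoint to each other
(`edge_out`, `edge_adj`). Paired with a vector, the relation `x₀² + x₁x₁* + x₂x₂* = 1` shows that
`x₀, x₁*, x₂*` are contractions, hence extend to the Hilbert space. All relations are invariant
under `x_i ↦ -x_i`; this symmetry, combined with the weight `s ^ L`, produces both chiral
representations from one computation. Uniqueness holds because a bounded operator is determined by
its values on the kets.

In `ρ₊ - ρ₋`, evaluated on a generator, only the terms with unchanged `l` survive. Their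
coefficients are `O(q^(2l))`, whereas the number of labels with given `l` grows polynomially. So the
difference is of trace class on generators, and by the Leibniz rule on the whole algebra
(`isSmooth_sub`). This gives the Fredholm module and its summability.

For the index, `F_e⁺` has a parametrix modulo trace class operators, and the index is the difference
of the two traces of the errors (`fredholmIndex_eq_trace_sub`). For a graded involution this becomes
`½ Tr(γF[F,e])` (`fredholmIndex_graded`), which here equals `Tr(ρ₊(tr e) - ρ₋(tr e))`. Since `tr e =
2 + ½(1 - q²)² x₀`, only `Tr(ρ₊(x₀) - ρ₋(x₀)) = 2 ∑ A⁰H⁰` is needed. Summed over `m₂, l` and then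
over `m₁, j`, this series telescopes twice and gives `2/(1 - q²)²` (`hasSum_A0_mul_H0`), so the
index is 1. -/

noncomputable section
namespace QuantumSphere

/-- The bracket `[k]` as a function of `x = q ^ k`. -/
def br (q x : ℝ) : ℝ := (x - x⁻¹) / (q - q⁻¹)

/-! ### Rational coefficients and reduced operators on the free module -/

section Coefs

/-- Throughout, `a = q ^ L`, `c = q ^ M₂` and `d = q ^ (±(J + 1))`. The suffixes `P`, `Z`, `M` stand
for `l + 1`, `l`, `l - 1`. The families `u` and `w` belong to the two parities of `l + 1/2 - j -
m₂`: a family that raises `j` at one parity lowers it at the other with `d` inverted, by the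
symmetry `J + 1 ↦ -(J + 1)`. The family `h` keeps `j`, `d` is for `x₂`, and `t` for its adjoint. -/
def uP (q a c _ : ℝ) : ℝ := -c / br q (a ^ 2 * q ^ 5)
def uM (q a c d : ℝ) : ℝ := -c * br q (a * c * q / d) * br q (a * q / (c * d)) / br q (a ^ 2 * q ^ 3)
def uZ (q a c d : ℝ) : ℝ := -((q + q⁻¹) * a * c * q ^ 2 * br q (a * q / (c * d)) /
  (br q (a ^ 2 * q ^ 3) * br q (a ^ 2 * q ^ 5)))
def wP (q a c _ : ℝ) : ℝ := -c * q / br q (a ^ 2 * q ^ 5)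
def wM (q a c d : ℝ) : ℝ := -c / q * br q (a * c * d * q ^ 2) * br q (a * d / c) / br q (a ^ 2 * q ^ 3)
def wZ (q a c d : ℝ) : ℝ := (q + q⁻¹) * c / (a * q ^ 2) * br q (a * c * d * q ^ 2) /
  (br q (a ^ 2 * q ^ 3) * br q (a ^ 2 * q ^ 5))
def hP (q a c d : ℝ) : ℝ := c * d / br q (a ^ 2 * q ^ 5)
def hM (q a c d : ℝ) : ℝ := c / (d * q) * br q (a * q / (c * d)) * br q (a * c * d * q ^ 2) /
  br q (a ^ 2 * q ^ 3)
def hZ (q a c d : ℝ) : ℝ := (br q (a * q / (c * d)) * br q (a * c / d * q ^ 3) -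
    (q ^ 2)⁻¹ * br q (a * d / c * q ^ 2) * br q (a * c * d * q ^ 2)) /
  (br q (a ^ 2 * q ^ 3) * br q (a ^ 2 * q ^ 5))
def dP (q a c _ : ℝ) : ℝ := c / (a * q) / br q (a ^ 2 * q ^ 5)
def dM (q a c d : ℝ) : ℝ := -(a * c * q ^ 2) * br q (a * q / (c * d)) * br q (a * d / c) / br q (a ^ 2 * q ^ 3)
def dZ (q a c d : ℝ) : ℝ := (q + q⁻¹) * c * q * br q (a * q / (c * d)) /
  (br q (a ^ 2 * q ^ 3) * br q (a ^ 2 * q ^ 5))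
def tM (q a c d : ℝ) : ℝ := c / (a * q ^ 2) * br q (a * c * d * q ^ 2) * br q (a * c / d * q) /
  br q (a ^ 2 * q ^ 3)
def tP (q a c _ : ℝ) : ℝ := -(a * c * q ^ 3) / br q (a ^ 2 * q ^ 5)
def tZ (q a c d : ℝ) : ℝ := (q + q⁻¹) * c * br q (a * c * d * q ^ 2) /
  (br q (a ^ 2 * q ^ 3) * br q (a ^ 2 * q ^ 5))

end Coefs

/-- The parity of `l + 1/2 - j - m₂`. -/
def par (L J M : ℤ) : Prop := Even (L - J - M)

theorem par_L_add {L J M : ℤ} : par (L + 1) J M ↔ ¬ par L J M := by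
  unfold par; rw [← Int.even_add_one]; ring_nf
theorem par_L_sub {L J M : ℤ} : par (L - 1) J M ↔ ¬ par L J M := by
  unfold par; rw [← Int.even_sub_one]; ring_nf
theorem par_J_add {L J M : ℤ} : par L (J + 1) M ↔ ¬ par L J M := by
  unfold par; rw [← Int.even_sub_one]; ring_nf
theorem par_J_sub {L J M : ℤ} : par L (J - 1) M ↔ ¬ par L J M := by
  unfold par; rw [← Int.even_add_one]; ring_nf
theorem par_M_add {L J M : ℤ} : par L J (M + 1) ↔ ¬ par L J M := by
  unfold par; rw [← Int.even_sub_one]; ring_nf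
theorem par_M_sub {L J M : ℤ} : par L J (M - 1) ↔ ¬ par L J M := by
  unfold par; rw [← Int.even_add_one]; ring_nf

/-- The free module on all labels. -/
abbrev Lat : Type := (ℤ × ℤ × ℤ × ℤ) →₀ ℂ

def k (L M₁ M₂ J : ℤ) : Lat := Finsupp.single (L, M₁, M₂, J) 1

/-- The linear map with given values on the basis. -/
def latMap (f : ℤ → ℤ → ℤ → ℤ → Lat) : Lat →ₗ[ℂ] Lat :=
  Finsupp.linearCombination ℂ fun v : ℤ × ℤ × ℤ × ℤ => f v.1 v.2.1 v.2.2.1 v.2.2.2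

theorem latMap_k (f : ℤ → ℤ → ℤ → ℤ → Lat) (L M₁ M₂ J : ℤ) :
    latMap f (k L M₁ M₂ J) = f L M₁ M₂ J := by
  simp [latMap, k]

variable (q : ℝ)

open Classical in
-- The reduced parts of `x₀, x₁, x₁*` that raise, lower and keep `j` are `Vp`, `Vm` and `Vz`; `Dop`
-- and `Dst` are `x₂` and `x₂*`.
def Vp : Lat →ₗ[ℂ] Lat := latMap fun L M₁ M₂ J =>
  let a := q ^ L
  let c := q ^ M₂
  let d := q ^ (J + 1)
  if par L J M₂ then
    uP q a c d • k (L + 1) M₁ M₂ (J + 1) + uZ q a c d • k L M₁ M₂ (J + 1) +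
      uM q a c d • k (L - 1) M₁ M₂ (J + 1)
  else
    wP q a c d⁻¹ • k (L + 1) M₁ M₂ (J + 1) + wZ q a c d⁻¹ • k L M₁ M₂ (J + 1) +
      wM q a c d⁻¹ • k (L - 1) M₁ M₂ (J + 1)

open Classical in
def Vm : Lat →ₗ[ℂ] Lat := latMap fun L M₁ M₂ J =>
  let a := q ^ L
  let c := q ^ M₂
  let d := q ^ (J + 1)
  if par L J M₂ then
    wP q a c d • k (L + 1) M₁ M₂ (J - 1) + wZ q a c d • k L M₁ M₂ (J - 1) +
      wM q a c d • k (L - 1) M₁ M₂ (J - 1)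
  else
    uP q a c d⁻¹ • k (L + 1) M₁ M₂ (J - 1) + uZ q a c d⁻¹ • k L M₁ M₂ (J - 1) +
      uM q a c d⁻¹ • k (L - 1) M₁ M₂ (J - 1)

open Classical in
def Vz : Lat →ₗ[ℂ] Lat := latMap fun L M₁ M₂ J =>
  let a := q ^ L
  let c := q ^ M₂
  let d := if par L J M₂ then q ^ (J + 1) else (q ^ (J + 1))⁻¹
  hP q a c d • k (L + 1) M₁ M₂ J + hZ q a c d • k L M₁ M₂ J + hM q a c d • k (L - 1) M₁ M₂ J

open Classical in
def Dop : Lat →ₗ[ℂ] Lat := latMap fun L M₁ M₂ J =>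
  let a := q ^ L
  let c := q ^ M₂
  let d := if par L J M₂ then q ^ (J + 1) else (q ^ (J + 1))⁻¹
  dP q a c d • k (L + 1) M₁ (M₂ + 1) J + dZ q a c d • k L M₁ (M₂ + 1) J +
    dM q a c d • k (L - 1) M₁ (M₂ + 1) J

open Classical in
def Dst : Lat →ₗ[ℂ] Lat := latMap fun L M₁ M₂ J =>
  let a := q ^ L
  let c := q ^ M₂
  let d := if par L J M₂ then q ^ (J + 1) else (q ^ (J + 1))⁻¹
  tP q a c d • k (L + 1) M₁ (M₂ - 1) J + tZ q a c d • k L M₁ (M₂ - 1) J +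
    tM q a c d • k (L - 1) M₁ (M₂ - 1) J

end QuantumSphere
end

/-! ### Identities between the reduced operators -/

noncomputable section
namespace QuantumSphere

set_option linter.unusedSimpArgs false

/-- The denominators are brackets of odd integers `2L + k`. Such a bracket vanishes only if `q ^ (4L
+ 2k) = 1`, which is impossible since `4 ∤ 2k`. Hence these identities need no admissibility. -/
theorem zpow_four_mul_pow_ne_one {q : ℝ} (h0 : 0 < q) (h1 : q < 1) (L : ℤ) (n : ℕ)
    (hn : ¬ 4 ∣ n) : (q ^ L) ^ 4 * q ^ n - 1 ≠ 0 ∧ q ^ n * (q ^ L) ^ 4 - 1 ≠ 0 := by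
  have e : (q ^ L) ^ 4 * q ^ n = q ^ (L * 4 + n) := by
    rw [zpow_add₀ h0.ne', zpow_mul]; norm_cast
  rw [mul_comm (q ^ n), and_self, e, sub_ne_zero, Ne, zpow_eq_one_iff_right₀ h0.le h1.ne]
  omega

theorem Vz_Vp {q : ℝ} (h0 : 0 < q) (h1 : q < 1) (L M₁ M₂ J : ℤ) :
    Vz q (Vp q (k L M₁ M₂ J)) = Vp q (Vz q (k L M₁ M₂ J)) := by
  have hq := h0.ne'
  obtain ⟨e1, f1⟩ := zpow_four_mul_pow_ne_one h0 h1 L 2 (by norm_num)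
  obtain ⟨e3, f3⟩ := zpow_four_mul_pow_ne_one h0 h1 L 6 (by norm_num)
  obtain ⟨e5, f5⟩ := zpow_four_mul_pow_ne_one h0 h1 L 10 (by norm_num)
  obtain ⟨e7, f7⟩ := zpow_four_mul_pow_ne_one h0 h1 L 14 (by norm_num)
  have za : q ^ L ≠ 0 := zpow_ne_zero _ hq
  have zc : q ^ M₂ ≠ 0 := zpow_ne_zero _ hq
  have zd : q ^ J ≠ 0 := zpow_ne_zero _ hq
  have zq : q ^ 2 - 1 ≠ 0 := by nlinarith
  by_cases h : par L J M₂ <;>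
  · simp only [Vz, Vp, latMap_k, h, if_true, if_false, map_add, LinearMap.map_smul_of_tower,
      par_L_add, par_L_sub, par_J_add, par_J_sub, par_M_add, par_M_sub, not_true, not_false_eq_true,
      smul_add, smul_smul, add_sub_cancel_right, sub_add_cancel, zpow_add_one₀ hq,
      zpow_sub_one₀ hq]
    -- One scalar identity per basis vector. Once the powers of `q` are named, each is an identity
    -- of rational functions in independent variables.
    match_scalars
    all_goals simp only [uP, uM, uZ, wP, wM, wZ, hP, hM, hZ, br]
    all_goals generalize q ^ L = a at *
    all_goals generalize q ^ M₂ = c at *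
    all_goals generalize q ^ J = d at *
    all_goals field_simp <;> ring

theorem Vz_Vm {q : ℝ} (h0 : 0 < q) (h1 : q < 1) (L M₁ M₂ J : ℤ) :
    Vz q (Vm q (k L M₁ M₂ J)) = Vm q (Vz q (k L M₁ M₂ J)) := by
  have hq := h0.ne'
  obtain ⟨e1, f1⟩ := zpow_four_mul_pow_ne_one h0 h1 L 2 (by norm_num)
  obtain ⟨e3, f3⟩ := zpow_four_mul_pow_ne_one h0 h1 L 6 (by norm_num)
  obtain ⟨e5, f5⟩ := zpow_four_mul_pow_ne_one h0 h1 L 10 (by norm_num)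
  obtain ⟨e7, f7⟩ := zpow_four_mul_pow_ne_one h0 h1 L 14 (by norm_num)
  have za : q ^ L ≠ 0 := zpow_ne_zero _ hq
  have zc : q ^ M₂ ≠ 0 := zpow_ne_zero _ hq
  have zd : q ^ J ≠ 0 := zpow_ne_zero _ hq
  have zq : q ^ 2 - 1 ≠ 0 := by nlinarith
  by_cases h : par L J M₂ <;>
  · simp only [Vz, Vm, latMap_k, h, if_true, if_false, map_add, LinearMap.map_smul_of_tower,
      par_L_add, par_L_sub, par_J_add, par_J_sub, par_M_add, par_M_sub, not_true, not_false_eq_true,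
      smul_add, smul_smul, add_sub_cancel_right, sub_add_cancel, zpow_add_one₀ hq,
      zpow_sub_one₀ hq]
    match_scalars
    all_goals simp only [uP, uM, uZ, wP, wM, wZ, hP, hM, hZ, br]
    all_goals generalize q ^ L = a at *
    all_goals generalize q ^ M₂ = c at *
    all_goals generalize q ^ J = d at *
    all_goals field_simp <;> ring

theorem Vz_Dop {q : ℝ} (h0 : 0 < q) (h1 : q < 1) (L M₁ M₂ J : ℤ) :
    Vz q (Dop q (k L M₁ M₂ J)) = q ^ 2 • Dop q (Vz q (k L M₁ M₂ J)) := by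
  have hq := h0.ne'
  obtain ⟨e1, f1⟩ := zpow_four_mul_pow_ne_one h0 h1 L 2 (by norm_num)
  obtain ⟨e3, f3⟩ := zpow_four_mul_pow_ne_one h0 h1 L 6 (by norm_num)
  obtain ⟨e5, f5⟩ := zpow_four_mul_pow_ne_one h0 h1 L 10 (by norm_num)
  obtain ⟨e7, f7⟩ := zpow_four_mul_pow_ne_one h0 h1 L 14 (by norm_num)
  have za : q ^ L ≠ 0 := zpow_ne_zero _ hq
  have zc : q ^ M₂ ≠ 0 := zpow_ne_zero _ hq
  have zd : q ^ J ≠ 0 := zpow_ne_zero _ hq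
  have zq : q ^ 2 - 1 ≠ 0 := by nlinarith
  by_cases h : par L J M₂ <;>
  · simp only [Vz, Dop, latMap_k, h, if_true, if_false, map_add, LinearMap.map_smul_of_tower,
      par_L_add, par_L_sub, par_J_add, par_J_sub, par_M_add, par_M_sub, not_true, not_false_eq_true,
      smul_add, smul_smul, add_sub_cancel_right, sub_add_cancel, zpow_add_one₀ hq,
      zpow_sub_one₀ hq]
    match_scalars
    all_goals simp only [hP, hM, hZ, dP, dM, dZ, br]
    all_goals generalize q ^ L = a at *
    all_goals generalize q ^ M₂ = c at *
    all_goals generalize q ^ J = d at *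
    all_goals field_simp <;> ring

theorem Vp_Dop {q : ℝ} (h0 : 0 < q) (h1 : q < 1) (L M₁ M₂ J : ℤ) :
    Vp q (Dop q (k L M₁ M₂ J)) = q ^ 2 • Dop q (Vp q (k L M₁ M₂ J)) := by
  have hq := h0.ne'
  obtain ⟨e1, f1⟩ := zpow_four_mul_pow_ne_one h0 h1 L 2 (by norm_num)
  obtain ⟨e3, f3⟩ := zpow_four_mul_pow_ne_one h0 h1 L 6 (by norm_num)
  obtain ⟨e5, f5⟩ := zpow_four_mul_pow_ne_one h0 h1 L 10 (by norm_num)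
  obtain ⟨e7, f7⟩ := zpow_four_mul_pow_ne_one h0 h1 L 14 (by norm_num)
  have za : q ^ L ≠ 0 := zpow_ne_zero _ hq
  have zc : q ^ M₂ ≠ 0 := zpow_ne_zero _ hq
  have zd : q ^ J ≠ 0 := zpow_ne_zero _ hq
  have zq : q ^ 2 - 1 ≠ 0 := by nlinarith
  by_cases h : par L J M₂ <;>
  · simp only [Vp, Dop, latMap_k, h, if_true, if_false, map_add, LinearMap.map_smul_of_tower,
      par_L_add, par_L_sub, par_J_add, par_J_sub, par_M_add, par_M_sub, not_true, not_false_eq_true,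
      smul_add, smul_smul, add_sub_cancel_right, sub_add_cancel, zpow_add_one₀ hq,
      zpow_sub_one₀ hq]
    match_scalars
    all_goals simp only [uP, uM, uZ, wP, wM, wZ, dP, dM, dZ, br]
    all_goals generalize q ^ L = a at *
    all_goals generalize q ^ M₂ = c at *
    all_goals generalize q ^ J = d at *
    all_goals field_simp <;> ring

theorem Vm_Dop {q : ℝ} (h0 : 0 < q) (h1 : q < 1) (L M₁ M₂ J : ℤ) :
    Vm q (Dop q (k L M₁ M₂ J)) = q ^ 2 • Dop q (Vm q (k L M₁ M₂ J)) := by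
  have hq := h0.ne'
  obtain ⟨e1, f1⟩ := zpow_four_mul_pow_ne_one h0 h1 L 2 (by norm_num)
  obtain ⟨e3, f3⟩ := zpow_four_mul_pow_ne_one h0 h1 L 6 (by norm_num)
  obtain ⟨e5, f5⟩ := zpow_four_mul_pow_ne_one h0 h1 L 10 (by norm_num)
  obtain ⟨e7, f7⟩ := zpow_four_mul_pow_ne_one h0 h1 L 14 (by norm_num)
  have za : q ^ L ≠ 0 := zpow_ne_zero _ hq
  have zc : q ^ M₂ ≠ 0 := zpow_ne_zero _ hq
  have zd : q ^ J ≠ 0 := zpow_ne_zero _ hq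
  have zq : q ^ 2 - 1 ≠ 0 := by nlinarith
  by_cases h : par L J M₂ <;>
  · simp only [Vm, Dop, latMap_k, h, if_true, if_false, map_add, LinearMap.map_smul_of_tower,
      par_L_add, par_L_sub, par_J_add, par_J_sub, par_M_add, par_M_sub, not_true, not_false_eq_true,
      smul_add, smul_smul, add_sub_cancel_right, sub_add_cancel, zpow_add_one₀ hq,
      zpow_sub_one₀ hq]
    match_scalars
    all_goals simp only [uP, uM, uZ, wP, wM, wZ, dP, dM, dZ, br]
    all_goals generalize q ^ L = a at *
    all_goals generalize q ^ M₂ = c at *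
    all_goals generalize q ^ J = d at *
    all_goals field_simp <;> ring

/-- A `q`-oscillator relation between `x₂` and `x₂*` alone. Together with the radius relation it
yields the defining relation for `[x₂*, x₂]`. -/
theorem Dst_Dop {q : ℝ} (h0 : 0 < q) (h1 : q < 1) (L M₁ M₂ J : ℤ) :
    Dst q (Dop q (k L M₁ M₂ J)) = (1 - q ^ 4) • (k L M₁ M₂ J) + q ^ 4 • Dop q (Dst q (k L M₁ M₂ J)) := by
  have hq := h0.ne'
  obtain ⟨e1, f1⟩ := zpow_four_mul_pow_ne_one h0 h1 L 2 (by norm_num)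
  obtain ⟨e3, f3⟩ := zpow_four_mul_pow_ne_one h0 h1 L 6 (by norm_num)
  obtain ⟨e5, f5⟩ := zpow_four_mul_pow_ne_one h0 h1 L 10 (by norm_num)
  obtain ⟨e7, f7⟩ := zpow_four_mul_pow_ne_one h0 h1 L 14 (by norm_num)
  have za : q ^ L ≠ 0 := zpow_ne_zero _ hq
  have zc : q ^ M₂ ≠ 0 := zpow_ne_zero _ hq
  have zd : q ^ J ≠ 0 := zpow_ne_zero _ hq
  have zq : q ^ 2 - 1 ≠ 0 := by nlinarith
  by_cases h : par L J M₂ <;>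
  · simp only [Dst, Dop, latMap_k, h, if_true, if_false, map_add, LinearMap.map_smul_of_tower,
      par_L_add, par_L_sub, par_J_add, par_J_sub, par_M_add, par_M_sub, not_true, not_false_eq_true,
      smul_add, smul_smul, add_sub_cancel_right, sub_add_cancel, zpow_add_one₀ hq,
      zpow_sub_one₀ hq]
    match_scalars
    all_goals simp only [tP, tM, tZ, dP, dM, dZ, br]
    all_goals generalize q ^ L = a at *
    all_goals generalize q ^ M₂ = c at *
    all_goals generalize q ^ J = d at *
    all_goals field_simp <;> ring

/-- Read as `[2J][2J+2] V₊V₋ = q([2J+1]²(1 - x₂x₂*) - V₀²)`. This and the next identity are what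
remains of the radius relation on the reduced level; they eliminate the mixed products. The brackets
stay on the left so that `J = 0` and `J = -1` need no exception. -/
theorem Vp_Vm {q : ℝ} (h0 : 0 < q) (h1 : q < 1) (L M₁ M₂ J : ℤ) :
    (br q ((q ^ J) ^ 2) * br q ((q ^ J) ^ 2 * q ^ 2)) • Vp q (Vm q (k L M₁ M₂ J)) =
      (q * br q ((q ^ J) ^ 2 * q) ^ 2) • ((k L M₁ M₂ J) - Dop q (Dst q (k L M₁ M₂ J))) - q • Vz q (Vz q (k L M₁ M₂ J)) := by
  have hq := h0.ne'
  obtain ⟨e1, f1⟩ := zpow_four_mul_pow_ne_one h0 h1 L 2 (by norm_num)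
  obtain ⟨e3, f3⟩ := zpow_four_mul_pow_ne_one h0 h1 L 6 (by norm_num)
  obtain ⟨e5, f5⟩ := zpow_four_mul_pow_ne_one h0 h1 L 10 (by norm_num)
  obtain ⟨e7, f7⟩ := zpow_four_mul_pow_ne_one h0 h1 L 14 (by norm_num)
  have za : q ^ L ≠ 0 := zpow_ne_zero _ hq
  have zc : q ^ M₂ ≠ 0 := zpow_ne_zero _ hq
  have zd : q ^ J ≠ 0 := zpow_ne_zero _ hq
  have zq : q ^ 2 - 1 ≠ 0 := by nlinarith
  by_cases h : par L J M₂ <;>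
  · simp only [Vz, Vp, Vm, Dst, Dop, latMap_k, h, if_true, if_false, map_add, LinearMap.map_smul_of_tower,
      par_L_add, par_L_sub, par_J_add, par_J_sub, par_M_add, par_M_sub, not_true, not_false_eq_true,
      smul_add, smul_smul, smul_sub, add_sub_cancel_right, sub_add_cancel, zpow_add_one₀ hq,
      zpow_sub_one₀ hq]
    match_scalars
    all_goals simp only [uP, uM, uZ, wP, wM, wZ, hP, hM, hZ, tP, tM, tZ, dP, dM, dZ, br]
    all_goals generalize q ^ L = a at *
    all_goals generalize q ^ M₂ = c at *
    all_goals generalize q ^ J = d at *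
    all_goals field_simp <;> ring

theorem Vm_Vp {q : ℝ} (h0 : 0 < q) (h1 : q < 1) (L M₁ M₂ J : ℤ) :
    (br q ((q ^ J) ^ 2 * q ^ 4) * br q ((q ^ J) ^ 2 * q ^ 2)) • Vm q (Vp q (k L M₁ M₂ J)) =
      (q * br q ((q ^ J) ^ 2 * q ^ 3) ^ 2) • ((k L M₁ M₂ J) - Dop q (Dst q (k L M₁ M₂ J))) - q • Vz q (Vz q (k L M₁ M₂ J)) := by
  have hq := h0.ne'
  obtain ⟨e1, f1⟩ := zpow_four_mul_pow_ne_one h0 h1 L 2 (by norm_num)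
  obtain ⟨e3, f3⟩ := zpow_four_mul_pow_ne_one h0 h1 L 6 (by norm_num)
  obtain ⟨e5, f5⟩ := zpow_four_mul_pow_ne_one h0 h1 L 10 (by norm_num)
  obtain ⟨e7, f7⟩ := zpow_four_mul_pow_ne_one h0 h1 L 14 (by norm_num)
  have za : q ^ L ≠ 0 := zpow_ne_zero _ hq
  have zc : q ^ M₂ ≠ 0 := zpow_ne_zero _ hq
  have zd : q ^ J ≠ 0 := zpow_ne_zero _ hq
  have zq : q ^ 2 - 1 ≠ 0 := by nlinarith
  by_cases h : par L J M₂ <;>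
  · simp only [Vz, Vp, Vm, Dst, Dop, latMap_k, h, if_true, if_false, map_add, LinearMap.map_smul_of_tower,
      par_L_add, par_L_sub, par_J_add, par_J_sub, par_M_add, par_M_sub, not_true, not_false_eq_true,
      smul_add, smul_smul, smul_sub, add_sub_cancel_right, sub_add_cancel, zpow_add_one₀ hq,
      zpow_sub_one₀ hq]
    match_scalars
    all_goals simp only [uP, uM, uZ, wP, wM, wZ, hP, hM, hZ, tP, tM, tZ, dP, dM, dZ, br]
    all_goals generalize q ^ L = a at *
    all_goals generalize q ^ M₂ = c at *
    all_goals generalize q ^ J = d at *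
    all_goals field_simp <;> ring

end QuantumSphere
end

/-! ### `x₀, x₁, x₁*` assembled from coefficients in `(j, m₁)` and reduced operators -/

noncomputable section
namespace QuantumSphere

/-- `α(J, M₁) P` followed by the shift `M₁ ↦ M₁ + e`. -/
def hop (e : ℤ) (α : ℤ → ℤ → ℝ) (P : Lat →ₗ[ℂ] Lat) : Lat →ₗ[ℂ] Lat :=
  latMap fun L M₁ M₂ J => α J M₁ • P (k L (M₁ + e) M₂ J)

theorem hop_k (e : ℤ) (α : ℤ → ℤ → ℝ) (P : Lat →ₗ[ℂ] Lat) (L M₁ M₂ J : ℤ) :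
    hop e α P (k L M₁ M₂ J) = α J M₁ • P (k L (M₁ + e) M₂ J) :=
  latMap_k _ L M₁ M₂ J

section

variable (q : ℝ) (e : ℤ) (α : ℤ → ℤ → ℝ) (P : Lat →ₗ[ℂ] Lat) (L M₁ M₂ J : ℤ)

/-- The coefficient depends on `j`, so passing it over an operator that raises `j` shifts its
argument to `J + 1`; this is the only non-commutativity between the two layers. -/
theorem hop_Vp : hop e α P (Vp q (k L M₁ M₂ J)) =
    α (J + 1) M₁ • P (Vp q (k L (M₁ + e) M₂ J)) := by
  by_cases h : par L J M₂ <;>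
    simp only [Vp, latMap_k, h, if_true, if_false, map_add, LinearMap.map_smul_of_tower, hop_k,
      smul_add, smul_comm (α _ _)]

theorem hop_Vm : hop e α P (Vm q (k L M₁ M₂ J)) =
    α (J - 1) M₁ • P (Vm q (k L (M₁ + e) M₂ J)) := by
  by_cases h : par L J M₂ <;>
    simp only [Vm, latMap_k, h, if_true, if_false, map_add, LinearMap.map_smul_of_tower, hop_k,
      smul_add, smul_comm (α _ _)]

theorem hop_Vz : hop e α P (Vz q (k L M₁ M₂ J)) = α J M₁ • P (Vz q (k L (M₁ + e) M₂ J)) := by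
  simp only [Vz, latMap_k, map_add, LinearMap.map_smul_of_tower, hop_k, smul_add,
    smul_comm (α _ _)]

theorem hop_Dop : hop e α P (Dop q (k L M₁ M₂ J)) = α J M₁ • P (Dop q (k L (M₁ + e) M₂ J)) := by
  simp only [Dop, latMap_k, map_add, LinearMap.map_smul_of_tower, hop_k, smul_add,
    smul_comm (α _ _)]

end

/-- Here `u = q ^ J` and `w = q ^ M₁`; the letters `a`, `b`, `c` belong to `x₀`, `x₁`, `x₁*`, and
the suffixes `P`, `Z`, `M` to raising, keeping and lowering `j`. -/
def aP (q u w : ℝ) : ℝ := w / q / br q (u ^ 2 * q ^ 3)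
def aZ (q u w : ℝ) : ℝ := (u * w * q ^ 2 * (q + q⁻¹) * br q (u / w) - br q (u ^ 2 * q)) /
  (q ^ 2 * br q (u ^ 2 * q) * br q (u ^ 2 * q ^ 3))
def aM (q u w : ℝ) : ℝ := w / q * br q (u * w * q) * br q (u / w) / br q (u ^ 2 * q)
def bP (q u w : ℝ) : ℝ := w / (u * q) / br q (u ^ 2 * q ^ 3)
def bZ (q u w : ℝ) : ℝ := (1 + q ^ 2) * w * br q (u / w) / (br q (u ^ 2 * q) * br q (u ^ 2 * q ^ 3))
def bM (q u w : ℝ) : ℝ := -(u * w * q) * br q (u / w) * br q (u / (w * q)) / br q (u ^ 2 * q)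
def cP (q u w : ℝ) : ℝ := -(u * w * q) / br q (u ^ 2 * q ^ 3)
def cZ (q u w : ℝ) : ℝ :=
  (1 + q ^ 2) * w / q * br q (u * w * q) / (br q (u ^ 2 * q) * br q (u ^ 2 * q ^ 3))
def cM (q u w : ℝ) : ℝ := w / (u * q) * br q (u * w) * br q (u * w * q) / br q (u ^ 2 * q)

section

variable (q : ℝ)

def X0 : Lat →ₗ[ℂ] Lat :=
  hop 0 (fun J M => aP q (q ^ J) (q ^ M)) (Vp q) + hop 0 (fun J M => aZ q (q ^ J) (q ^ M)) (Vz q) +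
    hop 0 (fun J M => aM q (q ^ J) (q ^ M)) (Vm q)

def X1 : Lat →ₗ[ℂ] Lat :=
  hop 1 (fun J M => bP q (q ^ J) (q ^ M)) (Vp q) + hop 1 (fun J M => bZ q (q ^ J) (q ^ M)) (Vz q) +
    hop 1 (fun J M => bM q (q ^ J) (q ^ M)) (Vm q)

def X1s : Lat →ₗ[ℂ] Lat :=
  hop (-1) (fun J M => cP q (q ^ J) (q ^ M)) (Vp q) +
    hop (-1) (fun J M => cZ q (q ^ J) (q ^ M)) (Vz q) +
    hop (-1) (fun J M => cM q (q ^ J) (q ^ M)) (Vm q)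

theorem Dop_hop (e : ℤ) (α : ℤ → ℤ → ℝ) (P : Lat →ₗ[ℂ] Lat)
    (hP : ∀ L M₁ M₂ J, P (Dop q (k L M₁ M₂ J)) = q ^ 2 • Dop q (P (k L M₁ M₂ J)))
    (L M₁ M₂ J : ℤ) :
    hop e α P (Dop q (k L M₁ M₂ J)) = q ^ 2 • Dop q (hop e α P (k L M₁ M₂ J)) := by
  rw [hop_Dop, hop_k, hP, LinearMap.map_smul_of_tower, smul_comm]

end

theorem X0_Dop {q : ℝ} (h0 : 0 < q) (h1 : q < 1) (L M₁ M₂ J : ℤ) :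
    X0 q (Dop q (k L M₁ M₂ J)) = q ^ 2 • Dop q (X0 q (k L M₁ M₂ J)) := by
  simp only [X0, LinearMap.add_apply, map_add, smul_add, Dop_hop _ _ _ _ (Vz_Dop h0 h1),
    Dop_hop _ _ _ _ (Vp_Dop h0 h1), Dop_hop _ _ _ _ (Vm_Dop h0 h1)]

theorem X1_Dop {q : ℝ} (h0 : 0 < q) (h1 : q < 1) (L M₁ M₂ J : ℤ) :
    X1 q (Dop q (k L M₁ M₂ J)) = q ^ 2 • Dop q (X1 q (k L M₁ M₂ J)) := by
  simp only [X1, LinearMap.add_apply, map_add, smul_add, Dop_hop _ _ _ _ (Vz_Dop h0 h1),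
    Dop_hop _ _ _ _ (Vp_Dop h0 h1), Dop_hop _ _ _ _ (Vm_Dop h0 h1)]

theorem X1s_Dop {q : ℝ} (h0 : 0 < q) (h1 : q < 1) (L M₁ M₂ J : ℤ) :
    X1s q (Dop q (k L M₁ M₂ J)) = q ^ 2 • Dop q (X1s q (k L M₁ M₂ J)) := by
  simp only [X1s, LinearMap.add_apply, map_add, smul_add, Dop_hop _ _ _ _ (Vz_Dop h0 h1),
    Dop_hop _ _ _ _ (Vp_Dop h0 h1), Dop_hop _ _ _ _ (Vm_Dop h0 h1)]

end QuantumSphere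
end

/-! ### Relations among `x₀, x₁, x₁*` and the radius relation -/

noncomputable section
namespace QuantumSphere

set_option linter.unusedSimpArgs false

theorem zpow_add_neg_one {q : ℝ} (h : q ≠ 0) (n : ℤ) : q ^ (n + -1) = q ^ n * q⁻¹ :=
  zpow_sub_one₀ h n

theorem zpow_four_sub_sq_ne_zero {q : ℝ} (h0 : 0 < q) (h1 : q < 1) (J : ℤ) :
    (q ^ J) ^ 4 - q ^ 2 ≠ 0 ∧ q ^ 2 - (q ^ J) ^ 4 ≠ 0 := by
  have e : (q ^ J) ^ 4 ≠ q ^ 2 := by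
    have : (q ^ J) ^ 4 = q ^ (J * 4) := by rw [zpow_mul]; norm_cast
    rw [this, ← zpow_natCast q 2, Ne, zpow_right_inj₀ h0 h1.ne]
    omega
  exact ⟨sub_ne_zero.2 e, sub_ne_zero.2 e.symm⟩

/-- The bracket `[2J + 2]` has an even argument and vanishes at `J = -1`; this is why the relations
below are stated for `0 ≤ J`. -/
theorem zpow_four_mul_pow_four_ne_one {q : ℝ} (h0 : 0 < q) (h1 : q < 1) {J : ℤ} (hJ : 0 ≤ J) :
    (q ^ J) ^ 4 * q ^ 4 - 1 ≠ 0 ∧ q ^ 4 * (q ^ J) ^ 4 - 1 ≠ 0 := by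
  have e : (q ^ J) ^ 4 * q ^ 4 = q ^ (J * 4 + 4) := by
    rw [zpow_add₀ h0.ne', zpow_mul]; norm_cast
  rw [mul_comm (q ^ 4), and_self, e, sub_ne_zero, Ne, zpow_eq_one_iff_right₀ h0.le h1.ne]
  omega

/-- Both sides are expanded into products of two reduced operators. The products other than `V₊V₋`
and `V₋V₊` are treated as independent atoms, and these two are removed with `Vp_Vm` and `Vm_Vp`. -/
theorem X0_X1 {q : ℝ} (h0 : 0 < q) (h1 : q < 1) (L M₁ M₂ : ℤ) {J : ℤ} (hJ : 0 ≤ J) :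
    X0 q (X1 q (k L M₁ M₂ J)) = q ^ 2 • X1 q (X0 q (k L M₁ M₂ J)) := by
  have hq := h0.ne'
  obtain ⟨e1, f1⟩ := zpow_four_mul_pow_ne_one h0 h1 J 2 (by norm_num)
  obtain ⟨e3, f3⟩ := zpow_four_mul_pow_ne_one h0 h1 J 6 (by norm_num)
  obtain ⟨e5, f5⟩ := zpow_four_mul_pow_ne_one h0 h1 J 10 (by norm_num)
  obtain ⟨e0, f0⟩ := zpow_four_sub_sq_ne_zero h0 h1 J
  obtain ⟨e2, f2⟩ := zpow_four_mul_pow_four_ne_one h0 h1 hJ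
  have zw : q ^ M₁ ≠ 0 := zpow_ne_zero _ hq
  have zu : q ^ J ≠ 0 := zpow_ne_zero _ hq
  have zq : q ^ 2 - 1 ≠ 0 := by nlinarith
  have hA := Vp_Vm h0 h1 L (M₁ + 1) M₂ J
  have hB := Vm_Vp h0 h1 L (M₁ + 1) M₂ J
  simp only [X0, X1, LinearMap.add_apply, hop_k, map_add, LinearMap.map_smul_of_tower, hop_Vp,
    hop_Vm, hop_Vz, smul_add, smul_smul, Vz_Vp h0 h1, Vz_Vm h0 h1, add_zero, add_neg_cancel_right,
    neg_add_cancel_right, zpow_add_one₀ hq, zpow_sub_one₀ hq, zpow_add_neg_one hq]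
  generalize Vp q (Vp q (k L (M₁ + 1) M₂ J)) = v₁
  generalize Vm q (Vm q (k L (M₁ + 1) M₂ J)) = v₂
  generalize Vp q (Vz q (k L (M₁ + 1) M₂ J)) = v₃
  generalize Vm q (Vz q (k L (M₁ + 1) M₂ J)) = v₄
  generalize Vp q (Vm q (k L (M₁ + 1) M₂ J)) = v₅ at *
  generalize Vm q (Vp q (k L (M₁ + 1) M₂ J)) = v₆ at *
  generalize Vz q (Vz q (k L (M₁ + 1) M₂ J)) = v₇ at *
  generalize Dop q (Dst q (k L (M₁ + 1) M₂ J)) = v₈ at *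
  -- The two coefficients are those that cancel `V₋V₊` and `V₊V₋`. Because of the factors `[2J+3]⁻²`
  -- and `[2J+1]⁻²`, the contributions of `1 - x₂x₂*` from the two identities are opposite to each
  -- other.
  linear_combination (norm := skip)
    (q ^ M₁ * br q (q ^ J / q ^ M₁) / (br q ((q ^ J) ^ 2 * q ^ 3) ^ 2 * br q ((q ^ J) ^ 2 * q ^ 2))) • hB +
      (-(q ^ M₁) * br q (q ^ J / q ^ M₁) / (br q ((q ^ J) ^ 2 * q) ^ 2 * br q ((q ^ J) ^ 2 * q ^ 2))) • hA
  match_scalars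
  all_goals simp only [aP, aM, aZ, bP, bM, bZ, br]
  all_goals generalize q ^ J = u at *
  all_goals generalize q ^ M₁ = w at *
  all_goals field_simp <;> ring

theorem X1s_X1 {q : ℝ} (h0 : 0 < q) (h1 : q < 1) (L M₁ M₂ : ℤ) {J : ℤ} (hJ : 0 ≤ J) :
    X1s q (X1 q (k L M₁ M₂ J)) - X1 q (X1s q (k L M₁ M₂ J)) = (1 - q ^ 4) • X0 q (X0 q (k L M₁ M₂ J)) := by
  have hq := h0.ne'
  obtain ⟨e1, f1⟩ := zpow_four_mul_pow_ne_one h0 h1 J 2 (by norm_num)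
  obtain ⟨e3, f3⟩ := zpow_four_mul_pow_ne_one h0 h1 J 6 (by norm_num)
  obtain ⟨e5, f5⟩ := zpow_four_mul_pow_ne_one h0 h1 J 10 (by norm_num)
  obtain ⟨e0, f0⟩ := zpow_four_sub_sq_ne_zero h0 h1 J
  obtain ⟨e2, f2⟩ := zpow_four_mul_pow_four_ne_one h0 h1 hJ
  have zw : q ^ M₁ ≠ 0 := zpow_ne_zero _ hq
  have zu : q ^ J ≠ 0 := zpow_ne_zero _ hq
  have zq : q ^ 2 - 1 ≠ 0 := by nlinarith
  have hA := Vp_Vm h0 h1 L M₁ M₂ J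
  have hB := Vm_Vp h0 h1 L M₁ M₂ J
  simp only [X0, X1, X1s, LinearMap.add_apply, hop_k, map_add, LinearMap.map_smul_of_tower, hop_Vp,
    hop_Vm, hop_Vz, smul_add, smul_smul, Vz_Vp h0 h1, Vz_Vm h0 h1, add_zero, add_neg_cancel_right,
    neg_add_cancel_right, zpow_add_one₀ hq, zpow_sub_one₀ hq, zpow_add_neg_one hq]
  generalize Vp q (Vp q (k L M₁ M₂ J)) = v₁
  generalize Vm q (Vm q (k L M₁ M₂ J)) = v₂
  generalize Vp q (Vz q (k L M₁ M₂ J)) = v₃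
  generalize Vm q (Vz q (k L M₁ M₂ J)) = v₄
  generalize Vp q (Vm q (k L M₁ M₂ J)) = v₅ at *
  generalize Vm q (Vp q (k L M₁ M₂ J)) = v₆ at *
  generalize Vz q (Vz q (k L M₁ M₂ J)) = v₇ at *
  generalize Dop q (Dst q (k L M₁ M₂ J)) = v₈ at *
  linear_combination (norm := skip)
    (((q ^ M₁) ^ 2 * (q + q⁻¹) - (q ^ J) ^ 2 * q - ((q ^ J) ^ 2 * q ^ 3)⁻¹) / (q - q⁻¹) / (br q ((q ^ J) ^ 2 * q ^ 3) ^ 2 * br q ((q ^ J) ^ 2 * q ^ 2))) • hB +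
      (-(((q ^ M₁) ^ 2 * (q + q⁻¹) - (q ^ J) ^ 2 * q - ((q ^ J) ^ 2 * q ^ 3)⁻¹) / (q - q⁻¹)) / (br q ((q ^ J) ^ 2 * q) ^ 2 * br q ((q ^ J) ^ 2 * q ^ 2))) • hA
  match_scalars
  all_goals simp only [aP, aM, aZ, bP, bM, bZ, cP, cM, cZ, br]
  all_goals generalize q ^ J = u at *
  all_goals generalize q ^ M₁ = w at *
  all_goals field_simp <;> ring

theorem X0_X0_add {q : ℝ} (h0 : 0 < q) (h1 : q < 1) (L M₁ M₂ : ℤ) {J : ℤ} (hJ : 0 ≤ J) :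
    X0 q (X0 q (k L M₁ M₂ J)) + X1 q (X1s q (k L M₁ M₂ J)) + Dop q (Dst q (k L M₁ M₂ J)) = (k L M₁ M₂ J) := by
  have hq := h0.ne'
  obtain ⟨e1, f1⟩ := zpow_four_mul_pow_ne_one h0 h1 J 2 (by norm_num)
  obtain ⟨e3, f3⟩ := zpow_four_mul_pow_ne_one h0 h1 J 6 (by norm_num)
  obtain ⟨e5, f5⟩ := zpow_four_mul_pow_ne_one h0 h1 J 10 (by norm_num)
  obtain ⟨e0, f0⟩ := zpow_four_sub_sq_ne_zero h0 h1 J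
  obtain ⟨e2, f2⟩ := zpow_four_mul_pow_four_ne_one h0 h1 hJ
  have zw : q ^ M₁ ≠ 0 := zpow_ne_zero _ hq
  have zu : q ^ J ≠ 0 := zpow_ne_zero _ hq
  have zq : q ^ 2 - 1 ≠ 0 := by nlinarith
  have hA := Vp_Vm h0 h1 L M₁ M₂ J
  have hB := Vm_Vp h0 h1 L M₁ M₂ J
  simp only [X0, X1, X1s, LinearMap.add_apply, hop_k, map_add, LinearMap.map_smul_of_tower, hop_Vp,
    hop_Vm, hop_Vz, smul_add, smul_smul, Vz_Vp h0 h1, Vz_Vm h0 h1, add_zero, add_neg_cancel_right,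
    neg_add_cancel_right, zpow_add_one₀ hq, zpow_sub_one₀ hq, zpow_add_neg_one hq]
  generalize Vp q (Vp q (k L M₁ M₂ J)) = v₁
  generalize Vm q (Vm q (k L M₁ M₂ J)) = v₂
  generalize Vp q (Vz q (k L M₁ M₂ J)) = v₃
  generalize Vm q (Vz q (k L M₁ M₂ J)) = v₄
  generalize Vp q (Vm q (k L M₁ M₂ J)) = v₅ at *
  generalize Vm q (Vp q (k L M₁ M₂ J)) = v₆ at *
  generalize Vz q (Vz q (k L M₁ M₂ J)) = v₇ at *
  generalize Dop q (Dst q (k L M₁ M₂ J)) = v₈ at *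
  -- Here the contributions of `1 - x₂x₂*` from the two identities add up to exactly one copy, since
  -- `q(uw[J-M₁+1] + (w/(uq²))[J+M₁+1]) = [2J+2]`, with `u = q ^ J` and `w = q ^ M₁`.
  linear_combination (norm := skip)
    (q ^ J * q ^ M₁ * br q (q ^ J / q ^ M₁ * q) / (br q ((q ^ J) ^ 2 * q ^ 3) ^ 2 * br q ((q ^ J) ^ 2 * q ^ 2))) • hB +
      (q ^ M₁ / (q ^ J * q ^ 2) * br q (q ^ J * q ^ M₁ * q) / (br q ((q ^ J) ^ 2 * q) ^ 2 * br q ((q ^ J) ^ 2 * q ^ 2))) • hA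
  match_scalars
  all_goals simp only [aP, aM, aZ, bP, bM, bZ, cP, cM, cZ, br]
  all_goals generalize q ^ J = u at *
  all_goals generalize q ^ M₁ = w at *
  all_goals field_simp <;> ring

/-- By `Dst_Dop`, the commutator is `(1 - q⁴)(1 - x₂x₂*)`. By the radius relation this is `(1 -
q⁴)(x₀² + x₁x₁*)`, and `(1 - q⁴)x₀²` is the commutator of `x₁*` and `x₁`. -/
theorem Dst_Dop_sub {q : ℝ} (h0 : 0 < q) (h1 : q < 1) (L M₁ M₂ : ℤ) {J : ℤ} (hJ : 0 ≤ J) :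
    Dst q (Dop q (k L M₁ M₂ J)) - Dop q (Dst q (k L M₁ M₂ J)) =
      X1s q (X1 q (k L M₁ M₂ J)) - q ^ 4 • X1 q (X1s q (k L M₁ M₂ J)) := by
  have hA := X1s_X1 h0 h1 L M₁ M₂ hJ
  have hB := X0_X0_add h0 h1 L M₁ M₂ hJ
  have hC := Dst_Dop h0 h1 L M₁ M₂ J
  linear_combination (norm := skip) (1 : ℝ) • hC - (1 : ℝ) • hA - (1 - q ^ 4) • hB
  module

end QuantumSphere
end

/-! ### `q`-integers, weights, and the given coefficients in terms of integer labels -/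

noncomputable section
namespace QuantumSphere

/-- The `q`-integer `[n]`. -/
def qi (q : ℝ) (n : ℤ) : ℝ := br q (q ^ n)

theorem qi_zero (q : ℝ) : qi q 0 = 0 := by simp [qi, br]

theorem qi_neg (q : ℝ) (n : ℤ) : qi q (-n) = -qi q n := by
  simp only [qi, br, zpow_neg, inv_inv]; ring

theorem qi_pos {q : ℝ} (h0 : 0 < q) (h1 : q < 1) {n : ℤ} (hn : 0 < n) : 0 < qi q n := by
  have h2 : q ^ n < 1 := zpow_lt_one₀ h0 h1 hn
  have h3 : 0 < q ^ n := zpow_pos h0 n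
  have h4 : 1 < (q ^ n)⁻¹ := (one_lt_inv₀ h3).2 h2
  have h5 : 1 < q⁻¹ := (one_lt_inv₀ h0).2 h1
  exact div_pos_of_neg_of_neg (by linarith) (by linarith)

theorem qi_nonneg {q : ℝ} (h0 : 0 < q) (h1 : q < 1) {n : ℤ} (hn : 0 ≤ n) : 0 ≤ qi q n := by
  rcases hn.eq_or_lt with rfl | h
  · rw [qi_zero]
  · exact (qi_pos h0 h1 h).le

theorem qi_ne_zero {q : ℝ} (h0 : 0 < q) (h1 : q < 1) {n : ℤ} (hn : n ≠ 0) : qi q n ≠ 0 := by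
  rcases hn.lt_or_gt with h | h
  · have := (qi_pos h0 h1 (neg_pos.2 h)).ne'
    rwa [qi_neg, neg_ne_zero] at this
  · exact (qi_pos h0 h1 h).ne'

/-- The `q`-factorial. -/
def qfact (q : ℝ) : ℕ → ℝ
  | 0 => 1
  | n + 1 => qi q (n + 1) * qfact q n

/-- The double `q`-factorial. -/
def qdfact (q : ℝ) : ℕ → ℝ
  | 0 => 1
  | 1 => 1
  | n + 2 => qi q (n + 2) * qdfact q n

theorem qfact_pos {q : ℝ} (h0 : 0 < q) (h1 : q < 1) : ∀ n, 0 < qfact q n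
  | 0 => one_pos
  | n + 1 => mul_pos (qi_pos h0 h1 (by positivity)) (qfact_pos h0 h1 n)

theorem qdfact_pos {q : ℝ} (h0 : 0 < q) (h1 : q < 1) : ∀ n, 0 < qdfact q n
  | 0 => one_pos
  | 1 => one_pos
  | n + 2 => mul_pos (qi_pos h0 h1 (by positivity)) (qdfact_pos h0 h1 n)

def qF (q : ℝ) (n : ℤ) : ℝ := qfact q n.toNat

def qG (q : ℝ) (n : ℤ) : ℝ := qdfact q n.toNat

theorem qF_step (q : ℝ) {n m : ℤ} (hm : m = n + 1) (hn : 0 ≤ n) : qF q m = qi q m * qF q n := by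
  lift n to ℕ using hn
  subst hm
  exact rfl

theorem qG_step (q : ℝ) {n m : ℤ} (hm : m = n + 2) (hn : 0 ≤ n) : qG q m = qi q m * qG q n := by
  lift n to ℕ using hn
  subst hm
  exact rfl

/-- The part of the squared norm of the unnormalised basis vectors that depends on `j, m₁`. -/
def N1 (q : ℝ) (J M : ℤ) : ℝ := qF q (J + M + 1) * qF q (J - M)

/-- The part of the squared norm of the unnormalised basis vectors that depends on `l, m₂` and
on `n = ±(j + 1/2)`. -/
def N2 (q : ℝ) (L M n : ℤ) : ℝ :=
  q ^ (-L) * (qG q (L + M + n + 2) * qG q (L + M - n + 1) * qG q (L - M - n + 1) *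
    qG q (L - M + n))

open Classical in
/-- `2ε(j + 1/2)`. -/
def nn (L J M : ℤ) : ℤ := if par L J M then J + 1 else -(J + 1)

theorem N1_pos {q : ℝ} (h0 : 0 < q) (h1 : q < 1) (J M : ℤ) : 0 < N1 q J M :=
  mul_pos (qfact_pos h0 h1 _) (qfact_pos h0 h1 _)

theorem N2_pos {q : ℝ} (h0 : 0 < q) (h1 : q < 1) (L M n : ℤ) : 0 < N2 q L M n := by
  have h := fun k => qdfact_pos h0 h1 (Int.toNat k)
  exact mul_pos (zpow_pos h0 _) (mul_pos (mul_pos (mul_pos (h _) (h _)) (h _)) (h _))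

theorem sqrt_mul_sqrt_of_sq {X N N' A : ℝ} (hA : 0 ≤ A) (hN : 0 ≤ N) (h : X * N = A ^ 2 * N') :
    √X * √N = A * √N' := by
  rw [← Real.sqrt_mul' X hN, h, Real.sqrt_mul (sq_nonneg A), Real.sqrt_sq hA]

section Closed

variable {q : ℝ}

theorem qnum_eq (h0 : 0 < q) {z : ℝ} (n : ℤ) (h : z = n) : qnum q z = qi q n := by
  rw [qnum, qi, br, h, Real.rpow_neg h0.le, Real.rpow_intCast]

theorem rpow_eq_zpow {z : ℝ} (n : ℤ) (h : z = n) : q ^ z = q ^ n := by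
  rw [h, Real.rpow_intCast]

/-- The shift by `1/2` in `l, m₁, m₂, j` leaves at most one factor `√q`; everything else is an
integer power. The closed forms below all arise in this way. -/
theorem rpow_eq_zpow_mul_sqrt (h0 : 0 < q) {z : ℝ} (n : ℤ) (h : z = n + 1 / 2) :
    q ^ z = q ^ n * √q := by
  rw [h, Real.rpow_add h0, Real.rpow_intCast, Real.sqrt_eq_rpow]

theorem Ap_eq (h0 : 0 < q) (J M : ℤ) : Ap q J M =
    q ^ (M - 1) * √q * √(qi q (J + M + 2) * qi q (J - M + 1)) / qi q (2 * J + 3) := by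
  simp only [Ap, half]
  rw [rpow_eq_zpow_mul_sqrt h0 (M - 1) (by push_cast; ring),
    qnum_eq h0 (J + M + 2) (by push_cast; ring), qnum_eq h0 (J - M + 1) (by push_cast; ring),
    qnum_eq h0 (2 * J + 3) (by push_cast; ring)]

theorem A0_eq (h0 : 0 < q) (J M : ℤ) : A0 q J M =
    q ^ (-2 : ℤ) * (q ^ (J + M + 2) * qi q 2 * qi q (J - M) - qi q (2 * J + 1)) /
      (qi q (2 * J + 1) * qi q (2 * J + 3)) := by
  simp only [A0, half]
  rw [rpow_eq_zpow (-2) (by norm_num), rpow_eq_zpow (J + M + 2) (by push_cast; ring),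
    qnum_eq h0 2 (by norm_num), qnum_eq h0 (J - M) (by push_cast; ring),
    qnum_eq h0 (2 * J + 1) (by push_cast; ring), qnum_eq h0 (2 * J + 3) (by push_cast; ring)]

theorem Bp_eq (h0 : 0 < q) (J M : ℤ) : Bp q J M =
    q ^ (M - J - 1) * √q * √(qi q (J + M + 2) * qi q (J + M + 3)) / qi q (2 * J + 3) := by
  simp only [Bp, half]
  rw [rpow_eq_zpow_mul_sqrt h0 (M - J - 1) (by push_cast; ring),
    qnum_eq h0 (J + M + 2) (by push_cast; ring), qnum_eq h0 (J + M + 3) (by push_cast; ring),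
    qnum_eq h0 (2 * J + 3) (by push_cast; ring)]

theorem B0_eq (h0 : 0 < q) (J M : ℤ) : B0 q J M =
    (1 + q ^ 2) * q ^ M * √(qi q (J - M) * qi q (J + M + 2)) /
      (qi q (2 * J + 1) * qi q (2 * J + 3)) := by
  simp only [B0, half]
  rw [rpow_eq_zpow M (by push_cast; ring),
    qnum_eq h0 (J - M) (by push_cast; ring), qnum_eq h0 (J + M + 2) (by push_cast; ring),
    qnum_eq h0 (2 * J + 1) (by push_cast; ring), qnum_eq h0 (2 * J + 3) (by push_cast; ring)]

theorem Bm_eq (h0 : 0 < q) (J M : ℤ) : Bm q J M =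
    -(q ^ (J + M + 1) * √q * √(qi q (J - M) * qi q (J - M - 1)) / qi q (2 * J + 1)) := by
  simp only [Bm, half]
  rw [rpow_eq_zpow_mul_sqrt h0 (J + M + 1) (by push_cast; ring),
    qnum_eq h0 (J - M) (by push_cast; ring), qnum_eq h0 (J - M - 1) (by push_cast; ring),
    qnum_eq h0 (2 * J + 1) (by push_cast; ring)]

theorem eps_of_par {L J M : ℤ} (h : par L J M) : eps L J M = 1 / 2 := if_pos h

theorem eps_of_not_par {L J M : ℤ} (h : ¬par L J M) : eps L J M = -(1 / 2) := if_neg h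

/-- `C⁺` for `ε = 1/2`; also `C⁻` for `ε = -1/2` after a shift. -/
def cU (q : ℝ) (L M n : ℤ) : ℝ :=
  -(q ^ (M - 1) * √(qi q (L + M + n + 4) * qi q (L - M + n + 2)) / qi q (2 * L + 5))

/-- `C⁺` for `ε = -1/2`; also `C⁻` for `ε = 1/2` after a shift. -/
def cW (q : ℝ) (L M n : ℤ) : ℝ :=
  -(q ^ M * √(qi q (L + M - n + 3) * qi q (L - M - n + 3)) / qi q (2 * L + 5))

/-- `C⁰` for `ε = 1/2`. -/
def gU (q : ℝ) (L M n : ℤ) : ℝ :=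
  qi q 2 * (q ^ (L + M + 1) * √q) * √(qi q (L - M + n + 2) * qi q (L - M - n + 1)) /
    (qi q (2 * L + 3) * qi q (2 * L + 5))

/-- `C⁰` for `ε = -1/2`. -/
def gW (q : ℝ) (L M n : ℤ) : ℝ :=
  -(qi q 2 * (q ^ (-L + M - 3) * √q) * √(qi q (L + M - n + 3) * qi q (L + M + n + 2)) /
    (qi q (2 * L + 3) * qi q (2 * L + 5)))

theorem Cp_of_par (h0 : 0 < q) {L J M : ℤ} (h : par L J M) :
    Cp q L J M = cU q L M (J + 1) := by
  simp only [Cp, cU, half, eps_of_par h]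
  rw [rpow_eq_zpow (M - 1) (by push_cast; ring),
    qnum_eq h0 (L + M + (J + 1) + 4) (by push_cast; ring),
    qnum_eq h0 (L - M + (J + 1) + 2) (by push_cast; ring),
    qnum_eq h0 (2 * L + 5) (by push_cast; ring)]

theorem Cp_of_not_par (h0 : 0 < q) {L J M : ℤ} (h : ¬par L J M) :
    Cp q L J M = cW q L M (-(J + 1)) := by
  simp only [Cp, cW, half, eps_of_not_par h]
  rw [rpow_eq_zpow M (by push_cast; ring),
    qnum_eq h0 (L + M - -(J + 1) + 3) (by push_cast; ring),
    qnum_eq h0 (L - M - -(J + 1) + 3) (by push_cast; ring),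
    qnum_eq h0 (2 * L + 5) (by push_cast; ring)]

theorem Cm_of_par (h0 : 0 < q) {L J M : ℤ} (h : par L J M) :
    Cm q L J M = cW q (L - 1) M (J + 2) := by
  simp only [Cm, cW, half, eps_of_par h]
  rw [rpow_eq_zpow M (by push_cast; ring),
    qnum_eq h0 (L - 1 + M - (J + 2) + 3) (by push_cast; ring),
    qnum_eq h0 (L - 1 - M - (J + 2) + 3) (by push_cast; ring),
    qnum_eq h0 (2 * (L - 1) + 5) (by push_cast; ring)]

theorem Cm_of_not_par (h0 : 0 < q) {L J M : ℤ} (h : ¬par L J M) :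
    Cm q L J M = cU q (L - 1) M (-(J + 2)) := by
  simp only [Cm, cU, half, eps_of_not_par h]
  rw [rpow_eq_zpow (M - 1) (by push_cast; ring),
    qnum_eq h0 (L - 1 + M + -(J + 2) + 4) (by push_cast; ring),
    qnum_eq h0 (L - 1 - M + -(J + 2) + 2) (by push_cast; ring),
    qnum_eq h0 (2 * (L - 1) + 5) (by push_cast; ring)]

theorem C0_of_par (h0 : 0 < q) {L J M : ℤ} (h : par L J M) :
    C0 q L J M = gU q L M (J + 1) := by
  simp only [C0, gU, half, eps_of_par h]
  rw [qnum_eq h0 2 (by norm_num), rpow_eq_zpow_mul_sqrt h0 (L + M + 1) (by push_cast; ring),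
    qnum_eq h0 (L - M + (J + 1) + 2) (by push_cast; ring),
    qnum_eq h0 (L - M - (J + 1) + 1) (by push_cast; ring),
    qnum_eq h0 (2 * L + 3) (by push_cast; ring), qnum_eq h0 (2 * L + 5) (by push_cast; ring)]

theorem C0_of_not_par (h0 : 0 < q) {L J M : ℤ} (h : ¬par L J M) :
    C0 q L J M = gW q L M (-(J + 1)) := by
  simp only [C0, gW, half, eps_of_not_par h]
  rw [qnum_eq h0 (-2) (by norm_num), qi_neg, rpow_eq_zpow_mul_sqrt h0 (-L + M - 3) (by push_cast; ring),
    qnum_eq h0 (L + M - -(J + 1) + 3) (by push_cast; ring),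
    qnum_eq h0 (L + M + -(J + 1) + 2) (by push_cast; ring),
    qnum_eq h0 (2 * L + 3) (by push_cast; ring), qnum_eq h0 (2 * L + 5) (by push_cast; ring)]
  ring

theorem Hp_eq (h0 : 0 < q) (L J M : ℤ) : Hp q L J M =
    q ^ (M + nn L J M - 1) * √q *
      √(qi q (L - M + nn L J M + 2) * qi q (L + M - nn L J M + 3)) / qi q (2 * L + 5) := by
  by_cases h : par L J M
  · simp only [Hp, nn, half, eps_of_par h, if_pos h]
    rw [rpow_eq_zpow_mul_sqrt h0 (M + (J + 1) - 1) (by push_cast; ring),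
      qnum_eq h0 (L - M + (J + 1) + 2) (by push_cast; ring),
      qnum_eq h0 (L + M - (J + 1) + 3) (by push_cast; ring),
      qnum_eq h0 (2 * L + 5) (by push_cast; ring)]
  · simp only [Hp, nn, half, eps_of_not_par h, if_neg h]
    rw [rpow_eq_zpow_mul_sqrt h0 (M + -(J + 1) - 1) (by push_cast; ring),
      qnum_eq h0 (L - M + -(J + 1) + 2) (by push_cast; ring),
      qnum_eq h0 (L + M - -(J + 1) + 3) (by push_cast; ring),
      qnum_eq h0 (2 * L + 5) (by push_cast; ring)]

theorem H0_eq (h0 : 0 < q) (L J M : ℤ) : H0 q L J M =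
    (qi q (L - M - nn L J M + 1) * qi q (L + M - nn L J M + 3) -
      q ^ (-2 : ℤ) * (qi q (L - M + nn L J M + 2) * qi q (L + M + nn L J M + 2))) /
      (qi q (2 * L + 3) * qi q (2 * L + 5)) := by
  by_cases h : par L J M
  · simp only [H0, nn, half, eps_of_par h, if_pos h]
    rw [rpow_eq_zpow (-2) (by norm_num), qnum_eq h0 (L - M - (J + 1) + 1) (by push_cast; ring),
      qnum_eq h0 (L + M - (J + 1) + 3) (by push_cast; ring),
      qnum_eq h0 (L - M + (J + 1) + 2) (by push_cast; ring),
      qnum_eq h0 (L + M + (J + 1) + 2) (by push_cast; ring),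
      qnum_eq h0 (2 * L + 3) (by push_cast; ring), qnum_eq h0 (2 * L + 5) (by push_cast; ring)]
  · simp only [H0, nn, half, eps_of_not_par h, if_neg h]
    rw [rpow_eq_zpow (-2) (by norm_num), qnum_eq h0 (L - M - -(J + 1) + 1) (by push_cast; ring),
      qnum_eq h0 (L + M - -(J + 1) + 3) (by push_cast; ring),
      qnum_eq h0 (L - M + -(J + 1) + 2) (by push_cast; ring),
      qnum_eq h0 (L + M + -(J + 1) + 2) (by push_cast; ring),
      qnum_eq h0 (2 * L + 3) (by push_cast; ring), qnum_eq h0 (2 * L + 5) (by push_cast; ring)]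

theorem Dp_eq (h0 : 0 < q) (L J M : ℤ) : Dp q L J M =
    q ^ (-L + M - 2) * √q *
      √(qi q (L + M + nn L J M + 4) * qi q (L + M - nn L J M + 3)) / qi q (2 * L + 5) := by
  by_cases h : par L J M
  · simp only [Dp, nn, half, eps_of_par h, if_pos h]
    rw [rpow_eq_zpow_mul_sqrt h0 (-L + M - 2) (by push_cast; ring),
      qnum_eq h0 (L + M + (J + 1) + 4) (by push_cast; ring),
      qnum_eq h0 (L + M - (J + 1) + 3) (by push_cast; ring),
      qnum_eq h0 (2 * L + 5) (by push_cast; ring)]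
  · simp only [Dp, nn, half, eps_of_not_par h, if_neg h]
    rw [rpow_eq_zpow_mul_sqrt h0 (-L + M - 2) (by push_cast; ring), mul_comm (qnum _ _),
      qnum_eq h0 (L + M + -(J + 1) + 4) (by push_cast; ring),
      qnum_eq h0 (L + M - -(J + 1) + 3) (by push_cast; ring),
      qnum_eq h0 (2 * L + 5) (by push_cast; ring)]

theorem D0_eq (h0 : 0 < q) (L J M : ℤ) : D0 q L J M =
    qi q 2 * q ^ (M + 1) *
      √(qi q (L - M - nn L J M + 1) * qi q (L + M - nn L J M + 3)) /
      (qi q (2 * L + 3) * qi q (2 * L + 5)) := by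
  by_cases h : par L J M
  · simp only [D0, nn, half, eps_of_par h, if_pos h]
    rw [qnum_eq h0 2 (by norm_num), rpow_eq_zpow (M + 1) (by push_cast; ring),
      qnum_eq h0 (L - M - (J + 1) + 1) (by push_cast; ring),
      qnum_eq h0 (L + M - (J + 1) + 3) (by push_cast; ring),
      qnum_eq h0 (2 * L + 3) (by push_cast; ring), qnum_eq h0 (2 * L + 5) (by push_cast; ring)]
  · simp only [D0, nn, half, eps_of_not_par h, if_neg h]
    rw [qnum_eq h0 2 (by norm_num), rpow_eq_zpow (M + 1) (by push_cast; ring),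
      qnum_eq h0 (L - M - -(J + 1) + 1) (by push_cast; ring),
      qnum_eq h0 (L + M - -(J + 1) + 3) (by push_cast; ring),
      qnum_eq h0 (2 * L + 3) (by push_cast; ring), qnum_eq h0 (2 * L + 5) (by push_cast; ring)]

theorem Dm_eq (h0 : 0 < q) (L J M : ℤ) : Dm q L J M =
    -(q ^ (L + M + 2) * √q *
      √(qi q (L - M - nn L J M + 1) * qi q (L - M + nn L J M)) / qi q (2 * L + 3)) := by
  by_cases h : par L J M
  · simp only [Dm, nn, half, eps_of_par h, if_pos h]
    rw [rpow_eq_zpow_mul_sqrt h0 (L + M + 2) (by push_cast; ring),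
      qnum_eq h0 (L - M - (J + 1) + 1) (by push_cast; ring),
      qnum_eq h0 (L - M + (J + 1)) (by push_cast; ring),
      qnum_eq h0 (2 * L + 3) (by push_cast; ring)]
  · simp only [Dm, nn, half, eps_of_not_par h, if_neg h]
    rw [rpow_eq_zpow_mul_sqrt h0 (L + M + 2) (by push_cast; ring), mul_comm (qnum _ _),
      qnum_eq h0 (L - M - -(J + 1) + 1) (by push_cast; ring),
      qnum_eq h0 (L - M + -(J + 1)) (by push_cast; ring),
      qnum_eq h0 (2 * L + 3) (by push_cast; ring)]

end Closed
end QuantumSphere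
end

/-! ### Square roots against weights; rational coefficients at integer labels -/

noncomputable section
namespace QuantumSphere

set_option linter.unusedSimpArgs false

section

variable {q X A B N N' : ℝ}

/-- If the ratio of two squared norms is the radicand `X`, the square root can be absorbed in either
direction: forward it disappears, backward it becomes `X`. The first gives the coefficient of an
operator in the rescaled basis, the second that of its adjoint. The next two lemmas treat a ratio
with an extra `q⁻¹` and a ratio of the form `B / A`. -/
theorem sqrt_balance (hX : 0 ≤ X) (hN : 0 < N) (h : N' = X * N) :
    √X * √N = √N' ∧ √X * √N' = X * √N := by
  have hN' : 0 ≤ N' := h ▸ mul_nonneg hX hN.le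
  constructor
  · simpa using sqrt_mul_sqrt_of_sq (A := 1) (N' := N') zero_le_one hN.le (by rw [h]; ring)
  · exact sqrt_mul_sqrt_of_sq hX hN' (by rw [h]; ring)

theorem sqrt_balance_q (h0 : 0 < q) (hX : 0 ≤ X) (hN : 0 < N) (h : N' = q⁻¹ * X * N) :
    √X * √N = √q * √N' ∧ √q * (√X * √N') = X * √N := by
  have hq := Real.sq_sqrt h0.le
  have hs := (Real.sqrt_pos.2 h0).ne'
  have hN' : 0 ≤ N' := h ▸ by positivity
  constructor
  · exact sqrt_mul_sqrt_of_sq (Real.sqrt_nonneg _) hN.le (by rw [h, hq]; field_simp)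
  · rw [sqrt_mul_sqrt_of_sq (A := X / √q) (N' := N) (div_nonneg hX (Real.sqrt_nonneg _)) hN'
      (by rw [h, div_pow, hq]; field_simp)]
    field_simp

theorem sqrt_balance_swap (hA : 0 ≤ A) (hB : 0 ≤ B) (hN : 0 < N) (hN' : 0 < N')
    (h : A * N' = B * N) : √(A * B) * √N = A * √N' ∧ √(A * B) * √N' = B * √N :=
  ⟨sqrt_mul_sqrt_of_sq hA hN.le (by linear_combination (-A) * h),
    sqrt_mul_sqrt_of_sq hB hN'.le (by linear_combination B * h)⟩

end

theorem aP_zpow {q : ℝ} (hq : q ≠ 0) (J M : ℤ) : aP q (q ^ J) (q ^ M) =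
    q ^ (M - 1) / qi q (2 * J + 3) := by
  simp only [aP, qi, zpow_add₀ hq, zpow_sub₀ hq, zpow_neg, two_mul, zpow_ofNat, zpow_one]
  ring_nf

theorem aZ_zpow {q : ℝ} (hq : q ≠ 0) (J M : ℤ) : aZ q (q ^ J) (q ^ M) =
    q ^ (-2 : ℤ) * (q ^ (J + M + 2) * (q + q⁻¹) * qi q (J - M) - qi q (2 * J + 1)) /
      (qi q (2 * J + 1) * qi q (2 * J + 3)) := by
  simp only [aZ, qi, zpow_add₀ hq, zpow_sub₀ hq, zpow_neg, two_mul, zpow_ofNat, zpow_one]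
  ring_nf

theorem aM_zpow {q : ℝ} (hq : q ≠ 0) (J M : ℤ) : aM q (q ^ J) (q ^ M) =
    q ^ (M - 1) * (qi q (J + M + 1) * qi q (J - M)) / qi q (2 * J + 1) := by
  simp only [aM, qi, zpow_add₀ hq, zpow_sub₀ hq, zpow_neg, two_mul, zpow_ofNat, zpow_one]
  ring_nf

theorem bP_zpow {q : ℝ} (hq : q ≠ 0) (J M : ℤ) : bP q (q ^ J) (q ^ M) =
    q ^ (M - J - 1) / qi q (2 * J + 3) := by
  simp only [bP, qi, zpow_add₀ hq, zpow_sub₀ hq, zpow_neg, two_mul, zpow_ofNat, zpow_one]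
  ring_nf

theorem bZ_zpow {q : ℝ} (hq : q ≠ 0) (J M : ℤ) : bZ q (q ^ J) (q ^ M) =
    (1 + q ^ 2) * q ^ M * qi q (J - M) / (qi q (2 * J + 1) * qi q (2 * J + 3)) := by
  simp only [bZ, qi, zpow_add₀ hq, zpow_sub₀ hq, zpow_neg, two_mul, zpow_ofNat, zpow_one]
  ring_nf

theorem bM_zpow {q : ℝ} (hq : q ≠ 0) (J M : ℤ) : bM q (q ^ J) (q ^ M) =
    -(q ^ (J + M + 1) * (qi q (J - M) * qi q (J - M - 1)) / qi q (2 * J + 1)) := by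
  simp only [bM, qi, zpow_add₀ hq, zpow_sub₀ hq, zpow_neg, two_mul, zpow_ofNat, zpow_one]
  ring_nf

theorem cP_zpow {q : ℝ} (hq : q ≠ 0) (J M : ℤ) : cP q (q ^ J) (q ^ M) =
    -(q ^ (J + M + 1) / qi q (2 * J + 3)) := by
  simp only [cP, qi, zpow_add₀ hq, zpow_sub₀ hq, zpow_neg, two_mul, zpow_ofNat, zpow_one]
  ring_nf

theorem cZ_zpow {q : ℝ} (hq : q ≠ 0) (J M : ℤ) : cZ q (q ^ J) (q ^ M) =
    (1 + q ^ 2) * q ^ (M - 1) * qi q (J + M + 1) / (qi q (2 * J + 1) * qi q (2 * J + 3)) := by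
  simp only [cZ, qi, zpow_add₀ hq, zpow_sub₀ hq, zpow_neg, two_mul, zpow_ofNat, zpow_one]
  ring_nf

theorem cM_zpow {q : ℝ} (hq : q ≠ 0) (J M : ℤ) : cM q (q ^ J) (q ^ M) =
    q ^ (M - J - 1) * (qi q (J + M) * qi q (J + M + 1)) / qi q (2 * J + 1) := by
  simp only [cM, qi, zpow_add₀ hq, zpow_sub₀ hq, zpow_neg, two_mul, zpow_ofNat, zpow_one]
  ring_nf

theorem uP_zpow {q : ℝ} (hq : q ≠ 0) (L M n : ℤ) : uP q (q ^ L) (q ^ M) (q ^ n) =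
    -(q ^ M / qi q (2 * L + 5)) := by
  simp only [uP, qi, zpow_add₀ hq, zpow_sub₀ hq, zpow_neg, two_mul, zpow_ofNat, zpow_one]
  ring_nf

theorem uM_zpow {q : ℝ} (hq : q ≠ 0) (L M n : ℤ) : uM q (q ^ L) (q ^ M) (q ^ n) =
    -(q ^ M * (qi q (L + M - n + 1) * qi q (L - M - n + 1)) / qi q (2 * L + 3)) := by
  simp only [uM, qi, zpow_add₀ hq, zpow_sub₀ hq, zpow_neg, two_mul, zpow_ofNat, zpow_one]
  ring_nf

theorem uZ_zpow {q : ℝ} (hq : q ≠ 0) (L M n : ℤ) : uZ q (q ^ L) (q ^ M) (q ^ n) =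
    -((q + q⁻¹) * q ^ (L + M + 2) * qi q (L - M - n + 1) / (qi q (2 * L + 3) * qi q (2 * L + 5))) := by
  simp only [uZ, qi, zpow_add₀ hq, zpow_sub₀ hq, zpow_neg, two_mul, zpow_ofNat, zpow_one]
  ring_nf

theorem wP_zpow {q : ℝ} (hq : q ≠ 0) (L M n : ℤ) : wP q (q ^ L) (q ^ M) (q ^ n) =
    -(q ^ (M + 1) / qi q (2 * L + 5)) := by
  simp only [wP, qi, zpow_add₀ hq, zpow_sub₀ hq, zpow_neg, two_mul, zpow_ofNat, zpow_one]
  ring_nf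

theorem wM_zpow {q : ℝ} (hq : q ≠ 0) (L M n : ℤ) : wM q (q ^ L) (q ^ M) (q ^ n) =
    -(q ^ (M - 1) * (qi q (L + M + n + 2) * qi q (L - M + n)) / qi q (2 * L + 3)) := by
  simp only [wM, qi, zpow_add₀ hq, zpow_sub₀ hq, zpow_neg, two_mul, zpow_ofNat, zpow_one]
  ring_nf

theorem wZ_zpow {q : ℝ} (hq : q ≠ 0) (L M n : ℤ) : wZ q (q ^ L) (q ^ M) (q ^ n) =
    (q + q⁻¹) * q ^ (-L + M - 2) * qi q (L + M + n + 2) / (qi q (2 * L + 3) * qi q (2 * L + 5)) := by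
  simp only [wZ, qi, zpow_add₀ hq, zpow_sub₀ hq, zpow_neg, two_mul, zpow_ofNat, zpow_one]
  ring_nf

theorem hP_zpow {q : ℝ} (hq : q ≠ 0) (L M n : ℤ) : hP q (q ^ L) (q ^ M) (q ^ n) =
    q ^ (M + n) / qi q (2 * L + 5) := by
  simp only [hP, qi, zpow_add₀ hq, zpow_sub₀ hq, zpow_neg, two_mul, zpow_ofNat, zpow_one]
  ring_nf

theorem hM_zpow {q : ℝ} (hq : q ≠ 0) (L M n : ℤ) : hM q (q ^ L) (q ^ M) (q ^ n) =
    q ^ (M - n - 1) * (qi q (L - M - n + 1) * qi q (L + M + n + 2)) / qi q (2 * L + 3) := by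
  simp only [hM, qi, zpow_add₀ hq, zpow_sub₀ hq, zpow_neg, two_mul, zpow_ofNat, zpow_one]
  ring_nf

theorem hZ_zpow {q : ℝ} (hq : q ≠ 0) (L M n : ℤ) : hZ q (q ^ L) (q ^ M) (q ^ n) =
    (qi q (L - M - n + 1) * qi q (L + M - n + 3) -
      q ^ (-2 : ℤ) * (qi q (L - M + n + 2) * qi q (L + M + n + 2))) / (qi q (2 * L + 3) * qi q (2 * L + 5)) := by
  simp only [hZ, qi, zpow_add₀ hq, zpow_sub₀ hq, zpow_neg, two_mul, zpow_ofNat, zpow_one]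
  ring_nf

theorem dP_zpow {q : ℝ} (hq : q ≠ 0) (L M n : ℤ) : dP q (q ^ L) (q ^ M) (q ^ n) =
    q ^ (-L + M - 1) / qi q (2 * L + 5) := by
  simp only [dP, qi, zpow_add₀ hq, zpow_sub₀ hq, zpow_neg, two_mul, zpow_ofNat, zpow_one]
  ring_nf

theorem dM_zpow {q : ℝ} (hq : q ≠ 0) (L M n : ℤ) : dM q (q ^ L) (q ^ M) (q ^ n) =
    -(q ^ (L + M + 2) * (qi q (L - M - n + 1) * qi q (L - M + n)) / qi q (2 * L + 3)) := by
  simp only [dM, qi, zpow_add₀ hq, zpow_sub₀ hq, zpow_neg, two_mul, zpow_ofNat, zpow_one]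
  ring_nf

theorem dZ_zpow {q : ℝ} (hq : q ≠ 0) (L M n : ℤ) : dZ q (q ^ L) (q ^ M) (q ^ n) =
    (q + q⁻¹) * q ^ (M + 1) * qi q (L - M - n + 1) / (qi q (2 * L + 3) * qi q (2 * L + 5)) := by
  simp only [dZ, qi, zpow_add₀ hq, zpow_sub₀ hq, zpow_neg, two_mul, zpow_ofNat, zpow_one]
  ring_nf

theorem tM_zpow {q : ℝ} (hq : q ≠ 0) (L M n : ℤ) : tM q (q ^ L) (q ^ M) (q ^ n) =
    q ^ (-L + M - 2) * (qi q (L + M + n + 2) * qi q (L + M - n + 1)) / qi q (2 * L + 3) := by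
  simp only [tM, qi, zpow_add₀ hq, zpow_sub₀ hq, zpow_neg, two_mul, zpow_ofNat, zpow_one]
  ring_nf

theorem tP_zpow {q : ℝ} (hq : q ≠ 0) (L M n : ℤ) : tP q (q ^ L) (q ^ M) (q ^ n) =
    -(q ^ (L + M + 3) / qi q (2 * L + 5)) := by
  simp only [tP, qi, zpow_add₀ hq, zpow_sub₀ hq, zpow_neg, two_mul, zpow_ofNat, zpow_one]
  ring_nf

theorem tZ_zpow {q : ℝ} (hq : q ≠ 0) (L M n : ℤ) : tZ q (q ^ L) (q ^ M) (q ^ n) =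
    (q + q⁻¹) * q ^ M * qi q (L + M + n + 2) / (qi q (2 * L + 3) * qi q (2 * L + 5)) := by
  simp only [tZ, qi, zpow_add₀ hq, zpow_sub₀ hq, zpow_neg, two_mul, zpow_ofNat, zpow_one]
  ring_nf

theorem qi_two {q : ℝ} (h0 : 0 < q) (h1 : q < 1) : qi q 2 = q + q⁻¹ := by
  have : q ^ 2 - 1 ≠ 0 := by nlinarith
  rw [qi, br]
  field_simp
  norm_cast
  ring

end QuantumSphere
end

/-! ### Given coefficients versus rational coefficients -/

noncomputable section
namespace QuantumSphere

section

variable {q : ℝ}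

/-- The square root is the ratio of the `q`-factorial weights at the two ends of the transition. The
pair of equations gives the coefficient of the transition and that of its adjoint; the lemmas below
follow this pattern. -/
theorem Ap_N1 (h0 : 0 < q) (h1 : q < 1) {J M : ℤ} (h : 0 ≤ J + M + 1) (h' : 0 ≤ J - M) :
    Ap q J M * √(N1 q J M) = √q * aP q (q ^ J) (q ^ M) * √(N1 q (J + 1) M) ∧
      Ap q J M * √(N1 q (J + 1) M) = √q * aM q (q ^ (J + 1)) (q ^ M) * √(N1 q J M) := by
  have hN : N1 q (J + 1) M = (qi q (J + M + 2) * qi q (J - M + 1)) * N1 q J M := by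
    simp only [N1]
    rw [qF_step q (n := J + M + 1) (m := J + 1 + M + 1) (by ring) (by omega), qF_step q (n := J - M) (m := J + 1 - M) (by ring) (by omega)]
    ring_nf
  obtain ⟨e1, e2⟩ := sqrt_balance (mul_nonneg (qi_nonneg h0 h1 (by omega)) (qi_nonneg h0 h1 (by omega))) (N1_pos h0 h1 J M) hN
  rw [Ap_eq h0, aP_zpow h0.ne', aM_zpow h0.ne']
  constructor
  · linear_combination (norm := ring_nf) (q ^ (M - 1) * √q / qi q (2 * J + 3)) * e1
  · linear_combination (norm := ring_nf) (q ^ (M - 1) * √q / qi q (2 * J + 3)) * e2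

theorem Bp_N1 (h0 : 0 < q) (h1 : q < 1) {J M : ℤ} (h : 0 ≤ J + M + 1) :
    Bp q J M * √(N1 q J M) = √q * bP q (q ^ J) (q ^ M) * √(N1 q (J + 1) (M + 1)) ∧
      Bp q J M * √(N1 q (J + 1) (M + 1)) = √q * cM q (q ^ (J + 1)) (q ^ (M + 1)) * √(N1 q J M) := by
  have hN : N1 q (J + 1) (M + 1) = (qi q (J + M + 2) * qi q (J + M + 3)) * N1 q J M := by
    simp only [N1]
    rw [qF_step q (n := J + M + 2) (m := J + 1 + (M + 1) + 1) (by ring) (by omega), qF_step q (n := J + M + 1) (m := J + M + 2) (by ring) (by omega)]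
    ring_nf
  obtain ⟨e1, e2⟩ := sqrt_balance (mul_nonneg (qi_nonneg h0 h1 (by omega)) (qi_nonneg h0 h1 (by omega))) (N1_pos h0 h1 J M) hN
  rw [Bp_eq h0, bP_zpow h0.ne', cM_zpow h0.ne']
  constructor
  · linear_combination (norm := ring_nf) (q ^ (M - J - 1) * √q / qi q (2 * J + 3)) * e1
  · linear_combination (norm := ring_nf) (q ^ (M - J - 1) * √q / qi q (2 * J + 3)) * e2

theorem Bm_N1 (h0 : 0 < q) (h1 : q < 1) {J M : ℤ} (h' : 0 ≤ J - M - 2) :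
    Bm q J M * √(N1 q J M) = √q * bM q (q ^ J) (q ^ M) * √(N1 q (J - 1) (M + 1)) ∧
      Bm q J M * √(N1 q (J - 1) (M + 1)) = √q * cP q (q ^ (J - 1)) (q ^ (M + 1)) * √(N1 q J M) := by
  have hN : N1 q J M = (qi q (J - M) * qi q (J - M - 1)) * N1 q (J - 1) (M + 1) := by
    simp only [N1]
    rw [qF_step q (n := J - M - 1) (m := J - M) (by ring) (by omega), qF_step q (n := J - M - 2) (m := J - M - 1) (by ring) (by omega)]
    ring_nf
  obtain ⟨e2, e1⟩ := sqrt_balance (mul_nonneg (qi_nonneg h0 h1 (by omega)) (qi_nonneg h0 h1 (by omega))) (N1_pos h0 h1 (J - 1) (M + 1)) hN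
  rw [Bm_eq h0, bM_zpow h0.ne', cP_zpow h0.ne']
  constructor
  · linear_combination (norm := ring_nf) (-(q ^ (J + M + 1) * √q / qi q (2 * J + 1))) * e1
  · linear_combination (norm := ring_nf) (-(q ^ (J + M + 1) * √q / qi q (2 * J + 1))) * e2

theorem B0_N1 (h0 : 0 < q) (h1 : q < 1) {J M : ℤ} (h : 0 ≤ J + M + 1) (h' : 0 ≤ J - M - 1) :
    B0 q J M * √(N1 q J M) = bZ q (q ^ J) (q ^ M) * √(N1 q J (M + 1)) ∧
      B0 q J M * √(N1 q J (M + 1)) = cZ q (q ^ J) (q ^ (M + 1)) * √(N1 q J M) := by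
  have hN : qi q (J - M) * N1 q J (M + 1) = qi q (J + M + 2) * N1 q J M := by
    simp only [N1]
    rw [qF_step q (n := J + M + 1) (m := J + (M + 1) + 1) (by ring) (by omega), qF_step q (n := J - M - 1) (m := J - M) (by ring) (by omega)]
    ring_nf
  obtain ⟨e1, e2⟩ := sqrt_balance_swap (qi_nonneg h0 h1 (by omega)) (qi_nonneg h0 h1 (by omega)) (N1_pos h0 h1 J M) (N1_pos h0 h1 J (M + 1)) hN
  rw [B0_eq h0, bZ_zpow h0.ne', cZ_zpow h0.ne']
  constructor
  · linear_combination (norm := ring_nf) ((1 + q ^ 2) * q ^ M / (qi q (2 * J + 1) * qi q (2 * J + 3))) * e1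
  · linear_combination (norm := ring_nf) ((1 + q ^ 2) * q ^ M / (qi q (2 * J + 1) * qi q (2 * J + 3))) * e2

theorem A0_eq_aZ (h0 : 0 < q) (h1 : q < 1) (J M : ℤ) : A0 q J M = aZ q (q ^ J) (q ^ M) := by
  rw [A0_eq h0, aZ_zpow h0.ne', qi_two h0 h1]

/-- The four double factorials step by two, matching `j ± 1, l + 1` at fixed `m₂`. The prefactor `q
^ (-L)` of `N2` supplies the `q⁻¹` that turns the stray `√q` into an integer power. -/
theorem cU_N2 (h0 : 0 < q) (h1 : q < 1) {L M n : ℤ} (h : 0 ≤ L + M + n + 2) (h' : 0 ≤ L - M + n) :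
    √q * cU q L M n * √(N2 q L M n) = uP q (q ^ L) (q ^ M) (q ^ n) * √(N2 q (L + 1) M (n + 1)) ∧
      √q * cU q L M n * √(N2 q (L + 1) M (n + 1)) = wM q (q ^ (L + 1)) (q ^ M) (q ^ (n + 1)) * √(N2 q L M n) := by
  have hq := h0.ne'
  have hs : √q ≠ 0 := (Real.sqrt_pos.2 h0).ne'
  have hs2 : √q * √q = q := Real.mul_self_sqrt h0.le
  have hN : N2 q (L + 1) M (n + 1) = q⁻¹ * (qi q (L + M + n + 4) * qi q (L - M + n + 2)) * N2 q L M n := by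
    simp only [N2]
    rw [qG_step q (n := L + M + n + 2) (m := L + 1 + M + (n + 1) + 2) (by ring) (by omega), qG_step q (n := L - M + n) (m := L + 1 - M + (n + 1)) (by ring) (by omega), neg_add, zpow_add₀ hq, zpow_neg_one]
    ring_nf
  obtain ⟨e1, e2⟩ := sqrt_balance_q h0 (mul_nonneg (qi_nonneg h0 h1 (by omega)) (qi_nonneg h0 h1 (by omega))) (N2_pos h0 h1 L M n) hN
  rw [cU, uP_zpow h0.ne', wM_zpow h0.ne']
  constructor
  · rw [show q ^ M = q ^ (M - 1) * (√q * √q) by rw [hs2, ← zpow_add_one₀ hq]; ring_nf]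
    linear_combination (norm := ring_nf) (-(√q * q ^ (M - 1) / qi q (2 * L + 5))) * e1
  · linear_combination (norm := ring_nf) (-(q ^ (M - 1) / qi q (2 * L + 5))) * e2

theorem cW_N2 (h0 : 0 < q) (h1 : q < 1) {L M n : ℤ} (h : 0 ≤ L + M - n + 1) (h' : 0 ≤ L - M - n + 1) :
    √q * cW q L M n * √(N2 q L M n) = wP q (q ^ L) (q ^ M) (q ^ n) * √(N2 q (L + 1) M (n - 1)) ∧
      √q * cW q L M n * √(N2 q (L + 1) M (n - 1)) = uM q (q ^ (L + 1)) (q ^ M) (q ^ (n - 1)) * √(N2 q L M n) := by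
  have hq := h0.ne'
  have hs : √q ≠ 0 := (Real.sqrt_pos.2 h0).ne'
  have hs2 : √q * √q = q := Real.mul_self_sqrt h0.le
  have hN : N2 q (L + 1) M (n - 1) = q⁻¹ * (qi q (L + M - n + 3) * qi q (L - M - n + 3)) * N2 q L M n := by
    simp only [N2]
    rw [qG_step q (n := L + M - n + 1) (m := L + 1 + M - (n - 1) + 1) (by ring) (by omega), qG_step q (n := L - M - n + 1) (m := L + 1 - M - (n - 1) + 1) (by ring) (by omega), neg_add, zpow_add₀ hq, zpow_neg_one]
    ring_nf
  obtain ⟨e1, e2⟩ := sqrt_balance_q h0 (mul_nonneg (qi_nonneg h0 h1 (by omega)) (qi_nonneg h0 h1 (by omega))) (N2_pos h0 h1 L M n) hN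
  rw [cW, wP_zpow h0.ne', uM_zpow h0.ne']
  constructor
  · rw [show q ^ (M + 1) = q ^ M * (√q * √q) by rw [hs2, ← zpow_add_one₀ hq]]
    linear_combination (norm := ring_nf) (-(√q * q ^ (M) / qi q (2 * L + 5))) * e1
  · linear_combination (norm := ring_nf) (-(q ^ (M) / qi q (2 * L + 5))) * e2

theorem Hp_N2 (h0 : 0 < q) (h1 : q < 1) {L M n : ℤ} (h : 0 ≤ L - M + n) (h' : 0 ≤ L + M - n + 1) :
    (q ^ (M + n - 1) * √q * √(qi q (L - M + n + 2) * qi q (L + M - n + 3)) / qi q (2 * L + 5)) * √(N2 q L M n) = hP q (q ^ L) (q ^ M) (q ^ n) * √(N2 q (L + 1) M (-n)) ∧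
      (q ^ (M + n - 1) * √q * √(qi q (L - M + n + 2) * qi q (L + M - n + 3)) / qi q (2 * L + 5)) * √(N2 q (L + 1) M (-n)) = hM q (q ^ (L + 1)) (q ^ M) (q ^ (-n)) * √(N2 q L M n) := by
  have hq := h0.ne'
  have hs : √q ≠ 0 := (Real.sqrt_pos.2 h0).ne'
  have hs2 : √q * √q = q := Real.mul_self_sqrt h0.le
  have hN : N2 q (L + 1) M (-n) = q⁻¹ * (qi q (L - M + n + 2) * qi q (L + M - n + 3)) * N2 q L M n := by
    simp only [N2]
    rw [qG_step q (n := L + M - n + 1) (m := L + 1 + M + -n + 2) (by ring) (by omega), qG_step q (n := L - M + n) (m := L + 1 - M - -n + 1) (by ring) (by omega), neg_add, zpow_add₀ hq, zpow_neg_one]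
    ring_nf
  obtain ⟨e1, e2⟩ := sqrt_balance_q h0 (mul_nonneg (qi_nonneg h0 h1 (by omega)) (qi_nonneg h0 h1 (by omega))) (N2_pos h0 h1 L M n) hN
  rw [hP_zpow h0.ne', hM_zpow h0.ne']
  constructor
  · rw [show q ^ (M + n) = q ^ (M + n - 1) * (√q * √q) by rw [hs2, ← zpow_add_one₀ hq]; ring_nf]
    linear_combination (norm := ring_nf) ((√q * q ^ (M + n - 1) / qi q (2 * L + 5))) * e1
  · linear_combination (norm := ring_nf) ((q ^ (M + n - 1) / qi q (2 * L + 5))) * e2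

theorem Dp_N2 (h0 : 0 < q) (h1 : q < 1) {L M n : ℤ} (h : 0 ≤ L + M + n + 2) (h' : 0 ≤ L + M - n + 1) :
    (q ^ (-L + M - 2) * √q * √(qi q (L + M + n + 4) * qi q (L + M - n + 3)) / qi q (2 * L + 5)) * √(N2 q L M n) = dP q (q ^ L) (q ^ M) (q ^ n) * √(N2 q (L + 1) (M + 1) n) ∧
      (q ^ (-L + M - 2) * √q * √(qi q (L + M + n + 4) * qi q (L + M - n + 3)) / qi q (2 * L + 5)) * √(N2 q (L + 1) (M + 1) n) = tM q (q ^ (L + 1)) (q ^ (M + 1)) (q ^ n) * √(N2 q L M n) := by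
  have hq := h0.ne'
  have hs : √q ≠ 0 := (Real.sqrt_pos.2 h0).ne'
  have hs2 : √q * √q = q := Real.mul_self_sqrt h0.le
  have hN : N2 q (L + 1) (M + 1) n = q⁻¹ * (qi q (L + M + n + 4) * qi q (L + M - n + 3)) * N2 q L M n := by
    simp only [N2]
    rw [qG_step q (n := L + M + n + 2) (m := L + 1 + (M + 1) + n + 2) (by ring) (by omega), qG_step q (n := L + M - n + 1) (m := L + 1 + (M + 1) - n + 1) (by ring) (by omega), neg_add, zpow_add₀ hq, zpow_neg_one]
    ring_nf
  obtain ⟨e1, e2⟩ := sqrt_balance_q h0 (mul_nonneg (qi_nonneg h0 h1 (by omega)) (qi_nonneg h0 h1 (by omega))) (N2_pos h0 h1 L M n) hN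
  rw [dP_zpow h0.ne', tM_zpow h0.ne']
  constructor
  · rw [show q ^ (-L + M - 1) = q ^ (-L + M - 2) * (√q * √q) by rw [hs2, ← zpow_add_one₀ hq]; ring_nf]
    linear_combination (norm := ring_nf) ((√q * q ^ (-L + M - 2) / qi q (2 * L + 5))) * e1
  · linear_combination (norm := ring_nf) ((q ^ (-L + M - 2) / qi q (2 * L + 5))) * e2

theorem Dm_N2 (h0 : 0 < q) (h1 : q < 1) {L M n : ℤ} (h : 0 ≤ L - M - n - 1) (h' : 0 ≤ L - M + n - 2) :
    -(q ^ (L + M + 2) * √q * √(qi q (L - M - n + 1) * qi q (L - M + n)) / qi q (2 * L + 3)) * √(N2 q L M n) = dM q (q ^ L) (q ^ M) (q ^ n) * √(N2 q (L - 1) (M + 1) n) ∧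
      -(q ^ (L + M + 2) * √q * √(qi q (L - M - n + 1) * qi q (L - M + n)) / qi q (2 * L + 3)) * √(N2 q (L - 1) (M + 1) n) = tP q (q ^ (L - 1)) (q ^ (M + 1)) (q ^ n) * √(N2 q L M n) := by
  have hq := h0.ne'
  have hs : √q ≠ 0 := (Real.sqrt_pos.2 h0).ne'
  have hs2 : √q * √q = q := Real.mul_self_sqrt h0.le
  have hN : N2 q L M n = q⁻¹ * (qi q (L - M - n + 1) * qi q (L - M + n)) * N2 q (L - 1) (M + 1) n := by
    simp only [N2]
    rw [qG_step q (n := L - M - n - 1) (m := L - M - n + 1) (by ring) (by omega), qG_step q (n := L - M + n - 2) (m := L - M + n) (by ring) (by omega), show q ^ (-(L - 1)) = q ^ (-L) * q by rw [← zpow_add_one₀ hq]; ring_nf]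
    field_simp
    ring_nf
  obtain ⟨e2, e1⟩ := sqrt_balance_q h0 (mul_nonneg (qi_nonneg h0 h1 (by omega)) (qi_nonneg h0 h1 (by omega))) (N2_pos h0 h1 (L - 1) (M + 1) n) hN
  rw [dM_zpow h0.ne', tP_zpow h0.ne']
  constructor
  · linear_combination (norm := ring_nf) (-(q ^ (L + M + 2) / qi q (2 * L + 3))) * e1
  · rw [show q ^ (L - 1 + (M + 1) + 3) = q ^ (L + M + 2) * (√q * √q) by rw [hs2, ← zpow_add_one₀ hq]; ring_nf]
    linear_combination (norm := ring_nf) (-(√q * q ^ (L + M + 2) / qi q (2 * L + 3))) * e2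

theorem D0_N2 (h0 : 0 < q) (h1 : q < 1) {L M n : ℤ} (h : 0 ≤ L - M - n - 1) (h' : 0 ≤ L + M - n + 1) :
    (qi q 2 * q ^ (M + 1) * √(qi q (L - M - n + 1) * qi q (L + M - n + 3)) /
      (qi q (2 * L + 3) * qi q (2 * L + 5))) * √(N2 q L M n) = dZ q (q ^ L) (q ^ M) (q ^ n) * √(N2 q L (M + 1) (-n)) ∧
      (qi q 2 * q ^ (M + 1) * √(qi q (L - M - n + 1) * qi q (L + M - n + 3)) /
      (qi q (2 * L + 3) * qi q (2 * L + 5))) * √(N2 q L (M + 1) (-n)) = tZ q (q ^ L) (q ^ (M + 1)) (q ^ (-n)) * √(N2 q L M n) := by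
  have hq := h0.ne'
  have hs : √q ≠ 0 := (Real.sqrt_pos.2 h0).ne'
  have hs2 : √q * √q = q := Real.mul_self_sqrt h0.le
  have hN : qi q (L - M - n + 1) * N2 q L (M + 1) (-n) = qi q (L + M - n + 3) * N2 q L M n := by
    simp only [N2]
    rw [qG_step q (n := L + M - n + 1) (m := L + (M + 1) + -n + 2) (by ring) (by omega), qG_step q (n := L - M - n - 1) (m := L - M - n + 1) (by ring) (by omega)]
    ring_nf
  obtain ⟨e1, e2⟩ := sqrt_balance_swap (qi_nonneg h0 h1 (by omega)) (qi_nonneg h0 h1 (by omega)) (N2_pos h0 h1 L M n) (N2_pos h0 h1 L (M + 1) (-n)) hN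
  rw [qi_two h0 h1, dZ_zpow h0.ne', tZ_zpow h0.ne']
  constructor
  · linear_combination (norm := ring_nf) ((q + q⁻¹) * q ^ (M + 1) / (qi q (2 * L + 3) * qi q (2 * L + 5))) * e1
  · linear_combination (norm := ring_nf) ((q + q⁻¹) * q ^ (M + 1) / (qi q (2 * L + 3) * qi q (2 * L + 5))) * e2

theorem gU_N2 (h0 : 0 < q) (h1 : q < 1) {L M n : ℤ} (h : 0 ≤ L - M - n - 1) (h' : 0 ≤ L - M + n) :
    √q * -gU q L M n * √(N2 q L M n) = uZ q (q ^ L) (q ^ M) (q ^ n) * √(N2 q L M (-(n + 1))) ∧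
      √q * -gU q L M n * √(N2 q L M (-(n + 1))) =
        uZ q (q ^ L) (q ^ M) (q ^ (-(n + 1))) * √(N2 q L M n) := by
  have hq := h0.ne'
  have hs2 : √q * √q = q := Real.mul_self_sqrt h0.le
  have hN : qi q (L - M + n + 2) * N2 q L M n = qi q (L - M - n + 1) * N2 q L M (-(n + 1)) := by
    simp only [N2]
    rw [qG_step q (n := L - M + n) (m := L - M - -(n + 1) + 1) (by ring) (by omega), qG_step q (n := L - M - n - 1) (m := L - M - n + 1) (by ring) (by omega)]
    ring_nf
  obtain ⟨e2, e1⟩ := sqrt_balance_swap (qi_nonneg h0 h1 (by omega)) (qi_nonneg h0 h1 (by omega)) (N2_pos h0 h1 L M (-(n + 1))) (N2_pos h0 h1 L M n) hN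
  rw [gU, qi_two h0 h1, uZ_zpow hq, uZ_zpow hq,
    show q ^ (L + M + 2) = q ^ (L + M + 1) * (√q * √q) by rw [hs2, ← zpow_add_one₀ hq]; ring_nf]
  constructor
  · linear_combination (norm := ring_nf) (-((q + q⁻¹) * q ^ (L + M + 1) * (√q * √q) / (qi q (2 * L + 3) * qi q (2 * L + 5)))) * e1
  · linear_combination (norm := ring_nf) (-((q + q⁻¹) * q ^ (L + M + 1) * (√q * √q) / (qi q (2 * L + 3) * qi q (2 * L + 5)))) * e2

theorem gW_N2 (h0 : 0 < q) (h1 : q < 1) {L M n : ℤ} (h : 0 ≤ L + M - n + 1) (h' : 0 ≤ L + M + n) :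
    √q * -gW q L M n * √(N2 q L M n) = wZ q (q ^ L) (q ^ M) (q ^ n) * √(N2 q L M (-(n - 1))) ∧
      √q * -gW q L M n * √(N2 q L M (-(n - 1))) =
        wZ q (q ^ L) (q ^ M) (q ^ (-(n - 1))) * √(N2 q L M n) := by
  have hq := h0.ne'
  have hs2 : √q * √q = q := Real.mul_self_sqrt h0.le
  have hN : qi q (L + M - n + 3) * N2 q L M n = qi q (L + M + n + 2) * N2 q L M (-(n - 1)) := by
    simp only [N2]
    rw [qG_step q (n := L + M - n + 1) (m := L + M + -(n - 1) + 2) (by ring) (by omega), qG_step q (n := L + M + n) (m := L + M + n + 2) (by ring) (by omega)]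
    ring_nf
  obtain ⟨e2, e1⟩ := sqrt_balance_swap (qi_nonneg h0 h1 (by omega)) (qi_nonneg h0 h1 (by omega)) (N2_pos h0 h1 L M (-(n - 1))) (N2_pos h0 h1 L M n) hN
  rw [gW, qi_two h0 h1, wZ_zpow hq, wZ_zpow hq,
    show q ^ (-L + M - 2) = q ^ (-L + M - 3) * (√q * √q) by rw [hs2, ← zpow_add_one₀ hq]; ring_nf]
  constructor
  · linear_combination (norm := ring_nf) (((q + q⁻¹) * q ^ (-L + M - 3) * (√q * √q) / (qi q (2 * L + 3) * qi q (2 * L + 5)))) * e1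
  · linear_combination (norm := ring_nf) (((q + q⁻¹) * q ^ (-L + M - 3) * (√q * √q) / (qi q (2 * L + 3) * qi q (2 * L + 5)))) * e2

theorem H0_eq_hZ (h0 : 0 < q) (L J M : ℤ) :
    H0 q L J M = hZ q (q ^ L) (q ^ M) (q ^ nn L J M) := by
  rw [H0_eq h0, hZ_zpow h0.ne']

end
end QuantumSphere
end

/-! ### Transitions between labels: boundary vanishing and adjoint coefficients -/

noncomputable section
namespace QuantumSphere

/-- Admissibility of `(m₁, j)`. -/
def MAdm (M J : ℤ) : Prop := -J - 1 ≤ M ∧ M ≤ J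

/-- Admissibility of `(l, m₂, j)`, apart from `0 < j`. -/
def VAdm (L M J : ℤ) : Prop := -(L - J) - 1 ≤ M ∧ M ≤ L - J

/-- The conditions `0 ≤ J` and `J ≤ L` need not be listed: they express that the intervals for `M₁`
and `M₂` are non-empty. -/
theorem admissible_iff {L M₁ M₂ J : ℤ} : Admissible L M₁ M₂ J ↔ MAdm M₁ J ∧ VAdm L M₂ J := by
  unfold Admissible MAdm VAdm; omega

/-- The norm of the unnormalised basis vector, as far as it depends on `l, m₂, j`. -/
def nV (q : ℝ) (L M J : ℤ) : ℝ := √(N2 q L M (nn L J M))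

/-- The norm of the unnormalised basis vector, as far as it depends on `m₁, j`. -/
def nM (q : ℝ) (M J : ℤ) : ℝ := √(N1 q J M)

theorem nV_pos {q : ℝ} (h0 : 0 < q) (h1 : q < 1) (L M J : ℤ) : 0 < nV q L M J :=
  Real.sqrt_pos.2 (N2_pos h0 h1 _ _ _)

theorem nM_pos {q : ℝ} (h0 : 0 < q) (h1 : q < 1) (M J : ℤ) : 0 < nM q M J :=
  Real.sqrt_pos.2 (N1_pos h0 h1 _ _)

/-- `A` is the normalised form of a matrix coefficient `α` in the `(m₁, j)`-part, and `α'` is the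
adjoint coefficient. -/
structure MEdge (q : ℝ) (e d : ℤ) (α α' A : ℤ → ℤ → ℝ) : Prop where
  out : ∀ M J, MAdm M J → ¬MAdm (M + e) (J + d) → α J M = 0
  out' : ∀ M J, MAdm M J → ¬MAdm (M - e) (J - d) → α' J M = 0
  fwd : ∀ M J, MAdm M J → MAdm (M + e) (J + d) → A J M * nM q M J = α J M * nM q (M + e) (J + d)
  bwd : ∀ M J, MAdm M J → MAdm (M + e) (J + d) →
    A J M * nM q (M + e) (J + d) = α' (J + d) (M + e) * nM q M J

/-- `b` is the normalised form of a matrix coefficient `β` in the `(l, m₂, j)`-part, and `β'` is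
the adjoint coefficient. -/
structure VEdge (q : ℝ) (a c d : ℤ) (β β' b : ℤ → ℤ → ℤ → ℝ) : Prop where
  out : ∀ L M J, 0 ≤ J → VAdm L M J → ¬VAdm (L + a) (M + c) (J + d) → β L J M = 0
  out' : ∀ L M J, 0 ≤ J → VAdm L M J → ¬VAdm (L - a) (M - c) (J - d) → β' L J M = 0
  fwd : ∀ L M J, 0 ≤ J → 0 ≤ J + d → VAdm L M J → VAdm (L + a) (M + c) (J + d) →
    b L J M * nV q L M J = β L J M * nV q (L + a) (M + c) (J + d)
  bwd : ∀ L M J, 0 ≤ J → 0 ≤ J + d → VAdm L M J → VAdm (L + a) (M + c) (J + d) →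
    b L J M * nV q (L + a) (M + c) (J + d) = β' (L + a) (J + d) (M + c) * nV q L M J

theorem MEdge.symm {q : ℝ} {e d : ℤ} {α α' A : ℤ → ℤ → ℝ} (h : MEdge q e d α α' A) :
    MEdge q (-e) (-d) α' α fun J M => A (J - d) (M - e) where
  out M J := by simpa only [← sub_eq_add_neg] using h.out' M J
  out' M J := by simpa only [sub_neg_eq_add] using h.out M J
  fwd M J h1 h2 := by
    simp only [← sub_eq_add_neg] at h2 ⊢
    have := h.bwd (M - e) (J - d) h2 (by simpa using h1)
    simpa using this
  bwd M J h1 h2 := by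
    simp only [← sub_eq_add_neg] at h2 ⊢
    have := h.fwd (M - e) (J - d) h2 (by simpa using h1)
    simpa using this

theorem VEdge.symm {q : ℝ} {a c d : ℤ} {β β' b : ℤ → ℤ → ℤ → ℝ} (h : VEdge q a c d β β' b) :
    VEdge q (-a) (-c) (-d) β' β fun L J M => b (L - a) (J - d) (M - c) where
  out L M J := by simpa only [← sub_eq_add_neg] using h.out' L M J
  out' L M J := by simpa only [sub_neg_eq_add] using h.out L M J
  fwd L M J h1 h2 h3 h4 := by
    simp only [← sub_eq_add_neg] at h2 h4 ⊢
    have := h.bwd (L - a) (M - c) (J - d) h2 (by simpa using h1) h4 (by simpa using h3)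
    simpa using this
  bwd L M J h1 h2 h3 h4 := by
    simp only [← sub_eq_add_neg] at h2 h4 ⊢
    have := h.fwd (L - a) (M - c) (J - d) h2 (by simpa using h1) h4 (by simpa using h3)
    simpa using this

section Coefs

variable (q : ℝ)

open Classical in
def vpP (L J M : ℤ) : ℝ :=
  if par L J M then uP q (q ^ L) (q ^ M) (q ^ (J + 1)) else wP q (q ^ L) (q ^ M) (q ^ (-(J + 1)))

open Classical in
def vpZ (L J M : ℤ) : ℝ :=
  if par L J M then uZ q (q ^ L) (q ^ M) (q ^ (J + 1)) else wZ q (q ^ L) (q ^ M) (q ^ (-(J + 1)))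

open Classical in
def vpM (L J M : ℤ) : ℝ :=
  if par L J M then uM q (q ^ L) (q ^ M) (q ^ (J + 1)) else wM q (q ^ L) (q ^ M) (q ^ (-(J + 1)))

open Classical in
def vmP (L J M : ℤ) : ℝ :=
  if par L J M then wP q (q ^ L) (q ^ M) (q ^ (J + 1)) else uP q (q ^ L) (q ^ M) (q ^ (-(J + 1)))

open Classical in
def vmZ (L J M : ℤ) : ℝ :=
  if par L J M then wZ q (q ^ L) (q ^ M) (q ^ (J + 1)) else uZ q (q ^ L) (q ^ M) (q ^ (-(J + 1)))

open Classical in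
def vmM (L J M : ℤ) : ℝ :=
  if par L J M then wM q (q ^ L) (q ^ M) (q ^ (J + 1)) else uM q (q ^ L) (q ^ M) (q ^ (-(J + 1)))

/-- Evaluation of a coefficient at `(q ^ l, q ^ m₂, q ^ n)`. -/
def atn (f : ℝ → ℝ → ℝ → ℝ → ℝ) (L J M : ℤ) : ℝ := f q (q ^ L) (q ^ M) (q ^ nn L J M)

def atj (f : ℝ → ℝ → ℝ → ℝ) (J M : ℤ) : ℝ := f q (q ^ J) (q ^ M)

theorem q_pow_nn (L J M : ℤ) [Decidable (par L J M)] :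
    (if par L J M then q ^ (J + 1) else (q ^ (J + 1))⁻¹) = q ^ nn L J M := by
  unfold nn; split_ifs <;> simp only [zpow_neg]

theorem Vp_k (L M₁ M₂ J : ℤ) : Vp q (k L M₁ M₂ J) =
    vpP q L J M₂ • k (L + 1) M₁ M₂ (J + 1) + vpZ q L J M₂ • k L M₁ M₂ (J + 1) +
      vpM q L J M₂ • k (L - 1) M₁ M₂ (J + 1) := by
  simp only [Vp, latMap_k, vpP, vpZ, vpM, zpow_neg]
  split_ifs <;> rfl

theorem Vm_k (L M₁ M₂ J : ℤ) : Vm q (k L M₁ M₂ J) =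
    vmP q L J M₂ • k (L + 1) M₁ M₂ (J - 1) + vmZ q L J M₂ • k L M₁ M₂ (J - 1) +
      vmM q L J M₂ • k (L - 1) M₁ M₂ (J - 1) := by
  simp only [Vm, latMap_k, vmP, vmZ, vmM, zpow_neg]
  split_ifs <;> rfl

theorem Vz_k (L M₁ M₂ J : ℤ) : Vz q (k L M₁ M₂ J) =
    atn q hP L J M₂ • k (L + 1) M₁ M₂ J + atn q hZ L J M₂ • k L M₁ M₂ J +
      atn q hM L J M₂ • k (L - 1) M₁ M₂ J := by
  simp only [Vz, latMap_k, atn, q_pow_nn]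

theorem Dop_k (L M₁ M₂ J : ℤ) : Dop q (k L M₁ M₂ J) =
    atn q dP L J M₂ • k (L + 1) M₁ (M₂ + 1) J + atn q dZ L J M₂ • k L M₁ (M₂ + 1) J +
      atn q dM L J M₂ • k (L - 1) M₁ (M₂ + 1) J := by
  simp only [Dop, latMap_k, atn, q_pow_nn]

theorem Dst_k (L M₁ M₂ J : ℤ) : Dst q (k L M₁ M₂ J) =
    atn q tP L J M₂ • k (L + 1) M₁ (M₂ - 1) J + atn q tZ L J M₂ • k L M₁ (M₂ - 1) J +
      atn q tM L J M₂ • k (L - 1) M₁ (M₂ - 1) J := by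
  simp only [Dst, latMap_k, atn, q_pow_nn]

end Coefs

section MEdges

variable {q : ℝ}

theorem mul_qi_eq_zero {m n : ℤ} (h : m = 0 ∨ n = 0) : qi q m * qi q n = 0 := by
  rcases h with rfl | rfl <;> simp [qi_zero]

/-- Only products of a coefficient in `(j, m₁)` with one in `(l, m₂, j)` occur in the
representation. A factor `√q` is therefore moved from `A^±, B^±` to `C`, so that both factors become
rational in the rescaled basis. -/
theorem mEdge_Ap (h0 : 0 < q) (h1 : q < 1) : MEdge q 0 1 (atj q aP) (atj q aM) fun J M => Ap q J M / √q := by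
  have hs := (Real.sqrt_pos.2 h0).ne'
  constructor <;> intro M J h h' <;> simp only [MAdm, atj, nM, add_zero] at *
  · omega
  · rw [aM_zpow h0.ne', mul_qi_eq_zero (by omega)]; simp
  · have := (Ap_N1 h0 h1 (J := J) (M := M) (by omega) (by omega)).1
    field_simp
    linear_combination this
  · have := (Ap_N1 h0 h1 (J := J) (M := M) (by omega) (by omega)).2
    field_simp
    linear_combination this

theorem mEdge_Bp (h0 : 0 < q) (h1 : q < 1) : MEdge q 1 1 (atj q bP) (atj q cM) fun J M => Bp q J M / √q := by
  have hs := (Real.sqrt_pos.2 h0).ne'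
  constructor <;> intro M J h h' <;> simp only [MAdm, atj, nM] at *
  · omega
  · rw [cM_zpow h0.ne', mul_qi_eq_zero (by omega)]; simp
  · have := (Bp_N1 h0 h1 (J := J) (M := M) (by omega)).1
    field_simp
    linear_combination this
  · have := (Bp_N1 h0 h1 (J := J) (M := M) (by omega)).2
    field_simp
    linear_combination this

theorem mEdge_Bm (h0 : 0 < q) (h1 : q < 1) : MEdge q 1 (-1) (atj q bM) (atj q cP) fun J M => Bm q J M / √q := by
  have hs := (Real.sqrt_pos.2 h0).ne'
  constructor <;> intro M J h h' <;> simp only [MAdm, atj, nM, ← sub_eq_add_neg] at *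
  · rw [bM_zpow h0.ne', mul_qi_eq_zero (by omega)]; simp
  · omega
  · have := (Bm_N1 h0 h1 (J := J) (M := M) (by omega)).1
    field_simp
    linear_combination this
  · have := (Bm_N1 h0 h1 (J := J) (M := M) (by omega)).2
    field_simp
    linear_combination this

theorem mEdge_B0 (h0 : 0 < q) (h1 : q < 1) : MEdge q 1 0 (atj q bZ) (atj q cZ) fun J M => B0 q J M := by
  constructor <;> intro M J h h' <;> simp only [MAdm, atj, nM, add_zero] at *
  · rw [bZ_zpow h0.ne', show J - M = 0 by omega, qi_zero]; simp
  · rw [cZ_zpow h0.ne', show J + M + 1 = 0 by omega, qi_zero]; simp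
  · exact (B0_N1 h0 h1 (by omega) (by omega)).1
  · exact (B0_N1 h0 h1 (by omega) (by omega)).2

theorem mEdge_A0 (h0 : 0 < q) (h1 : q < 1) : MEdge q 0 0 (atj q aZ) (atj q aZ) fun J M => A0 q J M := by
  constructor <;> intro M J h h' <;> simp only [MAdm, atj, nM, add_zero, A0_eq_aZ h0 h1] at *
  · omega
  · omega

end MEdges

section VEdges

variable {q : ℝ}

theorem nn_of_par {L J M : ℤ} (h : par L J M) : nn L J M = J + 1 := if_pos h

theorem nn_of_not_par {L J M : ℤ} (h : ¬par L J M) : nn L J M = -(J + 1) := if_neg h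

/-- The parity is put in a form usable in linear integer arithmetic. It sharpens the bounds: for
instance `L - M - J ≥ 0` and odd forces `≥ 1`, which keeps the arguments of the double factorials
non-negative on admissible labels. -/
theorem nn_cases (L J M : ℤ) :
    (2 * ((L - J - M) / 2) = L - J - M ∧ nn L J M = J + 1) ∨
      (2 * ((L - J - M) / 2) + 1 = L - J - M ∧ nn L J M = -(J + 1)) := by
  by_cases hp : par L J M
  · refine .inl ⟨?_, nn_of_par hp⟩
    simp only [par, Int.even_iff] at hp; omega
  · refine .inr ⟨?_, nn_of_not_par hp⟩
    simp only [par, Int.even_iff] at hp; omega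

/-- The adjoint of raising `l` and `j` is lowering both, so the partner of `vpP` is `vmM`. The
parity is preserved, and at the boundary one of the two brackets in the adjoint coefficient is
`[0]`. -/
theorem vEdge_Cp (h0 : 0 < q) (h1 : q < 1) : VEdge q 1 0 1 (vpP q) (vmM q) fun L J M => √q * Cp q L J M := by
  constructor
  · intro L M J hJ h h'
    simp only [VAdm] at *
    omega
  · intro L M J hJ h h'
    simp only [VAdm, vmM] at *
    split_ifs with hp <;> simp only [par, Int.even_iff] at hp
    · rw [wM_zpow h0.ne', mul_qi_eq_zero (by omega)]; simp
    · rw [uM_zpow h0.ne', mul_qi_eq_zero (by omega)]; simp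
  all_goals
    intro L M J hJ hJ' h h'
    have hc := nn_cases L J M
    simp only [add_zero] at h' ⊢
    simp only [VAdm, vpP, vmM, nV] at *
    by_cases hp : par L J M
    · rw [nn_of_par hp] at hc
      have hp' : par (L + 1) (J + 1) M := by rw [par_L_add, par_J_add, not_not]; exact hp
      have := cU_N2 h0 h1 (L := L) (M := M) (n := J + 1) (by omega) (by omega)
      simp only [if_pos hp, if_pos hp', nn_of_par hp, nn_of_par hp', Cp_of_par h0 hp]
      first | exact this.1 | exact this.2
    · rw [nn_of_not_par hp] at hc
      have hp' : ¬par (L + 1) (J + 1) M := by rw [par_L_add, par_J_add, not_not]; exact hp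
      have := cW_N2 h0 h1 (L := L) (M := M) (n := -(J + 1)) (by omega) (by omega)
      rw [show -(J + 1) - 1 = -(J + 1 + 1) by ring] at this
      simp only [if_neg hp, if_neg hp', nn_of_not_par hp, nn_of_not_par hp', Cp_of_not_par h0 hp]
      first | exact this.1 | exact this.2

theorem vEdge_Cm (h0 : 0 < q) (h1 : q < 1) : VEdge q (-1) 0 1 (vpM q) (vmP q) fun L J M => √q * Cm q L J M := by
  constructor
  · intro L M J hJ h h'
    simp only [VAdm, vpM] at *
    split_ifs with hp <;> simp only [par, Int.even_iff] at hp
    · rw [uM_zpow h0.ne', mul_qi_eq_zero (by omega)]; simp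
    · rw [wM_zpow h0.ne', mul_qi_eq_zero (by omega)]; simp
  · intro L M J hJ h h'
    simp only [VAdm] at *
    omega
  all_goals
    intro L M J hJ hJ' h h'
    have hc := nn_cases L J M
    simp only [add_zero, ← sub_eq_add_neg] at h' ⊢
    simp only [VAdm, vpM, vmP, nV] at *
    by_cases hp : par L J M
    · rw [nn_of_par hp] at hc
      have hp' : par (L - 1) (J + 1) M := by rw [par_L_sub, par_J_add, not_not]; exact hp
      have := cW_N2 h0 h1 (L := L - 1) (M := M) (n := J + 2) (by omega) (by omega)
      rw [show L - 1 + 1 = L by ring, show J + 2 - 1 = J + 1 by ring] at this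
      simp only [if_pos hp, if_pos hp', nn_of_par hp, nn_of_par hp', Cm_of_par h0 hp,
        show J + 1 + 1 = J + 2 by ring]
      first | exact this.1 | exact this.2
    · rw [nn_of_not_par hp] at hc
      have hp' : ¬par (L - 1) (J + 1) M := by rw [par_L_sub, par_J_add, not_not]; exact hp
      have := cU_N2 h0 h1 (L := L - 1) (M := M) (n := -(J + 2)) (by omega) (by omega)
      rw [show L - 1 + 1 = L by ring, show -(J + 2) + 1 = -(J + 1) by ring] at this
      simp only [if_neg hp, if_neg hp', nn_of_not_par hp, nn_of_not_par hp', Cm_of_not_par h0 hp,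
        show J + 1 + 1 = J + 2 by ring]
      first | exact this.1 | exact this.2

theorem vEdge_C0 (h0 : 0 < q) (h1 : q < 1) : VEdge q 0 0 1 (vpZ q) (vmZ q) fun L J M => √q * -C0 q L J M := by
  constructor
  · intro L M J hJ h h'
    simp only [VAdm, vpZ] at *
    split_ifs with hp <;> simp only [par, Int.even_iff] at hp
    · rw [uZ_zpow h0.ne', show L - M - (J + 1) + 1 = 0 by omega, qi_zero]; simp
    · rw [wZ_zpow h0.ne', show L + M + -(J + 1) + 2 = 0 by omega, qi_zero]; simp
  · intro L M J hJ h h'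
    simp only [VAdm] at *
    omega
  all_goals
    intro L M J hJ hJ' h h'
    have hc := nn_cases L J M
    simp only [add_zero] at h' ⊢
    simp only [VAdm, vpZ, vmZ, nV] at *
    by_cases hp : par L J M
    · rw [nn_of_par hp] at hc
      have hp' : ¬par L (J + 1) M := by rw [par_J_add, not_not]; exact hp
      have := gU_N2 h0 h1 (L := L) (M := M) (n := J + 1) (by omega) (by omega)
      simp only [if_pos hp, if_neg hp', nn_of_par hp, nn_of_not_par hp', C0_of_par h0 hp]
      first | exact this.1 | exact this.2
    · rw [nn_of_not_par hp] at hc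
      have hp' : par L (J + 1) M := by rw [par_J_add]; exact hp
      have := gW_N2 h0 h1 (L := L) (M := M) (n := -(J + 1)) (by omega) (by omega)
      rw [show -(-(J + 1) - 1) = J + 1 + 1 by ring] at this
      simp only [if_neg hp, if_pos hp', nn_of_not_par hp, nn_of_par hp', C0_of_not_par h0 hp]
      first | exact this.1 | exact this.2

theorem nn_of_par_iff_not {L J M L' M' : ℤ} (h : par L' J M' ↔ ¬par L J M) :
    nn L' J M' = -nn L J M := by
  unfold nn
  by_cases hp : par L J M <;> simp [hp, h]

theorem nn_of_par_iff {L J M L' M' : ℤ} (h : par L' J M' ↔ par L J M) :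
    nn L' J M' = nn L J M := by
  unfold nn
  by_cases hp : par L J M <;> simp [hp, h]

theorem vEdge_Hp (h0 : 0 < q) (h1 : q < 1) : VEdge q 1 0 0 (atn q hP) (atn q hM) fun L J M => Hp q L J M := by
  constructor <;> intro L M J hJ
  · intro h h'
    have := nn_cases L J M
    simp only [VAdm] at *
    omega
  · intro h h'
    have := nn_cases L J M
    simp only [VAdm, atn] at *
    rw [hM_zpow h0.ne', mul_qi_eq_zero (by omega)]; simp
  all_goals
    intro hJ' h h'
    have hn := nn_of_par_iff_not (par_L_add (L := L) (J := J) (M := M))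
    have hc := nn_cases L J M
    simp only [VAdm, atn, nV, add_zero] at *
    rw [hn, Hp_eq h0]
    have := Hp_N2 h0 h1 (L := L) (M := M) (n := nn L J M) (by omega) (by omega)
    first | exact this.1 | exact this.2

theorem vEdge_H0 (h0 : 0 < q) : VEdge q 0 0 0 (atn q hZ) (atn q hZ) fun L J M => H0 q L J M := by
  constructor <;> intro L M J hJ <;> simp only [VAdm, atn, add_zero, sub_zero, H0_eq_hZ h0]
  · intro h h'; omega
  · intro h h'; omega
  · intros; trivial
  · intros; trivial

theorem vEdge_Dp (h0 : 0 < q) (h1 : q < 1) : VEdge q 1 1 0 (atn q dP) (atn q tM) fun L J M => Dp q L J M := by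
  constructor <;> intro L M J hJ
  · intro h h'
    simp only [VAdm] at *
    omega
  · intro h h'
    have := nn_cases L J M
    simp only [VAdm, atn] at *
    rw [tM_zpow h0.ne', mul_qi_eq_zero (by omega)]; simp
  all_goals
    intro hJ' h h'
    have hn := nn_of_par_iff (L := L) (J := J) (M := M) (L' := L + 1) (M' := M + 1)
      (by rw [par_L_add, par_M_add, not_not])
    have hc := nn_cases L J M
    simp only [VAdm, atn, nV, add_zero] at *
    rw [hn, Dp_eq h0]
    have := Dp_N2 h0 h1 (L := L) (M := M) (n := nn L J M) (by omega) (by omega)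
    first | exact this.1 | exact this.2

theorem vEdge_Dm (h0 : 0 < q) (h1 : q < 1) : VEdge q (-1) 1 0 (atn q dM) (atn q tP) fun L J M => Dm q L J M := by
  constructor <;> intro L M J hJ
  · intro h h'
    have := nn_cases L J M
    simp only [VAdm, atn] at *
    rw [dM_zpow h0.ne', mul_qi_eq_zero (by omega)]; simp
  · intro h h'
    simp only [VAdm] at *
    omega
  all_goals
    intro hJ' h h'
    simp only [← sub_eq_add_neg] at h' ⊢
    have hn := nn_of_par_iff (L := L) (J := J) (M := M) (L' := L - 1) (M' := M + 1)
      (by rw [par_L_sub, par_M_add, not_not])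
    have hc := nn_cases L J M
    simp only [VAdm, atn, nV, add_zero] at *
    rw [hn, Dm_eq h0]
    have := Dm_N2 h0 h1 (L := L) (M := M) (n := nn L J M) (by omega) (by omega)
    first | exact this.1 | exact this.2

theorem vEdge_D0 (h0 : 0 < q) (h1 : q < 1) : VEdge q 0 1 0 (atn q dZ) (atn q tZ) fun L J M => D0 q L J M := by
  constructor <;> intro L M J hJ
  · intro h h'
    have := nn_cases L J M
    simp only [VAdm, atn] at *
    rw [dZ_zpow h0.ne', show L - M - nn L J M + 1 = 0 by omega, qi_zero]; simp
  · intro h h'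
    have := nn_cases L J M
    simp only [VAdm, atn] at *
    rw [tZ_zpow h0.ne', show L + M + nn L J M + 2 = 0 by omega, qi_zero]; simp
  all_goals
    intro hJ' h h'
    have hn := nn_of_par_iff_not (par_M_add (L := L) (J := J) (M := M))
    have hc := nn_cases L J M
    simp only [VAdm, atn, nV, add_zero] at *
    rw [hn, D0_eq h0]
    have := D0_N2 h0 h1 (L := L) (M := M) (n := nn L J M) (by omega) (by omega)
    first | exact this.1 | exact this.2

end VEdges
end QuantumSphere
end

/-! ### From the free module to the Hilbert space -/

noncomputable section
namespace QuantumSphere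

section Ket

theorem ket_of_adm {L M₁ M₂ J : ℤ} (h : Admissible L M₁ M₂ J) :
    ket L M₁ M₂ J = lp.single 2 (⟨(L, M₁, M₂, J), h⟩ : Label) (1 : ℂ) := dif_pos h

theorem ket_of_not_adm {L M₁ M₂ J : ℤ} (h : ¬Admissible L M₁ M₂ J) : ket L M₁ M₂ J = 0 :=
  dif_neg h

theorem inner_ket (L M₁ M₂ J : ℤ) (h : Admissible L M₁ M₂ J) (f : Spinors) :
    ⟪ket L M₁ M₂ J, f⟫_ℂ = f ⟨(L, M₁, M₂, J), h⟩ := by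
  rw [ket_of_adm h, lp.inner_single_left]
  simp

theorem inner_ket_self {L M₁ M₂ J : ℤ} (h : Admissible L M₁ M₂ J) :
    ⟪ket L M₁ M₂ J, ket L M₁ M₂ J⟫_ℂ = 1 := by
  rw [inner_ket _ _ _ _ h, ket_of_adm h]
  simp

theorem inner_ket_of_ne {L M₁ M₂ J L' M₁' M₂' J' : ℤ} (h : (L, M₁, M₂, J) ≠ (L', M₁', M₂', J')) :
    ⟪ket L M₁ M₂ J, ket L' M₁' M₂' J'⟫_ℂ = 0 := by
  by_cases h1 : Admissible L M₁ M₂ J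
  · by_cases h2 : Admissible L' M₁' M₂' J'
    · rw [inner_ket _ _ _ _ h1, ket_of_adm h2, lp.single_apply_ne]
      exact fun h3 => h (congrArg Subtype.val h3)
    · rw [ket_of_not_adm h2, inner_zero_right]
  · rw [ket_of_not_adm h1, inner_zero_left]

end Ket

theorem termKet_eq (r : ℝ) (L M₁ M₂ J : ℤ) : termKet r L M₁ M₂ J = r • ket L M₁ M₂ J :=
  Complex.coe_smul r _

theorem smul_termKet (w r : ℝ) (L M₁ M₂ J : ℤ) :
    w • termKet r L M₁ M₂ J = termKet (w * r) L M₁ M₂ J := by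
  rw [termKet_eq, termKet_eq, mul_smul]

theorem termKet_of_not_adm (r : ℝ) {L M₁ M₂ J : ℤ} (h : ¬Admissible L M₁ M₂ J) :
    termKet r L M₁ M₂ J = 0 := by
  rw [termKet, ket_of_not_adm h, smul_zero]

theorem termKet_congr {r t : ℝ} (h : r = t) (L M₁ M₂ J : ℤ) :
    termKet r L M₁ M₂ J = termKet t L M₁ M₂ J := by rw [h]

section Phi

variable (q s : ℝ)

/-- The signed norm of the unnormalised basis vector. -/
def wt (L M₁ M₂ J : ℤ) : ℝ := s ^ L * (nM q M₁ J * nV q L M₂ J)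

/-- The map from the free module on all labels to the Hilbert space. -/
def Phi : Lat →ₗ[ℂ] Spinors :=
  Finsupp.linearCombination ℂ fun v : ℤ × ℤ × ℤ × ℤ =>
    termKet (wt q s v.1 v.2.1 v.2.2.1 v.2.2.2) v.1 v.2.1 v.2.2.1 v.2.2.2

theorem Phi_k (L M₁ M₂ J : ℤ) :
    Phi q s (k L M₁ M₂ J) = termKet (wt q s L M₁ M₂ J) L M₁ M₂ J := by
  simp [Phi, k]

theorem Phi_smul_k (r : ℝ) (L M₁ M₂ J : ℤ) :
    Phi q s (r • k L M₁ M₂ J) = termKet (r * wt q s L M₁ M₂ J) L M₁ M₂ J := by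
  rw [LinearMap.map_smul_of_tower, Phi_k, smul_termKet]

/-- The span of the admissible basis vectors. -/
def adm : Submodule ℂ Lat :=
  Finsupp.supported ℂ ℂ {v : ℤ × ℤ × ℤ × ℤ | Admissible v.1 v.2.1 v.2.2.1 v.2.2.2}

theorem k_mem_adm {L M₁ M₂ J : ℤ} (h : Admissible L M₁ M₂ J) : k L M₁ M₂ J ∈ adm :=
  Finsupp.single_mem_supported ℂ 1 h

theorem adm_induction {p : Lat → Prop} (hk : ∀ L M₁ M₂ J, Admissible L M₁ M₂ J → p (k L M₁ M₂ J))
    (h0 : p 0) (hadd : ∀ f g, p f → p g → p (f + g)) (hsmul : ∀ (c : ℂ) f, p f → p (c • f))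
    {f : Lat} (hf : f ∈ adm) : p f := by
  rw [adm, Finsupp.supported_eq_span_single] at hf
  refine Submodule.span_induction ?_ h0 (fun f g _ _ => hadd f g) (fun c f _ => hsmul c f) hf
  rintro _ ⟨⟨L, M₁, M₂, J⟩, h, rfl⟩
  exact hk L M₁ M₂ J h

end Phi

section Edge

variable {q s : ℝ} {a e c d : ℤ} {α α' A : ℤ → ℤ → ℝ} {β β' b : ℤ → ℤ → ℤ → ℝ}

/-- If the target is inadmissible, then its `(m₁, j)` part or its `(l, m₂, j)` part is, and the
corresponding factor vanishes. Thus operators defined on all labels restrict to the admissible ones.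
-/
theorem edge_out (hM : MEdge q e d α α' A) (hV : VEdge q a c d β β' b) {L M₁ M₂ J : ℤ}
    (h : Admissible L M₁ M₂ J) (h' : ¬Admissible (L + a) (M₁ + e) (M₂ + c) (J + d)) :
    α J M₁ * β L J M₂ = 0 := by
  have hJ := h.1
  rw [admissible_iff] at h h'
  by_cases h2 : MAdm (M₁ + e) (J + d)
  · rw [hV.out L M₂ J hJ h.2 fun h3 => h' ⟨h2, h3⟩, mul_zero]
  · rw [hM.out M₁ J h.1 h2, zero_mul]

theorem edge_mem (hM : MEdge q e d α α' A) (hV : VEdge q a c d β β' b) {L M₁ M₂ J : ℤ}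
    (h : Admissible L M₁ M₂ J) :
    α J M₁ • β L J M₂ • k (L + a) (M₁ + e) (M₂ + c) (J + d) ∈ adm := by
  rw [smul_smul]
  by_cases h' : Admissible (L + a) (M₁ + e) (M₂ + c) (J + d)
  · exact Submodule.smul_of_tower_mem adm _ (k_mem_adm h')
  · rw [edge_out hM hV h h', zero_smul]; exact zero_mem _

/-- A transition `l ↦ l + a` picks up `s ^ a` from the weight `s ^ L`; this is the source of the
signs that distinguish the two representations. -/
theorem edge_fwd (hs : s * s = 1) (hM : MEdge q e d α α' A) (hV : VEdge q a c d β β' b)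
    {L M₁ M₂ J : ℤ} (h : Admissible L M₁ M₂ J) :
    Phi q s (α J M₁ • β L J M₂ • k (L + a) (M₁ + e) (M₂ + c) (J + d)) =
      wt q s L M₁ M₂ J • termKet (s ^ a * (A J M₁ * b L J M₂)) (L + a) (M₁ + e) (M₂ + c) (J + d) := by
  rw [smul_smul, Phi_smul_k, smul_termKet]
  by_cases h' : Admissible (L + a) (M₁ + e) (M₂ + c) (J + d)
  · apply termKet_congr
    have hs0 : s ≠ 0 := fun h => by simp [h] at hs
    have hJ := h.1
    have hJ' := h'.1
    rw [admissible_iff] at h h'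
    have e1 := hM.fwd M₁ J h.1 h'.1
    have e2 := hV.fwd L M₂ J hJ hJ' h.2 h'.2
    rw [wt, wt, zpow_add₀ hs0]
    linear_combination (-s ^ L * s ^ a * (α J M₁ * nM q (M₁ + e) (J + d))) * e2 -
      s ^ L * s ^ a * (b L J M₂ * nV q L M₂ J) * e1
  · rw [termKet_of_not_adm _ h', termKet_of_not_adm _ h']

theorem wt_sq (hs : s * s = 1) (L M₁ M₂ J : ℤ) :
    wt q s L M₁ M₂ J * wt q s L M₁ M₂ J = (nM q M₁ J * nV q L M₂ J) ^ 2 := by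
  have : s ^ L * s ^ L = 1 := by rw [← mul_zpow, hs, one_zpow]
  rw [wt]
  linear_combination (nM q M₁ J * nV q L M₂ J) ^ 2 * this

theorem inner_termKet (r t : ℝ) (L M₁ M₂ J L' M₁' M₂' J' : ℤ) :
    ⟪termKet r L M₁ M₂ J, termKet t L' M₁' M₂' J'⟫_ℂ =
      ((r * t : ℝ) : ℂ) * ⟪ket L M₁ M₂ J, ket L' M₁' M₂' J'⟫_ℂ := by
  rw [termKet, termKet, inner_smul_left, inner_smul_right, Complex.conj_ofReal]
  push_cast; ring

theorem edge_adj (hs : s * s = 1) (hM : MEdge q e d α α' A) (hV : VEdge q a c d β β' b)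
    {L M₁ M₂ J L' M₁' M₂' J' : ℤ} (h : Admissible L M₁ M₂ J) (h' : Admissible L' M₁' M₂' J') :
    ⟪Phi q s (α J M₁ • β L J M₂ • k (L + a) (M₁ + e) (M₂ + c) (J + d)),
        Phi q s (k L' M₁' M₂' J')⟫_ℂ =
      ⟪Phi q s (k L M₁ M₂ J),
        Phi q s (α' J' M₁' • β' L' J' M₂' • k (L' - a) (M₁' - e) (M₂' - c) (J' - d))⟫_ℂ := by
  simp only [smul_smul, Phi_smul_k, Phi_k, inner_termKet]
  by_cases hE : (L + a, M₁ + e, M₂ + c, J + d) = (L', M₁', M₂', J')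
  · obtain ⟨rfl, rfl, rfl, rfl⟩ : L + a = L' ∧ M₁ + e = M₁' ∧ M₂ + c = M₂' ∧ J + d = J' := by
      simpa using hE
    simp only [add_sub_cancel_right]
    rw [inner_ket_self h, inner_ket_self h']
    congr 2
    have hJ := h.1
    have hJ' := h'.1
    rw [admissible_iff] at h h'
    rw [mul_assoc, wt_sq hs, mul_left_comm, wt_sq hs]
    have e1 := hM.fwd M₁ J h.1 h'.1
    have e2 := hV.fwd L M₂ J hJ hJ' h.2 h'.2
    have e3 := hM.bwd M₁ J h.1 h'.1
    have e4 := hV.bwd L M₂ J hJ hJ' h.2 h'.2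
    generalize nM q M₁ J = n1 at *
    generalize nM q (M₁ + e) (J + d) = n2 at *
    generalize nV q L M₂ J = n3 at *
    generalize nV q (L + a) (M₂ + c) (J + d) = n4 at *
    -- With `n₁n₃` and `n₂n₄` the norms at the two ends, both sides equal `A b` times the product of
    -- the two norms; the forward equations give one expression, the backward equations the other.
    calc α J M₁ * β L J M₂ * (n2 * n4) ^ 2 = (α J M₁ * n2) * (β L J M₂ * n4) * n2 * n4 := by ring
      _ = (A J M₁ * n2) * (b L J M₂ * n4) * n1 * n3 := by rw [← e1, ← e2]; ring
      _ = α' (J + d) (M₁ + e) * β' (L + a) (J + d) (M₂ + c) * (n1 * n3) ^ 2 := by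
        rw [e3, e4]; ring
  · rw [inner_ket_of_ne hE, inner_ket_of_ne]
    · simp
    · intro h
      apply hE
      simp only [Prod.mk.injEq] at h ⊢
      omega

end Edge

section Expand

variable (q : ℝ)

theorem X0_k (L M₁ M₂ J : ℤ) : X0 q (k L M₁ M₂ J) =
    atj q aP J M₁ • vpP q L J M₂ • k (L + 1) M₁ M₂ (J + 1) +
    atj q aP J M₁ • vpZ q L J M₂ • k L M₁ M₂ (J + 1) +
    atj q aP J M₁ • vpM q L J M₂ • k (L - 1) M₁ M₂ (J + 1) +
    atj q aZ J M₁ • atn q hP L J M₂ • k (L + 1) M₁ M₂ J +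
    atj q aZ J M₁ • atn q hZ L J M₂ • k L M₁ M₂ J +
    atj q aZ J M₁ • atn q hM L J M₂ • k (L - 1) M₁ M₂ J +
    atj q aM J M₁ • vmP q L J M₂ • k (L + 1) M₁ M₂ (J - 1) +
    atj q aM J M₁ • vmZ q L J M₂ • k L M₁ M₂ (J - 1) +
    atj q aM J M₁ • vmM q L J M₂ • k (L - 1) M₁ M₂ (J - 1) := by
  simp only [X0, LinearMap.add_apply, hop_k, Vp_k, Vz_k, Vm_k, add_zero, smul_add, atj, add_assoc]

theorem X1_k (L M₁ M₂ J : ℤ) : X1 q (k L M₁ M₂ J) =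
    atj q bP J M₁ • vpP q L J M₂ • k (L + 1) (M₁ + 1) M₂ (J + 1) +
    atj q bP J M₁ • vpZ q L J M₂ • k L (M₁ + 1) M₂ (J + 1) +
    atj q bP J M₁ • vpM q L J M₂ • k (L - 1) (M₁ + 1) M₂ (J + 1) +
    atj q bZ J M₁ • atn q hP L J M₂ • k (L + 1) (M₁ + 1) M₂ J +
    atj q bZ J M₁ • atn q hZ L J M₂ • k L (M₁ + 1) M₂ J +
    atj q bZ J M₁ • atn q hM L J M₂ • k (L - 1) (M₁ + 1) M₂ J +
    atj q bM J M₁ • vmP q L J M₂ • k (L + 1) (M₁ + 1) M₂ (J - 1) +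
    atj q bM J M₁ • vmZ q L J M₂ • k L (M₁ + 1) M₂ (J - 1) +
    atj q bM J M₁ • vmM q L J M₂ • k (L - 1) (M₁ + 1) M₂ (J - 1) := by
  simp only [X1, LinearMap.add_apply, hop_k, Vp_k, Vz_k, Vm_k, smul_add, atj, add_assoc]

theorem X1s_k (L M₁ M₂ J : ℤ) : X1s q (k L M₁ M₂ J) =
    atj q cP J M₁ • vpP q L J M₂ • k (L + 1) (M₁ - 1) M₂ (J + 1) +
    atj q cP J M₁ • vpZ q L J M₂ • k L (M₁ - 1) M₂ (J + 1) +
    atj q cP J M₁ • vpM q L J M₂ • k (L - 1) (M₁ - 1) M₂ (J + 1) +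
    atj q cZ J M₁ • atn q hP L J M₂ • k (L + 1) (M₁ - 1) M₂ J +
    atj q cZ J M₁ • atn q hZ L J M₂ • k L (M₁ - 1) M₂ J +
    atj q cZ J M₁ • atn q hM L J M₂ • k (L - 1) (M₁ - 1) M₂ J +
    atj q cM J M₁ • vmP q L J M₂ • k (L + 1) (M₁ - 1) M₂ (J - 1) +
    atj q cM J M₁ • vmZ q L J M₂ • k L (M₁ - 1) M₂ (J - 1) +
    atj q cM J M₁ • vmM q L J M₂ • k (L - 1) (M₁ - 1) M₂ (J - 1) := by
  simp only [X1s, LinearMap.add_apply, hop_k, Vp_k, Vz_k, Vm_k, smul_add, atj, ← sub_eq_add_neg]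
  simp only [add_assoc]

end Expand

/-- `x₂` leaves `(m₁, j)` untouched, so its transitions are paired with this trivial one. -/
theorem mEdge_one (q : ℝ) : MEdge q 0 0 (fun _ _ => 1) (fun _ _ => 1) fun _ _ => 1 := by
  constructor <;> intro M J h h' <;> simp_all

section Structure

variable {q s : ℝ} {L M₁ M₂ J : ℤ}

/-- The nine terms of `x₀` are five transitions and four reversed ones: lowering `j` reverses
raising it, and the term `l - 1` at fixed `j` reverses `l + 1`. -/
theorem X0_mem (h0 : 0 < q) (h1 : q < 1) (h : Admissible L M₁ M₂ J) : X0 q (k L M₁ M₂ J) ∈ adm := by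
  have t1 := edge_mem (mEdge_Ap h0 h1) (vEdge_Cp h0 h1) h
  have t2 := edge_mem (mEdge_Ap h0 h1) (vEdge_C0 h0 h1) h
  have t3 := edge_mem (mEdge_Ap h0 h1) (vEdge_Cm h0 h1) h
  have t4 := edge_mem (mEdge_A0 h0 h1) (vEdge_Hp h0 h1) h
  have t5 := edge_mem (mEdge_A0 h0 h1) (vEdge_H0 h0) h
  have t6 := edge_mem (mEdge_A0 h0 h1) (vEdge_Hp h0 h1).symm h
  have t7 := edge_mem (mEdge_Ap h0 h1).symm (vEdge_Cm h0 h1).symm h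
  have t8 := edge_mem (mEdge_Ap h0 h1).symm (vEdge_C0 h0 h1).symm h
  have t9 := edge_mem (mEdge_Ap h0 h1).symm (vEdge_Cp h0 h1).symm h
  simp only [add_zero, neg_zero, neg_neg, ← sub_eq_add_neg] at *
  rw [X0_k]
  repeat' apply add_mem
  all_goals assumption

theorem X1_mem (h0 : 0 < q) (h1 : q < 1) (h : Admissible L M₁ M₂ J) : X1 q (k L M₁ M₂ J) ∈ adm := by
  have t1 := edge_mem (mEdge_Bp h0 h1) (vEdge_Cp h0 h1) h
  have t2 := edge_mem (mEdge_Bp h0 h1) (vEdge_C0 h0 h1) h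
  have t3 := edge_mem (mEdge_Bp h0 h1) (vEdge_Cm h0 h1) h
  have t4 := edge_mem (mEdge_B0 h0 h1) (vEdge_Hp h0 h1) h
  have t5 := edge_mem (mEdge_B0 h0 h1) (vEdge_H0 h0) h
  have t6 := edge_mem (mEdge_B0 h0 h1) (vEdge_Hp h0 h1).symm h
  have t7 := edge_mem (mEdge_Bm h0 h1) (vEdge_Cm h0 h1).symm h
  have t8 := edge_mem (mEdge_Bm h0 h1) (vEdge_C0 h0 h1).symm h
  have t9 := edge_mem (mEdge_Bm h0 h1) (vEdge_Cp h0 h1).symm h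
  simp only [add_zero, neg_zero, neg_neg, ← sub_eq_add_neg] at *
  rw [X1_k]
  repeat' apply add_mem
  all_goals assumption

theorem X1s_mem (h0 : 0 < q) (h1 : q < 1) (h : Admissible L M₁ M₂ J) :
    X1s q (k L M₁ M₂ J) ∈ adm := by
  have t1 := edge_mem (mEdge_Bm h0 h1).symm (vEdge_Cp h0 h1) h
  have t2 := edge_mem (mEdge_Bm h0 h1).symm (vEdge_C0 h0 h1) h
  have t3 := edge_mem (mEdge_Bm h0 h1).symm (vEdge_Cm h0 h1) h
  have t4 := edge_mem (mEdge_B0 h0 h1).symm (vEdge_Hp h0 h1) h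
  have t5 := edge_mem (mEdge_B0 h0 h1).symm (vEdge_H0 h0) h
  have t6 := edge_mem (mEdge_B0 h0 h1).symm (vEdge_Hp h0 h1).symm h
  have t7 := edge_mem (mEdge_Bp h0 h1).symm (vEdge_Cm h0 h1).symm h
  have t8 := edge_mem (mEdge_Bp h0 h1).symm (vEdge_C0 h0 h1).symm h
  have t9 := edge_mem (mEdge_Bp h0 h1).symm (vEdge_Cp h0 h1).symm h
  simp only [add_zero, neg_zero, neg_neg, ← sub_eq_add_neg] at *
  rw [X1s_k]
  repeat' apply add_mem
  all_goals assumption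

theorem Dop_mem (h0 : 0 < q) (h1 : q < 1) (h : Admissible L M₁ M₂ J) :
    Dop q (k L M₁ M₂ J) ∈ adm := by
  have t1 := edge_mem (mEdge_one q) (vEdge_Dp h0 h1) h
  have t2 := edge_mem (mEdge_one q) (vEdge_D0 h0 h1) h
  have t3 := edge_mem (mEdge_one q) (vEdge_Dm h0 h1) h
  simp only [add_zero, one_smul, ← sub_eq_add_neg] at *
  rw [Dop_k]
  repeat' apply add_mem
  all_goals assumption

theorem Dst_mem (h0 : 0 < q) (h1 : q < 1) (h : Admissible L M₁ M₂ J) :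
    Dst q (k L M₁ M₂ J) ∈ adm := by
  have t1 := edge_mem (mEdge_one q) (vEdge_Dp h0 h1).symm h
  have t2 := edge_mem (mEdge_one q) (vEdge_D0 h0 h1).symm h
  have t3 := edge_mem (mEdge_one q) (vEdge_Dm h0 h1).symm h
  simp only [add_zero, neg_zero, neg_neg, one_smul, ← sub_eq_add_neg] at *
  rw [Dst_k]
  repeat' apply add_mem
  all_goals assumption

variable {L' M₁' M₂' J' : ℤ}

theorem inner_X0 (h0 : 0 < q) (h1 : q < 1) (hs : s * s = 1) (h : Admissible L M₁ M₂ J)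
    (h' : Admissible L' M₁' M₂' J') :
    ⟪Phi q s (X0 q (k L M₁ M₂ J)), Phi q s (k L' M₁' M₂' J')⟫_ℂ =
      ⟪Phi q s (k L M₁ M₂ J), Phi q s (X0 q (k L' M₁' M₂' J'))⟫_ℂ := by
  have t1 := edge_adj hs (mEdge_Ap h0 h1) (vEdge_Cp h0 h1) h h'
  have t2 := edge_adj hs (mEdge_Ap h0 h1) (vEdge_C0 h0 h1) h h'
  have t3 := edge_adj hs (mEdge_Ap h0 h1) (vEdge_Cm h0 h1) h h'
  have t4 := edge_adj hs (mEdge_A0 h0 h1) (vEdge_Hp h0 h1) h h'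
  have t5 := edge_adj hs (mEdge_A0 h0 h1) (vEdge_H0 h0) h h'
  have t6 := edge_adj hs (mEdge_A0 h0 h1) (vEdge_Hp h0 h1).symm h h'
  have t7 := edge_adj hs (mEdge_Ap h0 h1).symm (vEdge_Cm h0 h1).symm h h'
  have t8 := edge_adj hs (mEdge_Ap h0 h1).symm (vEdge_C0 h0 h1).symm h h'
  have t9 := edge_adj hs (mEdge_Ap h0 h1).symm (vEdge_Cp h0 h1).symm h h'
  simp only [add_zero, sub_zero, neg_zero, neg_neg, ← sub_eq_add_neg, sub_neg_eq_add] at *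
  rw [X0_k, X0_k]
  simp only [map_add, inner_add_left, inner_add_right]
  rw [t1, t2, t3, t4, t5, t6, t7, t8, t9]
  abel

theorem inner_X1 (h0 : 0 < q) (h1 : q < 1) (hs : s * s = 1) (h : Admissible L M₁ M₂ J)
    (h' : Admissible L' M₁' M₂' J') :
    ⟪Phi q s (X1 q (k L M₁ M₂ J)), Phi q s (k L' M₁' M₂' J')⟫_ℂ =
      ⟪Phi q s (k L M₁ M₂ J), Phi q s (X1s q (k L' M₁' M₂' J'))⟫_ℂ := by
  have t1 := edge_adj hs (mEdge_Bp h0 h1) (vEdge_Cp h0 h1) h h'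
  have t2 := edge_adj hs (mEdge_Bp h0 h1) (vEdge_C0 h0 h1) h h'
  have t3 := edge_adj hs (mEdge_Bp h0 h1) (vEdge_Cm h0 h1) h h'
  have t4 := edge_adj hs (mEdge_B0 h0 h1) (vEdge_Hp h0 h1) h h'
  have t5 := edge_adj hs (mEdge_B0 h0 h1) (vEdge_H0 h0) h h'
  have t6 := edge_adj hs (mEdge_B0 h0 h1) (vEdge_Hp h0 h1).symm h h'
  have t7 := edge_adj hs (mEdge_Bm h0 h1) (vEdge_Cm h0 h1).symm h h'
  have t8 := edge_adj hs (mEdge_Bm h0 h1) (vEdge_C0 h0 h1).symm h h'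
  have t9 := edge_adj hs (mEdge_Bm h0 h1) (vEdge_Cp h0 h1).symm h h'
  simp only [add_zero, sub_zero, neg_zero, neg_neg, ← sub_eq_add_neg, sub_neg_eq_add] at *
  rw [X1_k, X1s_k]
  simp only [map_add, inner_add_left, inner_add_right]
  rw [t1, t2, t3, t4, t5, t6, t7, t8, t9]
  abel

theorem inner_Dop (h0 : 0 < q) (h1 : q < 1) (hs : s * s = 1) (h : Admissible L M₁ M₂ J)
    (h' : Admissible L' M₁' M₂' J') :
    ⟪Phi q s (Dop q (k L M₁ M₂ J)), Phi q s (k L' M₁' M₂' J')⟫_ℂ =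
      ⟪Phi q s (k L M₁ M₂ J), Phi q s (Dst q (k L' M₁' M₂' J'))⟫_ℂ := by
  have t1 := edge_adj hs (mEdge_one q) (vEdge_Dp h0 h1) h h'
  have t2 := edge_adj hs (mEdge_one q) (vEdge_D0 h0 h1) h h'
  have t3 := edge_adj hs (mEdge_one q) (vEdge_Dm h0 h1) h h'
  simp only [add_zero, sub_zero, one_smul, ← sub_eq_add_neg, sub_neg_eq_add] at *
  rw [Dop_k, Dst_k]
  simp only [map_add, inner_add_left, inner_add_right]
  rw [t1, t2, t3]
  abel

theorem smul_smul_termKet (w r : ℝ) (L M₁ M₂ J : ℤ) :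
    s • w • termKet r L M₁ M₂ J = w • termKet (s * r) L M₁ M₂ J := by
  rw [smul_comm, smul_termKet s r]

/-- The prefactor `s` meets `s ^ (±1)` on the terms that change `l` and cancels there, since `s² =
1`; it survives on the terms with fixed `l`. This is the sign pattern of the chiral representations.
-/
theorem smul_Phi_X0 (h0 : 0 < q) (h1 : q < 1) (hs : s * s = 1) (h : Admissible L M₁ M₂ J) :
    s • Phi q s (X0 q (k L M₁ M₂ J)) = wt q s L M₁ M₂ J • (
      termKet (Ap q J M₁ * Cp q L J M₂) (L + 1) M₁ M₂ (J + 1)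
    + termKet (-s * (Ap q J M₁ * C0 q L J M₂)) L M₁ M₂ (J + 1)
    + termKet (Ap q J M₁ * Cm q L J M₂) (L - 1) M₁ M₂ (J + 1)
    + termKet (A0 q J M₁ * Hp q L J M₂) (L + 1) M₁ M₂ J
    + termKet (s * (A0 q J M₁ * H0 q L J M₂)) L M₁ M₂ J
    + termKet (A0 q J M₁ * Hp q (L - 1) J M₂) (L - 1) M₁ M₂ J
    + termKet (Ap q (J - 1) M₁ * Cm q (L + 1) (J - 1) M₂) (L + 1) M₁ M₂ (J - 1)
    + termKet (-s * (Ap q (J - 1) M₁ * C0 q L (J - 1) M₂)) L M₁ M₂ (J - 1)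
    + termKet (Ap q (J - 1) M₁ * Cp q (L - 1) (J - 1) M₂) (L - 1) M₁ M₂ (J - 1)) := by
  have t1 := edge_fwd hs (mEdge_Ap h0 h1) (vEdge_Cp h0 h1) h
  have t2 := edge_fwd hs (mEdge_Ap h0 h1) (vEdge_C0 h0 h1) h
  have t3 := edge_fwd hs (mEdge_Ap h0 h1) (vEdge_Cm h0 h1) h
  have t4 := edge_fwd hs (mEdge_A0 h0 h1) (vEdge_Hp h0 h1) h
  have t5 := edge_fwd hs (mEdge_A0 h0 h1) (vEdge_H0 h0) h
  have t6 := edge_fwd hs (mEdge_A0 h0 h1) (vEdge_Hp h0 h1).symm h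
  have t7 := edge_fwd hs (mEdge_Ap h0 h1).symm (vEdge_Cm h0 h1).symm h
  have t8 := edge_fwd hs (mEdge_Ap h0 h1).symm (vEdge_C0 h0 h1).symm h
  have t9 := edge_fwd hs (mEdge_Ap h0 h1).symm (vEdge_Cp h0 h1).symm h
  have hs0 : s ≠ 0 := fun h => by simp [h] at hs
  have hs2 : s ^ 2 = 1 := by rw [sq, hs]
  have hr : √q ≠ 0 := (Real.sqrt_pos.2 h0).ne'
  simp only [add_zero, sub_zero, neg_zero, neg_neg, ← sub_eq_add_neg, sub_neg_eq_add, zpow_one,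
    zpow_zero, zpow_neg, one_mul] at *
  rw [X0_k]
  simp only [map_add, smul_add]
  rw [t1, t2, t3, t4, t5, t6, t7, t8, t9]
  simp only [smul_smul_termKet]
  refine congrArg₂ _ (congrArg₂ _ (congrArg₂ _ (congrArg₂ _ (congrArg₂ _ (congrArg₂ _
    (congrArg₂ _ (congrArg₂ _ ?_ ?_) ?_) ?_) ?_) ?_) ?_) ?_) ?_ <;>
  · refine congrArg _ (termKet_congr ?_ _ _ _ _)
    field_simp
    try rw [hs2, one_mul]

theorem smul_Phi_X1 (h0 : 0 < q) (h1 : q < 1) (hs : s * s = 1) (h : Admissible L M₁ M₂ J) :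
    s • Phi q s (X1 q (k L M₁ M₂ J)) = wt q s L M₁ M₂ J • (
      termKet (Bp q J M₁ * Cp q L J M₂) (L + 1) (M₁ + 1) M₂ (J + 1)
    + termKet (-s * (Bp q J M₁ * C0 q L J M₂)) L (M₁ + 1) M₂ (J + 1)
    + termKet (Bp q J M₁ * Cm q L J M₂) (L - 1) (M₁ + 1) M₂ (J + 1)
    + termKet (B0 q J M₁ * Hp q L J M₂) (L + 1) (M₁ + 1) M₂ J
    + termKet (s * (B0 q J M₁ * H0 q L J M₂)) L (M₁ + 1) M₂ J
    + termKet (B0 q J M₁ * Hp q (L - 1) J M₂) (L - 1) (M₁ + 1) M₂ J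
    + termKet (Bm q J M₁ * Cm q (L + 1) (J - 1) M₂) (L + 1) (M₁ + 1) M₂ (J - 1)
    + termKet (-s * (Bm q J M₁ * C0 q L (J - 1) M₂)) L (M₁ + 1) M₂ (J - 1)
    + termKet (Bm q J M₁ * Cp q (L - 1) (J - 1) M₂) (L - 1) (M₁ + 1) M₂ (J - 1)) := by
  have t1 := edge_fwd hs (mEdge_Bp h0 h1) (vEdge_Cp h0 h1) h
  have t2 := edge_fwd hs (mEdge_Bp h0 h1) (vEdge_C0 h0 h1) h
  have t3 := edge_fwd hs (mEdge_Bp h0 h1) (vEdge_Cm h0 h1) h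
  have t4 := edge_fwd hs (mEdge_B0 h0 h1) (vEdge_Hp h0 h1) h
  have t5 := edge_fwd hs (mEdge_B0 h0 h1) (vEdge_H0 h0) h
  have t6 := edge_fwd hs (mEdge_B0 h0 h1) (vEdge_Hp h0 h1).symm h
  have t7 := edge_fwd hs (mEdge_Bm h0 h1) (vEdge_Cm h0 h1).symm h
  have t8 := edge_fwd hs (mEdge_Bm h0 h1) (vEdge_C0 h0 h1).symm h
  have t9 := edge_fwd hs (mEdge_Bm h0 h1) (vEdge_Cp h0 h1).symm h
  have hs0 : s ≠ 0 := fun h => by simp [h] at hs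
  have hs2 : s ^ 2 = 1 := by rw [sq, hs]
  have hr : √q ≠ 0 := (Real.sqrt_pos.2 h0).ne'
  simp only [add_zero, sub_zero, neg_zero, neg_neg, ← sub_eq_add_neg, sub_neg_eq_add, zpow_one,
    zpow_zero, zpow_neg, one_mul] at *
  rw [X1_k]
  simp only [map_add, smul_add]
  rw [t1, t2, t3, t4, t5, t6, t7, t8, t9]
  simp only [smul_smul_termKet]
  refine congrArg₂ _ (congrArg₂ _ (congrArg₂ _ (congrArg₂ _ (congrArg₂ _ (congrArg₂ _
    (congrArg₂ _ (congrArg₂ _ ?_ ?_) ?_) ?_) ?_) ?_) ?_) ?_) ?_ <;>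
  · refine congrArg _ (termKet_congr ?_ _ _ _ _)
    field_simp
    try rw [hs2, one_mul]

theorem smul_Phi_Dop (h0 : 0 < q) (h1 : q < 1) (hs : s * s = 1) (h : Admissible L M₁ M₂ J) :
    s • Phi q s (Dop q (k L M₁ M₂ J)) = wt q s L M₁ M₂ J • (
      termKet (Dp q L J M₂) (L + 1) M₁ (M₂ + 1) J
    + termKet (s * D0 q L J M₂) L M₁ (M₂ + 1) J
    + termKet (Dm q L J M₂) (L - 1) M₁ (M₂ + 1) J) := by
  have t1 := edge_fwd hs (mEdge_one q) (vEdge_Dp h0 h1) h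
  have t2 := edge_fwd hs (mEdge_one q) (vEdge_D0 h0 h1) h
  have t3 := edge_fwd hs (mEdge_one q) (vEdge_Dm h0 h1) h
  have hs0 : s ≠ 0 := fun h => by simp [h] at hs
  have hs2 : s ^ 2 = 1 := by rw [sq, hs]
  simp only [add_zero, one_smul, ← sub_eq_add_neg, zpow_one, zpow_zero, zpow_neg, one_mul] at *
  rw [Dop_k]
  simp only [map_add, smul_add]
  rw [t1, t2, t3]
  simp only [smul_smul_termKet]
  refine congrArg₂ _ (congrArg₂ _ ?_ ?_) ?_ <;>
  · refine congrArg _ (termKet_congr ?_ _ _ _ _)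
    field_simp
    try rw [hs2, one_mul]

end Structure
end QuantumSphere
end

/-! ### Universal property of the algebra, density of the kets, extension to bounded operators -/

noncomputable section
namespace QuantumSphere

section Lift

variable {q : ℝ} {B : Type*} [Ring B] [StarRing B] [Algebra ℂ B] [StarModule ℂ B]

/-- The defining relations of `A(S⁴_q)` for elements of a `*`-algebra. -/
structure SphereRel (q : ℝ) (t₀ t₁ t₂ : B) : Prop where
  sa : star t₀ = t₀
  c01 : t₀ * t₁ = (q : ℂ) ^ 2 • (t₁ * t₀)
  c02 : t₀ * t₂ = (q : ℂ) ^ 2 • (t₂ * t₀)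
  c12 : t₁ * t₂ = (q : ℂ) ^ 2 • (t₂ * t₁)
  s12 : star t₁ * t₂ = (q : ℂ) ^ 2 • (t₂ * star t₁)
  u1 : star t₁ * t₁ - t₁ * star t₁ = (1 - (q : ℂ) ^ 4) • (t₀ * t₀)
  u2 : star t₂ * t₂ - t₂ * star t₂ = star t₁ * t₁ - (q : ℂ) ^ 4 • (t₁ * star t₁)
  radius : t₀ * t₀ + t₁ * star t₁ + t₂ * star t₂ = 1

/-- The images of the generators. -/
def genMap (t₀ t₁ t₂ : B) : Gen → B
  | .x0 => t₀
  | .x1 => t₁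
  | .x1s => star t₁
  | .x2 => t₂
  | .x2s => star t₂

def freeRep (t₀ t₁ t₂ : B) : FreeAlgebra ℂ Gen →ₐ[ℂ] B := FreeAlgebra.lift ℂ (genMap t₀ t₁ t₂)

theorem freeRep_fx (t₀ t₁ t₂ : B) (i : Fin 3) : freeRep t₀ t₁ t₂ (fx i) = ![t₀, t₁, t₂] i := by
  fin_cases i <;> simp [freeRep, fx, genMap]

theorem freeRep_fxs (t₀ t₁ t₂ : B) (i : Fin 3) :
    freeRep t₀ t₁ t₂ (fxs i) = ![t₀, star t₁, star t₂] i := by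
  fin_cases i <;> simp [freeRep, fxs, genMap]

theorem star_rel {a b c d : B} (h : a * b = (q : ℂ) ^ 2 • (c * d)) :
    star b * star a = (q : ℂ) ^ 2 • (star d * star c) := by
  have := congrArg star h
  simpa [star_mul, star_smul] using this

theorem freeRep_rel {t₀ t₁ t₂ : B} (h : SphereRel q t₀ t₁ t₂) ⦃a b : FreeAlgebra ℂ Gen⦄
    (hab : Rel q a b) : freeRep t₀ t₁ t₂ a = freeRep t₀ t₁ t₂ b := by
  have s01 := star_rel h.c01
  have s02 := star_rel h.c02
  have s21 := star_rel h.s12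
  have s12 := star_rel h.c12
  rw [h.sa] at s01 s02
  rw [star_star] at s21
  cases hab with
  | comm i j hij =>
    simp only [map_mul, map_smul, freeRep_fx]
    fin_cases i <;> fin_cases j <;> first | exact absurd hij (by decide) | skip
    exacts [h.c01, h.c02, h.c12]
  | comm_adj i j hij =>
    simp only [map_mul, map_smul, freeRep_fxs]
    fin_cases i <;> fin_cases j <;> first | exact absurd hij (by decide) | skip
    exacts [s01, s02, s12]
  | cross i j hij =>
    simp only [map_mul, map_smul, freeRep_fxs, freeRep_fx]
    fin_cases i <;> fin_cases j <;> first | exact absurd rfl hij | skip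
    exacts [h.c01, h.c02, s01, h.s12, s02, s21]
  | u1 => simpa [freeRep_fx, freeRep_fxs] using h.u1
  | u2 => simpa [freeRep_fx, freeRep_fxs] using h.u2
  | radius => simpa [freeRep_fx, freeRep_fxs] using h.radius

/-- The homomorphism defined by elements that satisfy the relations. -/
def liftHom {t₀ t₁ t₂ : B} (h : SphereRel q t₀ t₁ t₂) : S4 q →ₐ[ℂ] B :=
  RingQuot.liftAlgHom ℂ ⟨freeRep t₀ t₁ t₂, freeRep_rel h⟩

theorem liftHom_mk {t₀ t₁ t₂ : B} (h : SphereRel q t₀ t₁ t₂) (a : FreeAlgebra ℂ Gen) :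
    liftHom h (mk q a) = freeRep t₀ t₁ t₂ a :=
  RingQuot.liftAlgHom_mkAlgHom_apply (S := ℂ) (f := freeRep t₀ t₁ t₂) (freeRep_rel h) a

theorem star_mk (a : FreeAlgebra ℂ Gen) : star (mk q a) = (preStar q a).unop :=
  congrArg MulOpposite.unop (starHom_mk q a)

theorem star_mk_ι (g : Gen) :
    star (mk q (FreeAlgebra.ι ℂ g)) = mk q (FreeAlgebra.ι ℂ g.adj) := by
  rw [star_mk, preStar_ι]; rfl

/-- An induction principle for `A(S⁴_q)`. -/
theorem S4.induction {p : S4 q → Prop} (hc : ∀ c, p (algebraMap ℂ _ c)) (hx : ∀ i, p (x q i))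
    (hstar : ∀ a, p a → p (star a)) (hadd : ∀ a b, p a → p b → p (a + b))
    (hmul : ∀ a b, p a → p b → p (a * b)) (a : S4 q) : p a := by
  obtain ⟨a, rfl⟩ := mk_surjective q a
  induction a using FreeAlgebra.induction with
  | grade0 c => rw [AlgHom.commutes]; exact hc c
  | grade1 g =>
    cases g with
    | x0 => exact hx 0
    | x1 => exact hx 1
    | x2 => exact hx 2
    | x1s => have := hstar _ (hx 1); rwa [star_x] at this
    | x2s => have := hstar _ (hx 2); rwa [star_x] at this
  | mul a b ha hb => rw [map_mul]; exact hmul _ _ ha hb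
  | add a b ha hb => rw [map_add]; exact hadd _ _ ha hb

theorem liftHom_star {t₀ t₁ t₂ : B} (h : SphereRel q t₀ t₁ t₂) (a : S4 q) :
    liftHom h (star a) = star (liftHom h a) := by
  obtain ⟨a, rfl⟩ := mk_surjective q a
  induction a using FreeAlgebra.induction with
  | grade0 c =>
    rw [AlgHom.commutes, ← algebraMap_star_comm, AlgHom.commutes, AlgHom.commutes,
      algebraMap_star_comm]
  | grade1 g =>
    rw [star_mk_ι, liftHom_mk, liftHom_mk]
    cases g <;> simp [freeRep, genMap, Gen.adj, h.sa]
  | mul a b ha hb => rw [map_mul, star_mul, map_mul, ha, hb, map_mul, star_mul]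
  | add a b ha hb => rw [map_add, star_add, map_add, ha, hb, map_add, star_add]

/-- The `*`-homomorphism defined by elements that satisfy the relations. -/
def liftRep {t₀ t₁ t₂ : B} (h : SphereRel q t₀ t₁ t₂) : S4 q →⋆ₐ[ℂ] B :=
  { liftHom h with map_star' := liftHom_star h }

theorem liftRep_x {t₀ t₁ t₂ : B} (h : SphereRel q t₀ t₁ t₂) (i : Fin 3) :
    liftRep h (x q i) = ![t₀, t₁, t₂] i :=
  (liftHom_mk h (fx i)).trans (freeRep_fx t₀ t₁ t₂ i)

theorem starAlgHom_ext {ρ σ : S4 q →⋆ₐ[ℂ] B} (h : ∀ i, ρ (x q i) = σ (x q i)) : ρ = σ := by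
  ext a
  induction a using S4.induction with
  | hc c => rw [AlgHomClass.commutes, AlgHomClass.commutes]
  | hx i => exact h i
  | hstar a ha => rw [map_star, map_star, ha]
  | hadd a b ha hb => rw [map_add, map_add, ha, hb]
  | hmul a b ha hb => rw [map_mul, map_mul, ha, hb]

end Lift

section Dense

/-- The orthonormal basis of admissible kets. -/
def ketBasis : HilbertBasis Label ℂ Spinors := HilbertBasis.ofRepr (LinearIsometryEquiv.refl ℂ _)

theorem ketBasis_apply (v : Label) : ketBasis v = ket v.1.1 v.1.2.1 v.1.2.2.1 v.1.2.2.2 := by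
  classical
  rw [ket_of_adm v.2, ← HilbertBasis.repr_symm_single]
  exact congrArg (lp.single 2 · (1 : ℂ)) rfl

theorem clm_ext_ket {E : Type*} [NormedAddCommGroup E] [NormedSpace ℂ E] {S T : Spinors →L[ℂ] E}
    (h : ∀ L M₁ M₂ J, Admissible L M₁ M₂ J → S (ket L M₁ M₂ J) = T (ket L M₁ M₂ J)) : S = T := by
  refine ContinuousLinearMap.ext_on (s := Set.range ketBasis) ?_ ?_
  · rw [dense_iff_closure_eq, ← Submodule.topologicalClosure_coe, ketBasis.dense_span]
    rfl
  · rintro _ ⟨v, rfl⟩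
    rw [ketBasis_apply]
    exact h _ _ _ _ v.2

variable (q s : ℝ)

/-- The restriction of `Phi` to the admissible part. -/
def emb : adm →ₗ[ℂ] Spinors := Phi q s ∘ₗ adm.subtype

theorem wt_ne_zero {q s : ℝ} (h0 : 0 < q) (h1 : q < 1) (hs : s * s = 1) (L M₁ M₂ J : ℤ) :
    wt q s L M₁ M₂ J ≠ 0 := by
  have hs0 : s ≠ 0 := fun h => by simp [h] at hs
  exact mul_ne_zero (zpow_ne_zero _ hs0) (mul_pos (nM_pos h0 h1 _ _) (nV_pos h0 h1 _ _ _)).ne'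

theorem ket_eq_emb {q s : ℝ} (h0 : 0 < q) (h1 : q < 1) (hs : s * s = 1) {L M₁ M₂ J : ℤ}
    (h : Admissible L M₁ M₂ J) :
    ket L M₁ M₂ J = (wt q s L M₁ M₂ J)⁻¹ • emb q s ⟨k L M₁ M₂ J, k_mem_adm h⟩ := by
  have : emb q s ⟨k L M₁ M₂ J, k_mem_adm h⟩ = wt q s L M₁ M₂ J • ket L M₁ M₂ J :=
    (Phi_k q s L M₁ M₂ J).trans (termKet_eq _ _ _ _ _)
  rw [this, smul_smul, inv_mul_cancel₀ (wt_ne_zero h0 h1 hs _ _ _ _), one_smul]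

theorem denseRange_emb {q s : ℝ} (h0 : 0 < q) (h1 : q < 1) (hs : s * s = 1) :
    DenseRange (emb q s) := by
  have h : Submodule.span ℂ (Set.range ketBasis) ≤ LinearMap.range (emb q s) := by
    rw [Submodule.span_le]
    rintro _ ⟨v, rfl⟩
    rw [ketBasis_apply, ket_eq_emb h0 h1 hs v.2]
    exact Submodule.smul_of_tower_mem _ _ (LinearMap.mem_range_self _ _)
  have hd : Dense (Submodule.span ℂ (Set.range ketBasis) : Set Spinors) := by
    rw [dense_iff_closure_eq, ← Submodule.topologicalClosure_coe, ketBasis.dense_span]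
    rfl
  exact hd.mono h

end Dense

section Extension

variable {E H : Type*} [AddCommGroup E] [Module ℂ E] [NormedAddCommGroup H] [InnerProductSpace ℂ H]
  [CompleteSpace H] {j : E →ₗ[ℂ] H}

theorem exists_extension (hj : DenseRange j) {Y : E →ₗ[ℂ] E} (hY : ∀ f, ‖j (Y f)‖ ≤ ‖j f‖) :
    ∃ T : H →L[ℂ] H, ∀ f, T (j f) = j (Y f) :=
  ⟨(j ∘ₗ Y).extendOfNorm j, LinearMap.extendOfNorm_eq hj ⟨1, fun f => by simpa using hY f⟩⟩

theorem star_apply_of_adjoint (hj : DenseRange j) {Y Y' : E →ₗ[ℂ] E} {T : H →L[ℂ] H}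
    (hT : ∀ f, T (j f) = j (Y' f)) (h : ∀ f g, ⟪j (Y f), j g⟫_ℂ = ⟪j f, j (Y' g)⟫_ℂ) (f : E) :
    (star T) (j f) = j (Y f) := by
  refine hj.eq_of_inner_left (𝕜 := ℂ) fun g => ?_
  rw [ContinuousLinearMap.star_eq_adjoint, ContinuousLinearMap.adjoint_inner_left, hT, h]

theorem clm_ext_denseRange (hj : DenseRange j) {S T : H →L[ℂ] H} (h : ∀ f, S (j f) = T (j f)) :
    S = T :=
  ContinuousLinearMap.ext fun v => congrFun
    (hj.equalizer S.continuous T.continuous (funext h)) v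

/-- The radius relation is applied to `f` and paired with `f`, moving one factor of each product to
the other side. It bounds `x₀, x₁*, x₂*`, each by 1. -/
theorem norm_sq_add_of_radius {Y0 Y1 Y1s D Ds : E →ₗ[ℂ] E}
    (h0 : ∀ f g, ⟪j (Y0 f), j g⟫_ℂ = ⟪j f, j (Y0 g)⟫_ℂ)
    (h1 : ∀ f g, ⟪j (Y1 f), j g⟫_ℂ = ⟪j f, j (Y1s g)⟫_ℂ)
    (hD : ∀ f g, ⟪j (D f), j g⟫_ℂ = ⟪j f, j (Ds g)⟫_ℂ)
    (hr : ∀ f, Y0 (Y0 f) + Y1 (Y1s f) + D (Ds f) = f) (f : E) :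
    ‖j (Y0 f)‖ ^ 2 + ‖j (Y1s f)‖ ^ 2 + ‖j (Ds f)‖ ^ 2 = ‖j f‖ ^ 2 := by
  have key : ⟪j (Y0 f), j (Y0 f)⟫_ℂ + ⟪j (Y1s f), j (Y1s f)⟫_ℂ + ⟪j (Ds f), j (Ds f)⟫_ℂ =
      ⟪j f, j f⟫_ℂ := by
    rw [← h0, ← h1, ← hD, ← inner_add_left, ← inner_add_left, ← map_add, ← map_add, hr]
  simp only [inner_self_eq_norm_sq_to_K] at key
  exact_mod_cast key

theorem exists_sphereRel {q : ℝ} (hj : DenseRange j) {Y0 Y1 Y1s D Ds : E →ₗ[ℂ] E}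
    (h0 : ∀ f g, ⟪j (Y0 f), j g⟫_ℂ = ⟪j f, j (Y0 g)⟫_ℂ)
    (h1 : ∀ f g, ⟪j (Y1 f), j g⟫_ℂ = ⟪j f, j (Y1s g)⟫_ℂ)
    (hD : ∀ f g, ⟪j (D f), j g⟫_ℂ = ⟪j f, j (Ds g)⟫_ℂ)
    (c01 : ∀ f, Y0 (Y1 f) = (q : ℂ) ^ 2 • Y1 (Y0 f))
    (c02 : ∀ f, Y0 (D f) = (q : ℂ) ^ 2 • D (Y0 f))
    (c12 : ∀ f, Y1 (D f) = (q : ℂ) ^ 2 • D (Y1 f))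
    (s12 : ∀ f, Y1s (D f) = (q : ℂ) ^ 2 • D (Y1s f))
    (u1 : ∀ f, Y1s (Y1 f) - Y1 (Y1s f) = (1 - (q : ℂ) ^ 4) • Y0 (Y0 f))
    (u2 : ∀ f, Ds (D f) - D (Ds f) = Y1s (Y1 f) - (q : ℂ) ^ 4 • Y1 (Y1s f))
    (hr : ∀ f, Y0 (Y0 f) + Y1 (Y1s f) + D (Ds f) = f) :
    ∃ t₀ t₁ t₂ : H →L[ℂ] H, SphereRel q t₀ t₁ t₂ ∧ (∀ f, t₀ (j f) = j (Y0 f)) ∧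
      (∀ f, t₁ (j f) = j (Y1 f)) ∧ ∀ f, t₂ (j f) = j (D f) := by
  have hN := norm_sq_add_of_radius h0 h1 hD hr
  obtain ⟨T0, e0⟩ := exists_extension hj (Y := Y0) fun f => by
    refine (sq_le_sq₀ (norm_nonneg _) (norm_nonneg _)).1 ?_
    nlinarith [hN f, sq_nonneg ‖j (Y1s f)‖, sq_nonneg ‖j (Ds f)‖]
  obtain ⟨T1s, e3⟩ := exists_extension hj (Y := Y1s) fun f => by
    refine (sq_le_sq₀ (norm_nonneg _) (norm_nonneg _)).1 ?_
    nlinarith [hN f, sq_nonneg ‖j (Y0 f)‖, sq_nonneg ‖j (Ds f)‖]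
  obtain ⟨T2s, e4⟩ := exists_extension hj (Y := Ds) fun f => by
    refine (sq_le_sq₀ (norm_nonneg _) (norm_nonneg _)).1 ?_
    nlinarith [hN f, sq_nonneg ‖j (Y1s f)‖, sq_nonneg ‖j (Y0 f)‖]
  have e1 := star_apply_of_adjoint hj e3 h1
  have e2 := star_apply_of_adjoint hj e4 hD
  -- The norm identity controls `x₁*` and `x₂*` rather than `x₁` and `x₂`; the latter are obtained
  -- as Hilbert space adjoints of the extensions.
  refine ⟨T0, star T1s, star T2s, ?_, e0, e1, e2⟩
  constructor
  · exact clm_ext_denseRange hj fun f => (star_apply_of_adjoint hj e0 h0 f).trans (e0 f).symm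
  all_goals
    refine clm_ext_denseRange hj fun f => ?_
    simp only [mul_apply_eq_comp, add_apply, sub_apply,
      smul_apply, one_apply_eq_self, star_star, e0, e1, e2, e3, e4]
  exacts [(congrArg j (c01 f)).trans (map_smul ..), (congrArg j (c02 f)).trans (map_smul ..),
    (congrArg j (c12 f)).trans (map_smul ..), (congrArg j (s12 f)).trans (map_smul ..),
    by simpa only [map_smul, map_sub] using congrArg j (u1 f),
    by simpa only [map_smul, map_sub] using congrArg j (u2 f),
    by simpa only [map_add] using congrArg j (hr f)]

end Extension

end QuantumSphere
end

/-! ### Existence and uniqueness of the chiral representations -/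

noncomputable section
namespace QuantumSphere

theorem map_mem_adm {X : Lat →ₗ[ℂ] Lat}
    (h : ∀ L M₁ M₂ J, Admissible L M₁ M₂ J → X (k L M₁ M₂ J) ∈ adm) (f : Lat) (hf : f ∈ adm) :
    X f ∈ adm := by
  refine adm_induction (p := fun f => X f ∈ adm) h ?_ ?_ ?_ hf
  · simp
  · intro f g hf hg; rw [map_add]; exact add_mem hf hg
  · intro c f hf; rw [map_smul]; exact Submodule.smul_mem _ _ hf

/-- The operator `s X` on the admissible part. -/
def res (s : ℝ) (X : Lat →ₗ[ℂ] Lat)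
    (h : ∀ L M₁ M₂ J, Admissible L M₁ M₂ J → X (k L M₁ M₂ J) ∈ adm) : adm →ₗ[ℂ] adm :=
  (s : ℂ) • X.restrict (map_mem_adm h)

section Res

variable {q s : ℝ} {X Y Z W : Lat →ₗ[ℂ] Lat}
  {hX : ∀ L M₁ M₂ J, Admissible L M₁ M₂ J → X (k L M₁ M₂ J) ∈ adm}
  {hY : ∀ L M₁ M₂ J, Admissible L M₁ M₂ J → Y (k L M₁ M₂ J) ∈ adm}

theorem res_coe (f : adm) : ((res s X hX f : adm) : Lat) = (s : ℂ) • X f := rfl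

/-- Every defining relation contains only products of two generators and constants, so replacing
each `X` by `sX` with `s² = 1` preserves the relations. -/
theorem res_res (hs : s * s = 1) (f : adm) :
    ((res s X hX (res s Y hY f) : adm) : Lat) = X (Y f) := by
  rw [res_coe, res_coe, map_smul, smul_smul, ← Complex.ofReal_mul, hs, Complex.ofReal_one, one_smul]

theorem emb_res (f : adm) : emb q s (res s X hX f) = (s : ℂ) • Phi q s (X f) :=
  map_smul (Phi q s) (s : ℂ) (X f)

theorem adm_ext {P Q : Lat →ₗ[ℂ] Lat}
    (h : ∀ L M₁ M₂ J, Admissible L M₁ M₂ J → P (k L M₁ M₂ J) = Q (k L M₁ M₂ J)) (f : adm) :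
    P f = Q f := by
  refine adm_induction (p := fun f => P f = Q f) h ?_ ?_ ?_ f.2
  · simp
  · intro f g hf hg; rw [map_add, map_add, hf, hg]
  · intro c f hf; rw [map_smul, map_smul, hf]

theorem inner_emb_res (h : ∀ L M₁ M₂ J L' M₁' M₂' J', Admissible L M₁ M₂ J →
      Admissible L' M₁' M₂' J' → ⟪Phi q s (X (k L M₁ M₂ J)), Phi q s (k L' M₁' M₂' J')⟫_ℂ =
        ⟪Phi q s (k L M₁ M₂ J), Phi q s (Y (k L' M₁' M₂' J'))⟫_ℂ) (f g : adm) :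
    ⟪emb q s (res s X hX f), emb q s g⟫_ℂ = ⟪emb q s f, emb q s (res s Y hY g)⟫_ℂ := by
  have key : ⟪Phi q s (X f), Phi q s g⟫_ℂ = ⟪Phi q s f, Phi q s (Y g)⟫_ℂ := by
    refine adm_induction (p := fun f => ⟪Phi q s (X f), Phi q s g⟫_ℂ = ⟪Phi q s f, Phi q s (Y g)⟫_ℂ)
      (fun L M₁ M₂ J hL => ?_) ?_ ?_ ?_ f.2
    · refine adm_induction (p := fun g => ⟪Phi q s (X (k L M₁ M₂ J)), Phi q s g⟫_ℂ =
        ⟪Phi q s (k L M₁ M₂ J), Phi q s (Y g)⟫_ℂ) (fun L' M₁' M₂' J' hL' => h _ _ _ _ _ _ _ _ hL hL')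
        ?_ ?_ ?_ g.2
      · simp
      · intro f g hf hg; simp only [map_add, inner_add_right, hf, hg]
      · intro c f hf; simp only [map_smul, inner_smul_right, hf]
    · simp
    · intro f g hf hg; simp only [map_add, inner_add_left, hf, hg]
    · intro c f hf; simp only [map_smul, inner_smul_left, hf]
  rw [emb_res, emb_res, inner_smul_left, inner_smul_right,
    Complex.conj_ofReal]
  exact congrArg _ key

end Res

section Rep

variable {q s : ℝ}

def Y0 (s : ℝ) (h0 : 0 < q) (h1 : q < 1) : adm →ₗ[ℂ] adm :=
  res s (X0 q) fun _ _ _ _ => X0_mem h0 h1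

def Y1 (s : ℝ) (h0 : 0 < q) (h1 : q < 1) : adm →ₗ[ℂ] adm :=
  res s (X1 q) fun _ _ _ _ => X1_mem h0 h1

def Y1s (s : ℝ) (h0 : 0 < q) (h1 : q < 1) : adm →ₗ[ℂ] adm :=
  res s (X1s q) fun _ _ _ _ => X1s_mem h0 h1

def Y2 (s : ℝ) (h0 : 0 < q) (h1 : q < 1) : adm →ₗ[ℂ] adm :=
  res s (Dop q) fun _ _ _ _ => Dop_mem h0 h1

def Y2s (s : ℝ) (h0 : 0 < q) (h1 : q < 1) : adm →ₗ[ℂ] adm :=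
  res s (Dst q) fun _ _ _ _ => Dst_mem h0 h1

theorem inner_Y0 (h0 : 0 < q) (h1 : q < 1) (hs : s * s = 1) (f g : adm) :
    ⟪emb q s (Y0 s h0 h1 f), emb q s g⟫_ℂ = ⟪emb q s f, emb q s (Y0 s h0 h1 g)⟫_ℂ :=
  inner_emb_res (fun _ _ _ _ _ _ _ _ => inner_X0 h0 h1 hs) f g

theorem inner_Y1 (h0 : 0 < q) (h1 : q < 1) (hs : s * s = 1) (f g : adm) :
    ⟪emb q s (Y1 s h0 h1 f), emb q s g⟫_ℂ = ⟪emb q s f, emb q s (Y1s s h0 h1 g)⟫_ℂ :=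
  inner_emb_res (fun _ _ _ _ _ _ _ _ => inner_X1 h0 h1 hs) f g

theorem inner_Y2 (h0 : 0 < q) (h1 : q < 1) (hs : s * s = 1) (f g : adm) :
    ⟪emb q s (Y2 s h0 h1 f), emb q s g⟫_ℂ = ⟪emb q s f, emb q s (Y2s s h0 h1 g)⟫_ℂ :=
  inner_emb_res (fun _ _ _ _ _ _ _ _ => inner_Dop h0 h1 hs) f g

theorem ofReal_smul_lat (r : ℝ) (f : Lat) : (r : ℂ) • f = r • f := by
  ext v; simp

theorem exists_sphereRel_emb (h0 : 0 < q) (h1 : q < 1) (hs : s * s = 1) :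
    ∃ t₀ t₁ t₂ : Spinors →L[ℂ] Spinors, SphereRel q t₀ t₁ t₂ ∧
      (∀ f, t₀ (emb q s f) = emb q s (Y0 s h0 h1 f)) ∧
      (∀ f, t₁ (emb q s f) = emb q s (Y1 s h0 h1 f)) ∧
      ∀ f, t₂ (emb q s f) = emb q s (Y2 s h0 h1 f) := by
  have c2 : (q : ℂ) ^ 2 = ((q ^ 2 : ℝ) : ℂ) := by push_cast; rfl
  have c4 : (q : ℂ) ^ 4 = ((q ^ 4 : ℝ) : ℂ) := by push_cast; rfl
  have c5 : (1 - ((q ^ 4 : ℝ) : ℂ)) = ((1 - q ^ 4 : ℝ) : ℂ) := by push_cast; rfl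
  have key := @exists_sphereRel adm Spinors _ _ _ _ _ (emb q s) q
  have key := @key (denseRange_emb h0 h1 hs) (Y0 s h0 h1) (Y1 s h0 h1) (Y1s s h0 h1) (Y2 s h0 h1)
    (Y2s s h0 h1) (inner_Y0 h0 h1 hs) (inner_Y1 h0 h1 hs) (inner_Y2 h0 h1 hs)
  refine key ?_ ?_ ?_ ?_ ?_ ?_ ?_
  all_goals
    refine fun f => Subtype.ext ?_
    simp only [Y0, Y1, Y1s, Y2, Y2s, Submodule.coe_add, Submodule.coe_sub, Submodule.coe_smul,
      res_res hs, c5, c2, c4, ofReal_smul_lat]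
  · exact adm_ext (P := X0 q ∘ₗ X1 q) (Q := q ^ 2 • (X1 q ∘ₗ X0 q))
      (fun L M₁ M₂ J h => X0_X1 h0 h1 L M₁ M₂ h.1) f
  · exact adm_ext (P := X0 q ∘ₗ Dop q) (Q := q ^ 2 • (Dop q ∘ₗ X0 q))
      (fun L M₁ M₂ J h => X0_Dop h0 h1 L M₁ M₂ J) f
  · exact adm_ext (P := X1 q ∘ₗ Dop q) (Q := q ^ 2 • (Dop q ∘ₗ X1 q))
      (fun L M₁ M₂ J h => X1_Dop h0 h1 L M₁ M₂ J) f
  · exact adm_ext (P := X1s q ∘ₗ Dop q) (Q := q ^ 2 • (Dop q ∘ₗ X1s q))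
      (fun L M₁ M₂ J h => X1s_Dop h0 h1 L M₁ M₂ J) f
  · exact adm_ext (P := X1s q ∘ₗ X1 q - X1 q ∘ₗ X1s q) (Q := (1 - q ^ 4) • (X0 q ∘ₗ X0 q))
      (fun L M₁ M₂ J h => X1s_X1 h0 h1 L M₁ M₂ h.1) f
  · exact adm_ext (P := Dst q ∘ₗ Dop q - Dop q ∘ₗ Dst q)
      (Q := X1s q ∘ₗ X1 q - q ^ 4 • (X1 q ∘ₗ X1s q))
      (fun L M₁ M₂ J h => Dst_Dop_sub h0 h1 L M₁ M₂ h.1) f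
  · exact adm_ext (P := X0 q ∘ₗ X0 q + X1 q ∘ₗ X1s q + Dop q ∘ₗ Dst q) (Q := LinearMap.id)
      (fun L M₁ M₂ J h => X0_X0_add h0 h1 L M₁ M₂ h.1) f

theorem apply_ket_of_emb {X : Lat →ₗ[ℂ] Lat}
    {hX : ∀ L M₁ M₂ J, Admissible L M₁ M₂ J → X (k L M₁ M₂ J) ∈ adm} {T : Spinors →L[ℂ] Spinors}
    (h0 : 0 < q) (h1 : q < 1) (hs : s * s = 1) (hT : ∀ f, T (emb q s f) = emb q s (res s X hX f))
    {L M₁ M₂ J : ℤ} (h : Admissible L M₁ M₂ J) {v : Spinors}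
    (hv : s • Phi q s (X (k L M₁ M₂ J)) = wt q s L M₁ M₂ J • v) : T (ket L M₁ M₂ J) = v := by
  have hv' : (s : ℂ) • Phi q s (X (k L M₁ M₂ J)) = (wt q s L M₁ M₂ J : ℂ) • v :=
    (Complex.coe_smul s _).trans (hv.trans (Complex.coe_smul _ v).symm)
  have hk : ket L M₁ M₂ J = ((wt q s L M₁ M₂ J : ℂ))⁻¹ • emb q s ⟨k L M₁ M₂ J, k_mem_adm h⟩ := by
    rw [ket_eq_emb h0 h1 hs h, ← Complex.ofReal_inv]
    exact (Complex.coe_smul _ _).symm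
  have hw : (wt q s L M₁ M₂ J : ℂ) ≠ 0 := Complex.ofReal_ne_zero.2 (wt_ne_zero h0 h1 hs _ _ _ _)
  rw [hk, map_smul, hT, emb_res]
  rw [hv', smul_smul, inv_mul_cancel₀ hw, one_smul]

theorem exists_isChiralRep (h0 : 0 < q) (h1 : q < 1) (hs : s * s = 1) :
    ∃ ρ, IsChiralRep q s ρ := by
  obtain ⟨t₀, t₁, t₂, hT, e0, e1, e2⟩ := exists_sphereRel_emb h0 h1 hs
  refine ⟨liftRep hT, fun L M₁ M₂ J h => ?_, fun L M₁ M₂ J h => ?_, fun L M₁ M₂ J h => ?_⟩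
  · rw [liftRep_x]
    exact apply_ket_of_emb h0 h1 hs e0 h (smul_Phi_X0 h0 h1 hs h)
  · rw [liftRep_x]
    exact apply_ket_of_emb h0 h1 hs e1 h (smul_Phi_X1 h0 h1 hs h)
  · rw [liftRep_x]
    exact apply_ket_of_emb h0 h1 hs e2 h (smul_Phi_Dop h0 h1 hs h)

theorem IsChiralRep.unique {ρ σ : S4 q →⋆ₐ[ℂ] (Spinors →L[ℂ] Spinors)} (hρ : IsChiralRep q s ρ)
    (hσ : IsChiralRep q s σ) : ρ = σ := by
  refine starAlgHom_ext fun i => clm_ext_ket fun L M₁ M₂ J h => ?_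
  fin_cases i
  · exact (hρ.x0_ket L M₁ M₂ J h).trans (hσ.x0_ket L M₁ M₂ J h).symm
  · exact (hρ.x1_ket L M₁ M₂ J h).trans (hσ.x1_ket L M₁ M₂ J h).symm
  · exact (hρ.x2_ket L M₁ M₂ J h).trans (hσ.x2_ket L M₁ M₂ J h).symm

theorem existsUnique_isChiralRep (h0 : 0 < q) (h1 : q < 1) (hs : s * s = 1) :
    ∃! ρ, IsChiralRep q s ρ :=
  existsUnique_of_exists_of_unique (exists_isChiralRep h0 h1 hs) fun _ _ => IsChiralRep.unique

end Rep
end QuantumSphere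
end

noncomputable section

/-! ### Nuclear operators and approximation by finite rank -/

section Ideal

variable {X Y Z : Type} [NormedAddCommGroup X] [InnerProductSpace ℂ X]
  [NormedAddCommGroup Y] [InnerProductSpace ℂ Y]
  [NormedAddCommGroup Z] [InnerProductSpace ℂ Z]

/-- `T = ∑ |u i⟩⟨w i|` with `∑ ‖u i‖ ‖w i‖ < ∞`. -/
structure IsNuclearSum {ι : Type} (u : ι → Y) (w : ι → X) (T : X →L[ℂ] Y) : Prop where
  summable : Summable fun i => ‖u i‖ * ‖w i‖
  hasSum : ∀ x, HasSum (fun i => ⟪w i, x⟫_ℂ • u i) (T x)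

/-- `T` is a nuclear operator. -/
def IsNuclear (T : X →L[ℂ] Y) : Prop :=
  ∃ (ι : Type) (u : ι → Y) (w : ι → X), IsNuclearSum u w T

/-- `T` is a nuclear operator and its trace is `t`. -/
def HasNuclearTrace (T : X →L[ℂ] X) (t : ℂ) : Prop :=
  ∃ (ι : Type) (u w : ι → X), IsNuclearSum u w T ∧ HasSum (fun i => ⟪w i, u i⟫_ℂ) t

/-- The approximation numbers of `T` are `O(n⁻²)`. -/
def HasQuadraticApprox (T : X →L[ℂ] Y) : Prop :=
  ∃ K : ℝ, 0 ≤ K ∧ ∀ n : ℕ, ∃ V : Submodule ℂ X, FiniteDimensional ℂ V ∧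
    Module.finrank ℂ V ≤ n ∧ ∀ x ∈ Vᗮ, ‖T x‖ ≤ K / (n + 1) ^ 2 * ‖x‖

/-- The ideal of operators in which all commutators of the Fredholm module lie. -/
def IsSmooth (T : X →L[ℂ] Y) : Prop := IsNuclear T ∧ HasQuadraticApprox T

theorem IsNuclearSum.comp_left {ι : Type} {u : ι → Y} {w : ι → X} {T : X →L[ℂ] Y}
    (h : IsNuclearSum u w T) (S : Y →L[ℂ] Z) : IsNuclearSum (fun i => S (u i)) w (S ∘L T) where
  summable := by
    refine (h.summable.mul_left ‖S‖).of_nonneg_of_le (fun i => by positivity) fun i => ?_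
    rw [← mul_assoc]
    exact mul_le_mul_of_nonneg_right (S.le_opNorm _) (norm_nonneg _)
  hasSum x := by simpa using (h.hasSum x).mapL S

theorem IsNuclearSum.comp_right [CompleteSpace X] [CompleteSpace Z] {ι : Type} {u : ι → Y}
    {w : ι → X} {T : X →L[ℂ] Y} (h : IsNuclearSum u w T) (S : Z →L[ℂ] X) :
    IsNuclearSum u (fun i => ContinuousLinearMap.adjoint S (w i)) (T ∘L S) where
  summable := by
    refine (h.summable.mul_left ‖ContinuousLinearMap.adjoint S‖).of_nonneg_of_le
      (fun i => by positivity) fun i => ?_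
    rw [mul_left_comm]
    exact mul_le_mul_of_nonneg_left (ContinuousLinearMap.le_opNorm _ _) (norm_nonneg _)
  hasSum x := by
    simp only [ContinuousLinearMap.adjoint_inner_left]
    exact h.hasSum (S x)

theorem IsNuclearSum.add {ι κ : Type} {u : ι → Y} {w : ι → X} {u' : κ → Y} {w' : κ → X}
    {T S : X →L[ℂ] Y} (h : IsNuclearSum u w T) (h' : IsNuclearSum u' w' S) :
    IsNuclearSum (Sum.elim u u') (Sum.elim w w') (T + S) where
  summable := (h.summable.hasSum.sum (f := fun i => ‖Sum.elim u u' i‖ * ‖Sum.elim w w' i‖)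
    h'.summable.hasSum).summable
  hasSum x := (h.hasSum x).sum (f := fun i => ⟪Sum.elim w w' i, x⟫_ℂ • Sum.elim u u' i)
    (h'.hasSum x)

theorem IsNuclearSum.adjoint [CompleteSpace X] [CompleteSpace Y] {ι : Type} {u : ι → Y}
    {w : ι → X} {T : X →L[ℂ] Y} (h : IsNuclearSum u w T) :
    IsNuclearSum w u (ContinuousLinearMap.adjoint T) where
  summable := by simpa only [mul_comm] using h.summable
  hasSum y := by
    have hs : Summable fun i => ⟪u i, y⟫_ℂ • w i := by
      refine Summable.of_norm_bounded (h.summable.mul_right ‖y‖) fun i => ?_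
      rw [norm_smul]
      calc ‖⟪u i, y⟫_ℂ‖ * ‖w i‖ ≤ ‖u i‖ * ‖y‖ * ‖w i‖ :=
            mul_le_mul_of_nonneg_right (norm_inner_le_norm _ _) (norm_nonneg _)
        _ = ‖u i‖ * ‖w i‖ * ‖y‖ := by ring
    convert hs.hasSum using 1
    refine ext_inner_left ℂ fun x => ?_
    rw [ContinuousLinearMap.adjoint_inner_right]
    have h1 := (h.hasSum x).mapL (innerSL ℂ y)
    have h2 := hs.hasSum.mapL (innerSL ℂ x)
    have h3 : HasSum (fun i => starRingEnd ℂ ((innerSL ℂ y) (⟪w i, x⟫_ℂ • u i)))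
        (starRingEnd ℂ ((innerSL ℂ y) (T x))) := h1.map (starRingEnd ℂ) Complex.continuous_conj
    simp only [innerSL_apply_apply, inner_smul_right, map_mul, inner_conj_symm] at h2 h3
    refine h3.unique ?_
    simpa only [mul_comm] using h2

theorem IsNuclear.comp_left {T : X →L[ℂ] Y} (h : IsNuclear T) (S : Y →L[ℂ] Z) :
    IsNuclear (S ∘L T) :=
  let ⟨_, _, _, h⟩ := h
  ⟨_, _, _, h.comp_left S⟩

theorem IsNuclear.comp_right [CompleteSpace X] [CompleteSpace Z] {T : X →L[ℂ] Y}
    (h : IsNuclear T) (S : Z →L[ℂ] X) : IsNuclear (T ∘L S) :=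
  let ⟨_, _, _, h⟩ := h
  ⟨_, _, _, h.comp_right S⟩

theorem IsNuclear.add {T S : X →L[ℂ] Y} (h : IsNuclear T) (h' : IsNuclear S) :
    IsNuclear (T + S) :=
  let ⟨_, _, _, h⟩ := h
  let ⟨_, _, _, h'⟩ := h'
  ⟨_, _, _, h.add h'⟩

theorem IsNuclear.neg {T : X →L[ℂ] Y} (h : IsNuclear T) : IsNuclear (-T) := by
  simpa using h.comp_left (-ContinuousLinearMap.id ℂ Y)

theorem IsNuclear.sub {T S : X →L[ℂ] Y} (h : IsNuclear T) (h' : IsNuclear S) :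
    IsNuclear (T - S) := by
  simpa only [sub_eq_add_neg] using h.add h'.neg

theorem IsNuclear.adjoint [CompleteSpace X] [CompleteSpace Y] {T : X →L[ℂ] Y}
    (h : IsNuclear T) : IsNuclear (ContinuousLinearMap.adjoint T) :=
  let ⟨_, _, _, h⟩ := h
  ⟨_, _, _, h.adjoint⟩

theorem isNuclear_zero : IsNuclear (0 : X →L[ℂ] Y) :=
  ⟨Empty, Empty.elim, Empty.elim, summable_empty, fun x => by simp⟩

theorem HasNuclearTrace.isNuclear {T : X →L[ℂ] X} {t : ℂ} (h : HasNuclearTrace T t) :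
    IsNuclear T :=
  let ⟨_, _, _, h, _⟩ := h
  ⟨_, _, _, h⟩

theorem HasNuclearTrace.add {T S : X →L[ℂ] X} {t s : ℂ} (h : HasNuclearTrace T t)
    (h' : HasNuclearTrace S s) : HasNuclearTrace (T + S) (t + s) :=
  let ⟨_, _, _, h, ht⟩ := h
  let ⟨_, u', w', h', hs⟩ := h'
  ⟨_, _, _, h.add h', ht.sum (f := fun i => ⟪Sum.elim _ w' i, Sum.elim _ u' i⟫_ℂ) hs⟩

theorem HasNuclearTrace.smul {T : X →L[ℂ] X} {t : ℂ} (h : HasNuclearTrace T t) (c : ℂ) :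
    HasNuclearTrace (c • T) (c * t) := by
  obtain ⟨ι, u, w, h, ht⟩ := h
  have := h.comp_left (c • ContinuousLinearMap.id ℂ X)
  refine ⟨ι, _, _, by simpa using this, ?_⟩
  simpa [inner_smul_right] using ht.mul_left c

theorem HasNuclearTrace.neg {T : X →L[ℂ] X} {t : ℂ} (h : HasNuclearTrace T t) :
    HasNuclearTrace (-T) (-t) := by
  simpa using h.smul (-1)

theorem HasNuclearTrace.sub {T S : X →L[ℂ] X} {t s : ℂ} (h : HasNuclearTrace T t)
    (h' : HasNuclearTrace S s) : HasNuclearTrace (T - S) (t - s) := by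
  simpa only [sub_eq_add_neg] using h.add h'.neg

theorem hasNuclearTrace_zero : HasNuclearTrace (0 : X →L[ℂ] X) 0 :=
  ⟨Empty, Empty.elim, Empty.elim, ⟨summable_empty, fun x => by simp⟩, by simp⟩

theorem HasNuclearTrace.sum {α : Type*} (s : Finset α) {T : α → X →L[ℂ] X} {t : α → ℂ}
    (h : ∀ i, HasNuclearTrace (T i) (t i)) :
    HasNuclearTrace (∑ i ∈ s, T i) (∑ i ∈ s, t i) := by
  classical
  induction s using Finset.induction_on with
  | empty => simpa using hasNuclearTrace_zero
  | insert a s ha ih => rw [Finset.sum_insert ha, Finset.sum_insert ha]; exact (h a).add ih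

theorem IsNuclearSum.summable_inner {ι : Type} {u w : ι → X} {T : X →L[ℂ] X}
    (h : IsNuclearSum u w T) : Summable fun i => ⟪w i, u i⟫_ℂ :=
  Summable.of_norm_bounded h.summable fun i => by
    rw [mul_comm]; exact norm_inner_le_norm _ _

/-- Cyclicity of the trace. -/
theorem IsNuclear.exists_trace_comm [CompleteSpace X] [CompleteSpace Y] {T : X →L[ℂ] Y}
    (h : IsNuclear T) (S : Y →L[ℂ] X) :
    ∃ t, HasNuclearTrace (S ∘L T) t ∧ HasNuclearTrace (T ∘L S) t := by
  obtain ⟨ι, u, w, h⟩ := h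
  have h1 := h.comp_left S
  refine ⟨∑' i, ⟪w i, S (u i)⟫_ℂ, ⟨ι, _, _, h1, h1.summable_inner.hasSum⟩,
    ⟨ι, _, _, h.comp_right S, ?_⟩⟩
  simpa only [ContinuousLinearMap.adjoint_inner_left] using h1.summable_inner.hasSum

theorem IsNuclear.exists_trace {T : X →L[ℂ] X} (h : IsNuclear T) : ∃ t, HasNuclearTrace T t :=
  let ⟨_, _, _, h⟩ := h
  ⟨_, _, _, _, h, h.summable_inner.hasSum⟩

theorem sum_norm_inner_mul_le {ι : Type} {b : ι → X} (hb : Orthonormal ℂ b) (x y : X)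
    (s : Finset ι) : ∑ i ∈ s, ‖⟪b i, x⟫_ℂ‖ * ‖⟪b i, y⟫_ℂ‖ ≤ ‖x‖ * ‖y‖ := by
  refine (Real.sum_mul_le_sqrt_mul_sqrt s _ _).trans ?_
  refine mul_le_mul ?_ ?_ (Real.sqrt_nonneg _) (norm_nonneg _)
  · exact Real.sqrt_le_iff.2 ⟨norm_nonneg _, hb.sum_inner_products_le x⟩
  · exact Real.sqrt_le_iff.2 ⟨norm_nonneg _, hb.sum_inner_products_le y⟩

/-- The trace of `∑ |u_i⟩⟨w_i|` in a basis `b` is the double series of `⟪w_i, b_j⟫⟪b_j, u_i⟫`. By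
Cauchy–Schwarz and Bessel it converges absolutely, so its order may be exchanged. The value of the
trace is therefore independent of the chosen decomposition. -/
theorem HasNuclearTrace.hasSum_inner {T : X →L[ℂ] X} {t : ℂ} (h : HasNuclearTrace T t)
    {κ : Type} (b : HilbertBasis κ ℂ X) : HasSum (fun j => ⟪b j, T (b j)⟫_ℂ) t := by
  obtain ⟨ι, u, w, h, ht⟩ := h
  have hb : ∀ i, Summable fun j => ‖⟪b j, u i⟫_ℂ‖ * ‖⟪b j, w i⟫_ℂ‖ := fun i =>
    summable_of_sum_le (fun j => by positivity) (sum_norm_inner_mul_le b.orthonormal (u i) (w i))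
  have hsum : Summable fun p : ι × κ => ⟪w p.1, b p.2⟫_ℂ * ⟪b p.2, u p.1⟫_ℂ := by
    refine Summable.of_norm ?_
    have hn : ∀ p : ι × κ, ‖⟪w p.1, b p.2⟫_ℂ * ⟪b p.2, u p.1⟫_ℂ‖ =
        ‖⟪b p.2, u p.1⟫_ℂ‖ * ‖⟪b p.2, w p.1⟫_ℂ‖ := fun p => by
      rw [norm_mul, norm_inner_symm, mul_comm]
    simp only [hn]
    refine (summable_prod_of_nonneg fun p => by positivity).2 ⟨hb, ?_⟩
    refine h.summable.of_nonneg_of_le (fun i => tsum_nonneg fun j => by positivity) fun i => ?_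
    exact (hb i).tsum_le_of_sum_le (sum_norm_inner_mul_le b.orthonormal (u i) (w i))
  have h1 : ∀ i, HasSum (fun j => ⟪w i, b j⟫_ℂ * ⟪b j, u i⟫_ℂ) ⟪w i, u i⟫_ℂ := fun i =>
    b.hasSum_inner_mul_inner _ _
  have h2 : ∀ j, HasSum (fun i => ⟪w i, b j⟫_ℂ * ⟪b j, u i⟫_ℂ) ⟪b j, T (b j)⟫_ℂ := fun j => by
    simpa [inner_smul_right] using (h.hasSum (b j)).mapL (innerSL ℂ (b j))
  have h3 := hsum.hasSum.prod_fiberwise h1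
  have h4 := ((Equiv.prodComm κ ι).hasSum_iff.2 hsum.hasSum).prod_fiberwise h2
  rwa [h3.unique ht] at h4

theorem HasNuclearTrace.unique [CompleteSpace X] {T : X →L[ℂ] X} {t s : ℂ}
    (h : HasNuclearTrace T t) (h' : HasNuclearTrace T s) : t = s := by
  obtain ⟨_, b, _⟩ := exists_hilbertBasis ℂ X
  exact (h.hasSum_inner b).unique (h'.hasSum_inner b)

end Ideal
end

/-! ### Operators with quadratically decaying approximation numbers -/

noncomputable section

section Approx

variable {X Y Z : Type} [NormedAddCommGroup X] [InnerProductSpace ℂ X]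
  [NormedAddCommGroup Y] [InnerProductSpace ℂ Y]
  [NormedAddCommGroup Z] [InnerProductSpace ℂ Z]

theorem HasQuadraticApprox.comp_left {T : X →L[ℂ] Y} (h : HasQuadraticApprox T) (S : Y →L[ℂ] Z) :
    HasQuadraticApprox (S ∘L T) := by
  obtain ⟨K, hK, h⟩ := h
  refine ⟨‖S‖ * K, by positivity, fun n => ?_⟩
  obtain ⟨V, hV, hn, h⟩ := h n
  refine ⟨V, hV, hn, fun x hx => (S.le_opNorm _).trans ?_⟩
  rw [mul_div_assoc, mul_assoc]
  exact mul_le_mul_of_nonneg_left (h x hx) (norm_nonneg _)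

theorem HasQuadraticApprox.comp_right [CompleteSpace X] [CompleteSpace Z] {T : X →L[ℂ] Y}
    (h : HasQuadraticApprox T) (S : Z →L[ℂ] X) : HasQuadraticApprox (T ∘L S) := by
  obtain ⟨K, hK, h⟩ := h
  refine ⟨K * ‖S‖, by positivity, fun n => ?_⟩
  obtain ⟨V, hV, hn, h⟩ := h n
  refine ⟨V.map (ContinuousLinearMap.adjoint S).toLinearMap, inferInstance,
    (Submodule.finrank_map_le _ _).trans hn, fun x hx => ?_⟩
  have hS : S x ∈ Vᗮ := by
    rw [Submodule.mem_orthogonal] at hx ⊢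
    intro v hv
    have := hx _ (Submodule.mem_map_of_mem hv)
    rwa [ContinuousLinearMap.coe_coe, ContinuousLinearMap.adjoint_inner_left] at this
  refine (h _ hS).trans ?_
  rw [mul_div_right_comm, mul_assoc]
  exact mul_le_mul_of_nonneg_left (S.le_opNorm x) (by positivity)

/-- Half of the allowed dimension is spent on each summand; this costs the factor 4. An explicit
rate makes such elementary ideal arguments possible, and it is enough for summable singular values.
-/
theorem HasQuadraticApprox.add {T S : X →L[ℂ] Y} (h : HasQuadraticApprox T)
    (h' : HasQuadraticApprox S) : HasQuadraticApprox (T + S) := by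
  obtain ⟨K, hK, h⟩ := h
  obtain ⟨K', hK', h'⟩ := h'
  refine ⟨4 * (K + K'), by positivity, fun n => ?_⟩
  obtain ⟨V, hV, hn, h⟩ := h (n / 2)
  obtain ⟨V', hV', hn', h'⟩ := h' (n / 2)
  refine ⟨V ⊔ V', inferInstance, (Submodule.finrank_add_le_finrank_add_finrank _ _).trans
    (by omega), fun x hx => ?_⟩
  rw [← Submodule.inf_orthogonal] at hx
  have hm : ((n : ℝ) + 1) / 2 ≤ ((n / 2 : ℕ) : ℝ) + 1 := by
    have : n + 1 ≤ 2 * (n / 2 + 1) := by omega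
    have : ((n + 1 : ℕ) : ℝ) ≤ (2 * (n / 2 + 1) : ℕ) := by exact_mod_cast this
    push_cast at this
    linarith
  have key : ∀ C : ℝ, 0 ≤ C → C / (((n / 2 : ℕ) : ℝ) + 1) ^ 2 ≤ 4 * C / (n + 1) ^ 2 := by
    intro C hC
    have : 4 * C / ((n : ℝ) + 1) ^ 2 = C / (((n : ℝ) + 1) / 2) ^ 2 := by field_simp; ring
    rw [this]
    gcongr
  calc ‖(T + S) x‖ ≤ ‖T x‖ + ‖S x‖ := norm_add_le _ _
    _ ≤ 4 * K / (n + 1) ^ 2 * ‖x‖ + 4 * K' / (n + 1) ^ 2 * ‖x‖ :=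
      add_le_add ((h x hx.1).trans (mul_le_mul_of_nonneg_right (key K hK) (norm_nonneg _)))
        ((h' x hx.2).trans (mul_le_mul_of_nonneg_right (key K' hK') (norm_nonneg _)))
    _ = 4 * (K + K') / (n + 1) ^ 2 * ‖x‖ := by ring

/-- If `y` is orthogonal to `T V`, then `z = T* y` is orthogonal to `V`, and `‖z‖² = ⟪T z, y⟫` is
bounded by the estimate for `T` at `z`. -/
theorem HasQuadraticApprox.adjoint [CompleteSpace X] [CompleteSpace Y] {T : X →L[ℂ] Y}
    (h : HasQuadraticApprox T) : HasQuadraticApprox (ContinuousLinearMap.adjoint T) := by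
  obtain ⟨K, hK, h⟩ := h
  refine ⟨K, hK, fun n => ?_⟩
  obtain ⟨V, hV, hn, h⟩ := h n
  refine ⟨V.map T.toLinearMap, inferInstance, (Submodule.finrank_map_le _ _).trans hn,
    fun y hy => ?_⟩
  set z := ContinuousLinearMap.adjoint T y with hz
  have hzV : z ∈ Vᗮ := by
    rw [Submodule.mem_orthogonal] at hy ⊢
    intro v hv
    rw [hz, ContinuousLinearMap.adjoint_inner_right]
    exact hy _ (Submodule.mem_map_of_mem hv)
  have h1 : ‖z‖ ^ 2 ≤ (K / (n + 1) ^ 2 * ‖y‖) * ‖z‖ := by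
    have h2 : ⟪z, z⟫_ℂ = ⟪T z, y⟫_ℂ := by
      nth_rw 2 [hz]
      rw [ContinuousLinearMap.adjoint_inner_right]
    have h3 : ‖z‖ ^ 2 = ‖⟪T z, y⟫_ℂ‖ := by
      rw [← h2, inner_self_eq_norm_sq_to_K]
      simp
    rw [h3]
    refine (norm_inner_le_norm _ _).trans ?_
    calc ‖T z‖ * ‖y‖ ≤ K / (n + 1) ^ 2 * ‖z‖ * ‖y‖ :=
          mul_le_mul_of_nonneg_right (h z hzV) (norm_nonneg _)
      _ = _ := by ring
  rcases (norm_nonneg z).eq_or_lt with h0 | h0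
  · rw [← h0]; positivity
  · rw [sq] at h1
    exact le_of_mul_le_mul_right h1 h0

theorem hasQuadraticApprox_zero : HasQuadraticApprox (0 : X →L[ℂ] Y) :=
  ⟨0, le_rfl, fun n => ⟨⊥, inferInstance, by simp, fun x _ => by simp⟩⟩

/-- Singular values are defined with subspaces of dimension exactly `n`, approximation with
dimension at most `n`. Enlarging the subspace bridges the gap and is always possible in infinite
dimension. -/
theorem exists_finrank_eq_of_le (hX : ¬FiniteDimensional ℂ X) (V : Submodule ℂ X)
    [FiniteDimensional ℂ V] (k : ℕ) : ∃ W : Submodule ℂ X, V ≤ W ∧ FiniteDimensional ℂ W ∧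
      Module.finrank ℂ W = Module.finrank ℂ V + k := by
  induction k with
  | zero => exact ⟨V, le_rfl, inferInstance, rfl⟩
  | succ k ih =>
    obtain ⟨W, hVW, hW, hk⟩ := ih
    obtain ⟨v, hv⟩ : ∃ v, v ∉ W := by
      by_contra! h
      have : W = ⊤ := Submodule.eq_top_iff'.2 h
      subst this
      exact hX (Module.Finite.equiv (Submodule.topEquiv (R := ℂ) (M := X)))
    have hv0 : v ≠ 0 := fun h => hv (h ▸ W.zero_mem)
    have hdisj : W ⊓ Submodule.span ℂ {v} = ⊥ := by
      rw [← disjoint_iff, Submodule.disjoint_span_singleton' hv0]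
      exact hv
    refine ⟨W ⊔ Submodule.span ℂ {v}, hVW.trans le_sup_left, inferInstance, ?_⟩
    have := Submodule.finrank_sup_add_finrank_inf_eq W (Submodule.span ℂ {v})
    rw [hdisj, finrank_bot, finrank_span_singleton hv0, hk] at this
    omega

theorem singularValue_nonneg (T : X →L[ℂ] X) (n : ℕ) : 0 ≤ singularValue T n := by
  refine Real.sInf_nonneg ?_
  rintro _ ⟨V, _, _, rfl⟩
  exact norm_nonneg (T ∘L Vᗮ.subtypeL)

theorem HasQuadraticApprox.singularValue_le (hX : ¬FiniteDimensional ℂ X) {T : X →L[ℂ] X}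
    (h : HasQuadraticApprox T) : ∃ K, ∀ n : ℕ, singularValue T n ≤ K / (n + 1) ^ 2 := by
  obtain ⟨K, hK, h⟩ := h
  refine ⟨K, fun n => ?_⟩
  obtain ⟨V, hV, hn, h⟩ := h n
  obtain ⟨W, hVW, hW, hk⟩ := exists_finrank_eq_of_le hX V (n - Module.finrank ℂ V)
  have hb : BddBelow {r : ℝ | ∃ V : Submodule ℂ X, FiniteDimensional ℂ V ∧
      Module.finrank ℂ V = n ∧ r = ‖T ∘L Vᗮ.subtypeL‖} := by
    refine ⟨0, ?_⟩
    rintro _ ⟨V, _, _, rfl⟩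
    exact norm_nonneg (T ∘L Vᗮ.subtypeL)
  refine (csInf_le hb ⟨W, hW, by omega, rfl⟩).trans ?_
  refine ContinuousLinearMap.opNorm_le_bound _ (by positivity) fun x => ?_
  exact h x (Submodule.orthogonal_le hVW x.2)

/-- `T` is the norm limit of `T P_n`, with `P_n` the projection onto the approximating subspace of
dimension at most `n`. -/
theorem HasQuadraticApprox.isCompactOperator [CompleteSpace X] [CompleteSpace Y] {T : X →L[ℂ] Y}
    (h : HasQuadraticApprox T) : IsCompactOperator T := by
  obtain ⟨K, hK, h⟩ := h
  choose V hV hn h using h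
  have hc : ∀ n, IsCompactOperator (T ∘L (V n).starProjection) := by
    intro n
    have : T ∘L (V n).starProjection = (T ∘L (V n).subtypeL) ∘L (V n).orthogonalProjectionOnto := by
      ext x; rfl
    rw [this]
    exact (isCompactOperator_of_locallyCompactSpace_rng (T ∘L (V n).subtypeL)).comp_clm _
  refine isCompactOperator_of_tendsto (l := Filter.atTop)
    (F := fun n => T ∘L (V n).starProjection) ?_ (.of_forall hc)
  have hlim : Filter.Tendsto (fun n : ℕ => K / ((n : ℝ) + 1) ^ 2) Filter.atTop (nhds 0) := by
    refine Filter.Tendsto.div_atTop tendsto_const_nhds ?_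
    exact (Filter.tendsto_pow_atTop two_ne_zero).comp
      (Filter.tendsto_atTop_add_const_right _ _ tendsto_natCast_atTop_atTop)
  rw [tendsto_iff_norm_sub_tendsto_zero]
  refine squeeze_zero (fun n => norm_nonneg _) (fun n => ?_) hlim
  refine ContinuousLinearMap.opNorm_le_bound _ (by positivity) fun x => ?_
  have hx : x - (V n).starProjection x ∈ (V n)ᗮ := Submodule.sub_starProjection_mem_orthogonal x
  calc ‖(T ∘L (V n).starProjection - T) x‖ = ‖T (x - (V n).starProjection x)‖ := by
        rw [map_sub, norm_sub_rev]; rfl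
    _ ≤ K / (n + 1) ^ 2 * ‖x - (V n).starProjection x‖ := h n _ hx
    _ ≤ K / (n + 1) ^ 2 * ‖x‖ := by
        refine mul_le_mul_of_nonneg_left ?_ (by positivity)
        rw [← Submodule.starProjection_orthogonal_val]
        exact Submodule.norm_starProjection_apply_le _ _

theorem HasQuadraticApprox.isSchatten [CompleteSpace X] (hX : ¬FiniteDimensional ℂ X)
    {T : X →L[ℂ] X} (h : HasQuadraticApprox T) : IsSchatten 1 T := by
  refine ⟨h.isCompactOperator, ?_⟩
  obtain ⟨K, hK⟩ := h.singularValue_le hX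
  simp only [Real.rpow_one]
  have hs : Summable fun n : ℕ => K / ((n : ℝ) + 1) ^ 2 := by
    have := (summable_nat_add_iff 1).2 (Real.summable_one_div_nat_pow.2 one_lt_two)
    simpa [div_eq_mul_inv] using this.mul_left K
  exact hs.of_nonneg_of_le (singularValue_nonneg T) hK

theorem IsSmooth.comp_left {T : X →L[ℂ] Y} (h : IsSmooth T) (S : Y →L[ℂ] Z) :
    IsSmooth (S ∘L T) := ⟨h.1.comp_left S, h.2.comp_left S⟩

theorem IsSmooth.comp_right [CompleteSpace X] [CompleteSpace Z] {T : X →L[ℂ] Y}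
    (h : IsSmooth T) (S : Z →L[ℂ] X) : IsSmooth (T ∘L S) := ⟨h.1.comp_right S, h.2.comp_right S⟩

theorem IsSmooth.add {T S : X →L[ℂ] Y} (h : IsSmooth T) (h' : IsSmooth S) : IsSmooth (T + S) :=
  ⟨h.1.add h'.1, h.2.add h'.2⟩

theorem IsSmooth.neg {T : X →L[ℂ] Y} (h : IsSmooth T) : IsSmooth (-T) := by
  simpa using h.comp_left (-ContinuousLinearMap.id ℂ Y)

theorem IsSmooth.sub {T S : X →L[ℂ] Y} (h : IsSmooth T) (h' : IsSmooth S) : IsSmooth (T - S) := by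
  simpa only [sub_eq_add_neg] using h.add h'.neg

theorem IsSmooth.adjoint [CompleteSpace X] [CompleteSpace Y] {T : X →L[ℂ] Y} (h : IsSmooth T) :
    IsSmooth (ContinuousLinearMap.adjoint T) := ⟨h.1.adjoint, h.2.adjoint⟩

theorem isSmooth_zero : IsSmooth (0 : X →L[ℂ] Y) := ⟨isNuclear_zero, hasQuadraticApprox_zero⟩

theorem IsSmooth.sum {α : Type*} (s : Finset α) {T : α → X →L[ℂ] Y} (h : ∀ i, IsSmooth (T i)) :
    IsSmooth (∑ i ∈ s, T i) := by
  classical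
  induction s using Finset.induction_on with
  | empty => simpa using isSmooth_zero
  | insert a s ha ih => rw [Finset.sum_insert ha]; exact (h a).add ih

section Basis

variable {ι : Type} (b : HilbertBasis ι ℂ X) {T : X →L[ℂ] Y} {g : ι → ℝ}

theorem isNuclearSum_of_basis (hT : Summable fun i => ‖T (b i)‖) :
    IsNuclearSum (fun i => T (b i)) b T where
  summable := by simpa [b.orthonormal.1] using hT
  hasSum x := by simpa [HilbertBasis.repr_apply_apply] using (b.hasSum_repr x).mapL T

theorem summable_pow_three (hg : Summable g) (h0 : ∀ i, 0 ≤ g i) : Summable fun i => g i ^ 3 := by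
  refine (hg.mul_left ((∑' i, g i) ^ 2)).of_nonneg_of_le (fun i => pow_nonneg (h0 i) 3) fun i => ?_
  have h1 : g i ≤ ∑' i, g i := hg.le_tsum i fun j _ => h0 j
  have := pow_le_pow_left₀ (h0 i) h1 2
  nlinarith [h0 i]

/-- The cube splits as `g · g²`: one factor keeps the sum over the basis finite, the other two give
the rate `n⁻²`. -/
theorem isSmooth_of_basis (hg : Summable g) (h0 : ∀ i, 0 ≤ g i) (hT : ∀ i, ‖T (b i)‖ ≤ g i ^ 3) :
    IsSmooth T := by
  have hT' : Summable fun i => ‖T (b i)‖ :=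
    (summable_pow_three hg h0).of_nonneg_of_le (fun i => norm_nonneg _) hT
  refine ⟨⟨ι, _, _, isNuclearSum_of_basis b hT'⟩, ?_⟩
  set S : ℝ := ∑' i, g i + 1 with hS
  have hS0 : 0 < S := by have : 0 ≤ ∑' i, g i := tsum_nonneg h0; positivity
  refine ⟨S ^ 3, by positivity, fun n => ?_⟩
  -- Since `∑ g < S`, at most `n` indices satisfy `g i ≥ τ`. The span of those basis vectors is the
  -- approximating subspace; outside it `g i ^ 3 ≤ g i * τ ^ 2`, and `S τ² = S³ / (n + 1)²`.
  set τ : ℝ := S / (n + 1) with hτ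
  have hτ0 : 0 < τ := by positivity
  have hfin : {i | τ ≤ g i}.Finite := by
    have := hg.tendsto_cofinite_zero.eventually_lt_const hτ0
    simpa [Filter.eventually_cofinite] using this
  set s := hfin.toFinset with hs
  have hmem : ∀ i, i ∉ s → g i < τ := fun i hi => by simpa [hs] using hi
  have hcard : s.card ≤ n := by
    by_contra! hlt
    have h1 : s.card • τ ≤ ∑ i ∈ s, g i :=
      Finset.card_nsmul_le_sum _ _ _ fun i hi => by simpa [hs] using hi
    have h2 : ∑ i ∈ s, g i ≤ ∑' i, g i := hg.sum_le_tsum s fun i _ => h0 i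
    have h3 : ((n : ℝ) + 1) * τ = S := by rw [hτ]; field_simp
    have h4 : ((n : ℝ) + 1) * τ ≤ s.card * τ :=
      mul_le_mul_of_nonneg_right (by exact_mod_cast hlt) hτ0.le
    rw [nsmul_eq_mul] at h1
    linarith
  refine ⟨Submodule.span ℂ (b '' s), FiniteDimensional.span_of_finite ℂ (s.finite_toSet.image _),
    ?_, fun x hx => ?_⟩
  · classical
    rw [← Finset.coe_image]
    exact (finrank_span_finset_le_card _).trans (Finset.card_image_le.trans hcard)
  · have hx0 : ∀ i ∈ s, ⟪b i, x⟫_ℂ = 0 := fun i hi =>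
      (Submodule.mem_orthogonal _ _).1 hx _ (Submodule.subset_span ⟨i, hi, rfl⟩)
    have hsum := (isNuclearSum_of_basis b hT').hasSum x
    have hle : ∀ i, ‖⟪b i, x⟫_ℂ • T (b i)‖ ≤ g i * (τ ^ 2 * ‖x‖) := by
      intro i
      by_cases hi : i ∈ s
      · rw [hx0 i hi, zero_smul, norm_zero]
        exact mul_nonneg (h0 i) (by positivity)
      · rw [norm_smul]
        have h1 : ‖⟪b i, x⟫_ℂ‖ ≤ ‖x‖ := by
          simpa [b.orthonormal.1] using norm_inner_le_norm (𝕜 := ℂ) (b i) x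
        have h2 : g i ^ 2 ≤ τ ^ 2 := pow_le_pow_left₀ (h0 i) (hmem i hi).le 2
        calc ‖⟪b i, x⟫_ℂ‖ * ‖T (b i)‖ ≤ ‖x‖ * g i ^ 3 :=
              mul_le_mul h1 (hT i) (norm_nonneg _) (norm_nonneg _)
          _ = g i * (g i ^ 2 * ‖x‖) := by ring
          _ ≤ g i * (τ ^ 2 * ‖x‖) := mul_le_mul_of_nonneg_left
              (mul_le_mul_of_nonneg_right h2 (norm_nonneg _)) (h0 i)
    have hb := hg.mul_right (τ ^ 2 * ‖x‖)
    rw [← hsum.tsum_eq]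
    refine (tsum_of_norm_bounded hb.hasSum hle).trans ?_
    rw [tsum_mul_right]
    calc (∑' i, g i) * (τ ^ 2 * ‖x‖) ≤ S * (τ ^ 2 * ‖x‖) :=
          mul_le_mul_of_nonneg_right (by rw [hS]; linarith) (by positivity)
      _ = S ^ 3 / (n + 1) ^ 2 * ‖x‖ := by rw [hτ, div_pow]; ring

end Basis

end Approx
end

/-! ### Fredholm index as a difference of traces -/

noncomputable section

section IndexTheorem

open LinearMap.FiniteRangeSetoid

variable {X Y : Type} [NormedAddCommGroup X] [InnerProductSpace ℂ X] [CompleteSpace X]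
  [NormedAddCommGroup Y] [InnerProductSpace ℂ Y] [CompleteSpace Y]

/-- A finite partial sum of the nuclear series is taken, with the tail of norms below `1/2`. -/
theorem IsNuclear.exists_finiteRange_sub {T : X →L[ℂ] X} (h : IsNuclear T) :
    ∃ f : X →L[ℂ] X, (f : X →ₗ[ℂ] X).HasFiniteRange ∧ ‖T - f‖ < 1 := by
  obtain ⟨ι, u, w, h⟩ := h
  have hlim := tendsto_tsum_compl_atTop_zero fun i => ‖u i‖ * ‖w i‖
  obtain ⟨s, hs⟩ := (hlim.eventually_lt_const (show (0 : ℝ) < 1 / 2 by norm_num)).exists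
  refine ⟨∑ i ∈ s, (innerSL ℂ (w i)).smulRight (u i), ?_, ?_⟩
  · classical
    rw [LinearMap.hasFiniteRange_iff_range]
    have hle : ((∑ i ∈ s, (innerSL ℂ (w i)).smulRight (u i) : X →L[ℂ] X) : X →ₗ[ℂ] X).range
        ≤ Submodule.span ℂ (s.image u : Set X) := by
      rintro _ ⟨x, rfl⟩
      have : (∑ i ∈ s, (innerSL ℂ (w i)).smulRight (u i) : X →L[ℂ] X) x
          ∈ Submodule.span ℂ (s.image u : Set X) := by
        rw [sum_apply]
        refine Submodule.sum_mem _ fun i hi => Submodule.smul_mem _ _ (Submodule.subset_span ?_)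
        simpa using ⟨i, hi, rfl⟩
      exact this
    have : FiniteDimensional ℂ (Submodule.span ℂ (s.image u : Set X)) :=
      FiniteDimensional.span_finset ℂ _
    have := Submodule.finiteDimensional_of_le hle
    exact (Submodule.fg_iff_finiteDimensional _).2 this
  · refine (ContinuousLinearMap.opNorm_le_bound _ (show (0 : ℝ) ≤ 1 / 2 by norm_num)
      fun x => ?_).trans_lt (by norm_num)
    have hx := h.hasSum x
    have hx' := hx.summable.sum_add_tsum_subtype_compl s
    rw [hx.tsum_eq] at hx'
    have : (T - ∑ i ∈ s, (innerSL ℂ (w i)).smulRight (u i)) x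
        = ∑' i : {i // i ∉ s}, ⟪w i, x⟫_ℂ • u i := by
      rw [sub_apply, sum_apply, ← hx']
      simp
    rw [this]
    have hb := ((h.summable.subtype (fun i => i ∉ s)).mul_right ‖x‖).hasSum
    refine (tsum_of_norm_bounded hb fun i => ?_).trans ?_
    · rw [norm_smul, mul_comm]
      calc ‖u i‖ * ‖⟪w i, x⟫_ℂ‖ ≤ ‖u i‖ * (‖w i‖ * ‖x‖) :=
            mul_le_mul_of_nonneg_left (norm_inner_le_norm _ _) (norm_nonneg _)
        _ = _ := by simp [mul_assoc]
    · rw [tsum_mul_right]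
      exact mul_le_mul_of_nonneg_right hs.le (norm_nonneg _)

/-- With `1 - ST = N` and `‖N - f‖ < 1` for some `f` of finite rank, `U = 1 - (N - f) = ST + f` is
invertible, and `U⁻¹ST = 1 - U⁻¹f`. -/
theorem exists_isLeftQuasiInverse {T : X →L[ℂ] Y} {S : Y →L[ℂ] X}
    (h : IsNuclear (1 - S ∘L T)) : ∃ L : Y →L[ℂ] X, (L : Y →ₗ[ℂ] X).IsLeftQuasiInverse T := by
  obtain ⟨f, hf, hlt⟩ := h.exists_finiteRange_sub
  set U := Units.oneSub _ hlt with hU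
  have hU' : (U : X →L[ℂ] X) = S ∘L T + f := by rw [hU, Units.val_oneSub]; abel
  refine ⟨(↑U⁻¹ : X →L[ℂ] X) ∘L S, ?_⟩
  rw [LinearMap.IsLeftQuasiInverse, Setoid.comm, equiv_iff_hasFiniteRange]
  have : (LinearMap.id - (((↑U⁻¹ : X →L[ℂ] X) ∘L S : Y →L[ℂ] X) : Y →ₗ[ℂ] X) ∘ₗ (T : X →ₗ[ℂ] Y))
      = ((↑U⁻¹ : X →L[ℂ] X) : X →ₗ[ℂ] X) ∘ₗ (f : X →ₗ[ℂ] X) := by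
    ext x
    have h1 : (↑U⁻¹ : X →L[ℂ] X) ((U : X →L[ℂ] X) x) = x := by
      rw [← mul_apply_eq_comp, U.inv_mul, one_apply_eq_self]
    rw [hU', add_apply, map_add] at h1
    simp only [LinearMap.sub_apply, LinearMap.id_apply, LinearMap.comp_apply,
      ContinuousLinearMap.coe_coe, ContinuousLinearMap.comp_apply] at h1 ⊢
    rw [sub_eq_iff_eq_add', h1]
  rw [this]
  exact hf.comp_left _

theorem exists_isRightQuasiInverse {T : X →L[ℂ] Y} {S : Y →L[ℂ] X}
    (h : IsNuclear (1 - T ∘L S)) : ∃ R : Y →L[ℂ] X, (R : Y →ₗ[ℂ] X).IsRightQuasiInverse T := by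
  obtain ⟨f, hf, hlt⟩ := h.exists_finiteRange_sub
  set U := Units.oneSub _ hlt with hU
  have hU' : (U : Y →L[ℂ] Y) = T ∘L S + f := by rw [hU, Units.val_oneSub]; abel
  refine ⟨S ∘L (↑U⁻¹ : Y →L[ℂ] Y), ?_⟩
  rw [LinearMap.IsRightQuasiInverse, Setoid.comm, equiv_iff_hasFiniteRange]
  have : (LinearMap.id - (T : X →ₗ[ℂ] Y) ∘ₗ ((S ∘L (↑U⁻¹ : Y →L[ℂ] Y) : Y →L[ℂ] X) : Y →ₗ[ℂ] X))
      = (f : Y →ₗ[ℂ] Y) ∘ₗ ((↑U⁻¹ : Y →L[ℂ] Y) : Y →ₗ[ℂ] Y) := by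
    ext x
    have h1 : (U : Y →L[ℂ] Y) ((↑U⁻¹ : Y →L[ℂ] Y) x) = x := by
      rw [← mul_apply_eq_comp, U.mul_inv, one_apply_eq_self]
    rw [hU', add_apply] at h1
    simp only [LinearMap.sub_apply, LinearMap.id_apply, LinearMap.comp_apply,
      ContinuousLinearMap.coe_coe, ContinuousLinearMap.comp_apply] at h1 ⊢
    rw [sub_eq_iff_eq_add', h1]
  rw [this]
  exact hf.comp_right _

theorem isFredholm_of_isNuclear {T : X →L[ℂ] Y} {S : Y →L[ℂ] X}
    (h1 : IsNuclear (1 - S ∘L T)) (h2 : IsNuclear (1 - T ∘L S)) : T.IsFredholm := by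
  obtain ⟨L, hL⟩ := exists_isLeftQuasiInverse h1
  obtain ⟨R, hR⟩ := exists_isRightQuasiInverse h2
  refine .of_isQuasiInverse (v := R) ⟨hL.congr ?_ (Setoid.refl _), hR⟩
  -- Left and right inverses modulo finite rank agree: `R ≈ LTR ≈ L`.
  calc (R : Y →ₗ[ℂ] X) = LinearMap.id ∘ₗ (R : Y →ₗ[ℂ] X) := by simp
    _ ≈ ((L : Y →ₗ[ℂ] X) ∘ₗ (T : X →ₗ[ℂ] Y)) ∘ₗ (R : Y →ₗ[ℂ] X) := by grw [hL.equiv]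
    _ = (L : Y →ₗ[ℂ] X) ∘ₗ ((T : X →ₗ[ℂ] Y) ∘ₗ (R : Y →ₗ[ℂ] X)) := by rw [LinearMap.comp_assoc]
    _ ≈ (L : Y →ₗ[ℂ] X) ∘ₗ LinearMap.id := by grw [hR.equiv]
    _ = L := by simp

/-- The trace of an idempotent of finite rank is its rank. -/
theorem hasNuclearTrace_of_projection {V : Submodule ℂ X} [FiniteDimensional ℂ V] {P : X →L[ℂ] X}
    (hr : ∀ x, P x ∈ V) (hV : ∀ x ∈ V, P x = x) :
    HasNuclearTrace P (Module.finrank ℂ V) := by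
  set b := stdOrthonormalBasis ℂ V
  refine ⟨Fin (Module.finrank ℂ V), fun i => b i, fun i => ContinuousLinearMap.adjoint P (b i),
    ⟨Summable.of_finite, fun x => ?_⟩, ?_⟩
  · have h := congrArg V.subtype (b.sum_repr' ⟨P x, hr x⟩)
    simp only [map_sum, map_smul, Submodule.coe_inner, Submodule.subtype_apply] at h
    rw [← h]
    convert hasSum_fintype _ using 2
    rw [ContinuousLinearMap.adjoint_inner_left]
  · have : ∀ i, ⟪ContinuousLinearMap.adjoint P (b i : X), (b i : X)⟫_ℂ = 1 := by
      intro i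
      rw [ContinuousLinearMap.adjoint_inner_left, hV _ (b i).2, ← Submodule.coe_inner,
        inner_self_eq_norm_sq_to_K, b.orthonormal.1 i]
      simp
    simp only [this]
    simpa using hasSum_fintype fun _ : Fin (Module.finrank ℂ V) => (1 : ℂ)

theorem FredholmDecomposition.hasNuclearTrace (d : FredholmDecomposition ℂ X) :
    HasNuclearTrace (1 - d.X₁.subtypeL ∘L d.proj) (Module.finrank ℂ d.X₀) := by
  have := d.finite_X₀
  refine hasNuclearTrace_of_projection (fun x => ?_) fun x hx => ?_
  · have := Submodule.projection_add_projection_eq_self d.isTopCompl.isCompl x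
    have h : (1 - d.X₁.subtypeL ∘L d.proj) x = d.X₀.projection d.X₁ d.isTopCompl.isCompl.symm x := by
      rw [sub_apply, one_apply_eq_self, sub_eq_iff_eq_add']
      exact this.symm
    rw [h]
    exact Submodule.projection_apply_mem _ _
  · have : d.proj x = 0 := by
      simp [hx]
    simp [this]

/-- The index of an operator with a parametrix modulo trace class operators. -/
theorem fredholmIndex_eq_trace_sub {T : X →L[ℂ] Y} {S : Y →L[ℂ] X} {t₁ t₂ : ℂ}
    (h1 : HasNuclearTrace (1 - S ∘L T) t₁) (h2 : HasNuclearTrace (1 - T ∘L S) t₂) :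
    T.IsFredholm ∧ (fredholmIndex T : ℂ) = t₁ - t₂ := by
  have hT := isFredholm_of_isNuclear h1.isNuclear h2.isNuclear
  refine ⟨hT, ?_⟩
  obtain ⟨d⟩ := hT.nonempty_fredholmPackage
  set S₀ := d.quasiInverse
  have hST : S₀ ∘L T = d.decDom.X₁.subtypeL ∘L d.decDom.proj := by
    ext x
    have : T x = d.decCodom.X₁.subtypeL (d.equiv (d.decDom.proj x)) := by
      conv_lhs => rw [d.eq_equiv]
      rfl
    simp [S₀, ContinuousLinearMap.FredholmPackage.quasiInverse, this]
  have hTS : T ∘L S₀ = d.decCodom.X₁.subtypeL ∘L d.decCodom.proj := by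
    ext x
    have : ∀ x, T x = d.decCodom.X₁.subtypeL (d.equiv (d.decDom.proj x)) := fun x => by
      conv_lhs => rw [d.eq_equiv]
      rfl
    simp [S₀, ContinuousLinearMap.FredholmPackage.quasiInverse, this]
  have hP := d.decDom.hasNuclearTrace
  have hQ := d.decCodom.hasNuclearTrace
  rw [← hST] at hP
  rw [← hTS] at hQ
  -- With `S₀` the inverse of `T` modulo finite rank projections, `S - S₀ = S(1 - TS₀) - (1 -
  -- ST)S₀`. The projections have the kernel and cokernel dimensions as traces; replacing `S₀` by
  -- `S` changes both error traces by the same amount, by cyclicity.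
  have hN : IsNuclear (S - S₀) := by
    have := (hQ.isNuclear.comp_left S).sub (h1.isNuclear.comp_right S₀)
    convert this using 1
    ext x
    simp
  obtain ⟨t, ht1, ht2⟩ := hN.exists_trace_comm T
  have e1 : t₁ = Module.finrank ℂ d.decDom.X₀ - t := by
    refine h1.unique ?_
    convert hP.sub ht2 using 1
    ext x
    simp
  have e2 : t₂ = Module.finrank ℂ d.decCodom.X₀ - t := by
    refine h2.unique ?_
    convert hQ.sub ht1 using 1
    ext x
    simp
  have e3 : Module.finrank ℂ (Y ⧸ T.range) = Module.finrank ℂ d.decCodom.X₀ := by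
    rw [d.range_eq]
    exact (Submodule.quotientEquivOfIsCompl _ _ d.decCodom.isTopCompl.isCompl).finrank_eq
  rw [fredholmIndex, e3, d.ker_eq, e1, e2]
  push_cast
  ring

end IndexTheorem
end

/-! ### The index formula for a graded involution -/

noncomputable section

section GradedIndex

variable {K : Type} [NormedAddCommGroup K] [InnerProductSpace ℂ K] [CompleteSpace K]

/-- Conjugation by an involution preserves the trace, by cyclicity applied to `F T` and `F`. -/
theorem HasNuclearTrace.conj {F T : K →L[ℂ] K} {t : ℂ} (hF : F * F = 1)
    (h : HasNuclearTrace T t) : HasNuclearTrace (F * T * F) t := by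
  obtain ⟨s, h1, h2⟩ := (h.isNuclear.comp_left F).exists_trace_comm F
  have : F ∘L F ∘L T = T := by
    rw [← ContinuousLinearMap.comp_assoc]
    change F * F * T = T
    rw [hF, one_mul]
  rw [this] at h1
  rw [h.unique h1]
  exact h2

/-- The trace identity behind the index formula of an even Fredholm module. -/
theorem exists_graded_trace {E F G : K →L[ℂ] K} {τ : ℂ} (hE : E * E = E) (hEG : G * E = E * G)
    (hF : F * F = 1) (hGF : G * F = -(F * G))
    (hB : IsNuclear (E - F * E * F)) (hτ : HasNuclearTrace (G * (E - F * E * F)) τ) :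
    HasNuclearTrace ((E - F * E * F) * (E * G)) (1 / 2 * τ) := by
  set C := F * E * F with hC
  set B := E - C with hBdef
  have hCC : C * C = C := by
    calc C * C = F * E * (F * F) * E * F := by simp only [hC, mul_assoc]
      _ = F * (E * E) * F := by rw [hF]; simp only [mul_assoc, mul_one]
      _ = C := by rw [hE]
  have hFG : F * G = -(G * F) := by rw [hGF, neg_neg]
  have hGC : G * C = C * G := by
    calc G * C = G * F * E * F := by simp only [hC, mul_assoc]
      _ = -(F * (G * E) * F) := by rw [hGF]; simp only [mul_assoc, neg_mul]
      _ = F * E * -(G * F) := by rw [hEG]; simp only [mul_assoc, mul_neg]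
      _ = C * G := by rw [← hFG]; simp only [hC, mul_assoc]
  have hGB : G * B = B * G := by rw [hBdef, mul_sub, sub_mul, hEG, hGC]
  obtain ⟨t, ht⟩ := (hB.comp_right (E * G)).exists_trace
  -- Conjugation by `F` exchanges `E` and `C = FEF` and changes the sign of both `B = E - C` and
  -- `G`, so `B E G` goes to `B C G`.
  have ht1 : HasNuclearTrace (B * (C * G)) t := by
    have h := HasNuclearTrace.conj hF ht
    have e : F * (B * (E * G)) * F = B * (C * G) := by
      have hFBF : F * B = (C - E) * F := by
        rw [hBdef, mul_sub, sub_mul, hC, mul_assoc (F * E), hF, mul_one]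
        simp only [← mul_assoc, hF, one_mul]
      calc F * (B * (E * G)) * F = (F * B) * E * (G * F) := by simp only [mul_assoc]
        _ = -((C - E) * (F * E * F) * G) := by rw [hFBF, hGF]; simp only [mul_assoc, mul_neg]
        _ = B * (C * G) := by rw [← hC, hBdef]; noncomm_ring
    exact e ▸ h
  have ht2 : HasNuclearTrace (E * (B * G)) t := by
    obtain ⟨s, h1, h2⟩ := hB.exists_trace_comm (E * G)
    have h3 : HasNuclearTrace (B * (E * G)) s := h2
    rw [ht.unique h3]
    have : E * (B * G) = (E * G) * B := by rw [← hGB, mul_assoc]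
    rw [this]
    exact h1
  -- For two idempotents `B = BE + BC - (BE - EB)`. After multiplication by `G`, the first two terms
  -- both have trace `t`, and the bracket has trace zero.
  have key : G * B = B * (E * G) + B * (C * G) - (B * (E * G) - E * (B * G)) := by
    rw [hGB, hBdef]
    simp only [sub_mul, mul_sub, ← mul_assoc, hE, hCC]
    abel
  have h5 := (ht.add ht1).sub (ht.sub ht2)
  have h6 : τ = t + t - (t - t) := hτ.unique (key ▸ h5)
  have h7 : 1 / 2 * τ = t := by rw [h6]; ring
  rw [h7]
  exact ht

/-- The index formula `Index (F_E⁺) = ½ Tr (γ F [F, E])`. -/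
theorem fredholmIndex_graded {E F G : K →L[ℂ] K} {τ : ℂ} (hE : E * E = E) (hEG : G * E = E * G)
    (hF : F * F = 1) (hG : G * G = 1) (hGF : G * F = -(F * G))
    (hB : IsNuclear (E - F * E * F)) (hτ : HasNuclearTrace (G * (E - F * E * F)) τ)
    {V W : Submodule ℂ K} (hV : V = (E * (1 + G)).range) (hW : W = ((1 - G) * E).range)
    {T : V →L[ℂ] W}
    (hT : ∀ v, (T v : K) = ((1 / 4 : ℂ) • ((1 - G) * E * F * E * (1 + G))) v) :
    T.IsFredholm ∧ (fredholmIndex T : ℂ) = 1 / 2 * τ := by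
  -- `p` and `r` are the idempotents onto the even and the odd corner, and `T` is the corner `r F
  -- p`. The parametrix is the opposite corner `p F r`; its errors are `p B p` and `r B r`.
  set p : K →L[ℂ] K := (1 / 2 : ℂ) • (E * (1 + G)) with hp
  set r : K →L[ℂ] K := (1 / 2 : ℂ) • ((1 - G) * E) with hr
  have hE' : ∀ x, E * (E * x) = E * x := fun x => by rw [← mul_assoc, hE]
  have hG' : ∀ x, G * (G * x) = x := fun x => by rw [← mul_assoc, hG, one_mul]
  have hEG' : ∀ x, G * (E * x) = E * (G * x) := fun x => by rw [← mul_assoc, hEG, mul_assoc]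
  have hGF' : ∀ x, G * (F * x) = -(F * (G * x)) := fun x => by
    rw [← mul_assoc, hGF, neg_mul, mul_assoc]
  have hF' : ∀ x, F * (F * x) = x := fun x => by rw [← mul_assoc, hF, one_mul]
  have hpp : p * p = p := by
    simp only [hp, smul_mul_smul_comm, mul_assoc, mul_add, add_mul, mul_one, hE, hG, hEG,
      hE', hEG']
    module
  have hrr : r * r = r := by
    simp only [hr, smul_mul_smul_comm, mul_assoc, mul_sub, sub_mul, mul_one, one_mul, hE, hG, hEG,
      hE', hEG']
    module
  have hp_sub_r : p - r = E * G := by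
    simp only [hp, hr, mul_add, sub_mul, mul_one, one_mul, hEG]
    module
  set B := E - F * E * F with hBdef
  have hpB : p * B * p = p - p * F * (r * F * p) := by
    simp only [hBdef, hp, hr, smul_mul_assoc, mul_smul_comm, mul_assoc, mul_add, add_mul, sub_mul,
      mul_sub, mul_neg, neg_mul, mul_one, one_mul, hE, hG, hEG, hE', hEG', hGF, hGF', neg_neg]
    module
  have hrB : r * B * r = r - r * F * (p * F * r) := by
    simp only [hBdef, hp, hr, smul_mul_assoc, mul_smul_comm, mul_assoc, mul_add, add_mul, sub_mul,
      mul_sub, mul_neg, neg_mul, mul_one, one_mul, hE, hG, hEG, hE', hEG', hGF, hGF', neg_neg]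
    module
  have hT' : ∀ v, (T v : K) = r (F (p v)) := fun v => by
    rw [hT]
    have : (1 / 4 : ℂ) • ((1 - G) * E * F * E * (1 + G)) = r * F * p := by
      simp only [hp, hr, smul_mul_assoc, mul_smul_comm, smul_smul, mul_assoc]
      norm_num
    rw [this]
    rfl
  have hpV : ∀ x, p x ∈ V := fun x => by
    rw [hV]; exact Submodule.smul_mem _ _ ⟨x, rfl⟩
  have hrW : ∀ x, r x ∈ W := fun x => by
    rw [hW]; exact Submodule.smul_mem _ _ ⟨x, rfl⟩
  have hVp : ∀ v ∈ V, p v = v := fun v hv => by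
    rw [hV] at hv
    obtain ⟨x, rfl⟩ := hv
    have h2 : E * (1 + G) = (2 : ℂ) • p := by rw [hp, smul_smul]; norm_num
    rw [h2]
    change (p * (2 : ℂ) • p) x = ((2 : ℂ) • p) x
    rw [mul_smul_comm, hpp]
  have hWr : ∀ v ∈ W, r v = v := fun v hv => by
    rw [hW] at hv
    obtain ⟨x, rfl⟩ := hv
    have h2 : (1 - G) * E = (2 : ℂ) • r := by rw [hr, smul_smul]; norm_num
    rw [h2]
    change (r * (2 : ℂ) • r) x = ((2 : ℂ) • r) x
    rw [mul_smul_comm, hrr]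
  have : CompleteSpace V := by
    have : (V : Set K) = {x | p x = x} := Set.ext fun x => ⟨hVp x, fun h => h ▸ hpV x⟩
    exact (this ▸ isClosed_eq p.continuous continuous_id : IsClosed (V : Set K)).completeSpace_coe
  have : CompleteSpace W := by
    have : (W : Set K) = {x | r x = x} := Set.ext fun x => ⟨hWr x, fun h => h ▸ hrW x⟩
    exact (this ▸ isClosed_eq r.continuous continuous_id : IsClosed (W : Set K)).completeSpace_coe
  obtain ⟨S, hS⟩ : ∃ S : W →L[ℂ] V, ∀ w, (S w : K) = p (F w) :=
    ⟨((p * F) ∘L W.subtypeL).codRestrict V fun x => hpV _, fun _ => rfl⟩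
  -- By cyclicity the trace of the error on `V` is that of `B p` on the whole space, and likewise
  -- for `W`. Their difference is the trace of `B (p - r) = B E G`.
  obtain ⟨t₁, h1, h1'⟩ := (hB.comp_right V.subtypeL).exists_trace_comm (p.codRestrict V hpV)
  obtain ⟨t₂, h2, h2'⟩ := (hB.comp_right W.subtypeL).exists_trace_comm (r.codRestrict W hrW)
  have e1 : p.codRestrict V hpV ∘L B ∘L V.subtypeL = 1 - S ∘L T := by
    ext v
    have := congrArg (fun A : K →L[ℂ] K => A v) hpB
    simp only [mul_apply_eq_comp, sub_apply, hVp v v.2] at this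
    simpa [hS, hT', hVp v v.2] using this
  have e2 : r.codRestrict W hrW ∘L B ∘L W.subtypeL = 1 - T ∘L S := by
    ext v
    have := congrArg (fun A : K →L[ℂ] K => A v) hrB
    simp only [mul_apply_eq_comp, sub_apply, hWr v v.2] at this
    have h3 : ∀ y, p (p y) = p y := fun y => hVp _ (hpV y)
    simpa [hS, hT', h3, hWr v v.2] using this
  rw [e1] at h1
  rw [e2] at h2
  obtain ⟨hT1, hT2⟩ := fredholmIndex_eq_trace_sub h1 h2
  refine ⟨hT1, hT2.trans ?_⟩
  refine HasNuclearTrace.unique ?_ (exists_graded_trace hE hEG hF hGF hB hτ)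
  convert h1'.sub h2' using 1
  rw [← hp_sub_r, mul_sub]
  rfl

end GradedIndex
end

/-! ### Amplifications, direct sums, and the pairing for two representations -/

noncomputable section

section Block

variable {H : Type} [NormedAddCommGroup H] [InnerProductSpace ℂ H] {N : ℕ}

theorem blockOp_apply (M : Matrix (Fin N) (Fin N) (H →L[ℂ] H)) (v : Amplified H N) (i : Fin N) :
    blockOp M v i = ∑ j, M i j (v j) := by
  simp [blockOp]

theorem blockOp_mul (M M' : Matrix (Fin N) (Fin N) (H →L[ℂ] H)) :
    blockOp (M * M') = blockOp M * blockOp M' := by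
  ext v i
  simp only [mul_apply_eq_comp, blockOp_apply, Matrix.mul_apply, sum_apply, map_sum]
  exact Finset.sum_comm

theorem blockOp_one : blockOp (1 : Matrix (Fin N) (Fin N) (H →L[ℂ] H)) = 1 := by
  ext v i
  simp [blockOp_apply, Matrix.one_apply, ite_apply, apply_ite]

theorem blockOp_sub (M M' : Matrix (Fin N) (Fin N) (H →L[ℂ] H)) :
    blockOp (M - M') = blockOp M - blockOp M' := by
  ext v i
  simp [blockOp_apply]

theorem blockOp_neg (M : Matrix (Fin N) (Fin N) (H →L[ℂ] H)) :
    blockOp (-M) = -blockOp M := by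
  ext v i
  simp [blockOp_apply]

/-- The inclusion of the `i`-th summand. -/
def ampIncl (H : Type) [NormedAddCommGroup H] [InnerProductSpace ℂ H] {N : ℕ} (i : Fin N) :
    H →L[ℂ] Amplified H N :=
  (PiLp.continuousLinearEquiv 2 ℂ (fun _ : Fin N => H)).symm.toContinuousLinearMap ∘L
    ContinuousLinearMap.single ℂ (fun _ : Fin N => H) i

/-- The projection to the `i`-th summand. -/
def ampProj (H : Type) [NormedAddCommGroup H] [InnerProductSpace ℂ H] {N : ℕ} (i : Fin N) :
    Amplified H N →L[ℂ] H :=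
  ContinuousLinearMap.proj i ∘L
    (PiLp.continuousLinearEquiv 2 ℂ (fun _ : Fin N => H)).toContinuousLinearMap

theorem ampIncl_apply (i j : Fin N) (x : H) : ampIncl H i x j = if j = i then x else 0 := by
  simp [ampIncl]

theorem ampProj_apply (i : Fin N) (v : Amplified H N) : ampProj H i v = v i := rfl

theorem blockOp_eq_sum (M : Matrix (Fin N) (Fin N) (H →L[ℂ] H)) :
    blockOp M = ∑ i, ∑ j, ampIncl H i ∘L M i j ∘L ampProj H j := by
  ext v i
  simp [blockOp_apply, sum_apply, ampIncl_apply, ampProj_apply]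

variable [CompleteSpace H]

theorem isSmooth_blockOp {M : Matrix (Fin N) (Fin N) (H →L[ℂ] H)} (h : ∀ i j, IsSmooth (M i j)) :
    IsSmooth (blockOp M) := by
  rw [blockOp_eq_sum]
  exact IsSmooth.sum _ fun i => IsSmooth.sum _ fun j => ((h i j).comp_right _).comp_left _

/-- By cyclicity the block in position `(i, j)` contributes the trace of `M i j` composed with a
projection after an inclusion, which is zero off the diagonal. -/
theorem hasNuclearTrace_blockOp {M : Matrix (Fin N) (Fin N) (H →L[ℂ] H)} {t : Fin N → ℂ}
    (h : ∀ i j, IsNuclear (M i j)) (ht : ∀ i, HasNuclearTrace (M i i) (t i)) :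
    HasNuclearTrace (blockOp M) (∑ i, t i) := by
  have key : ∀ i j, HasNuclearTrace (ampIncl H i ∘L M i j ∘L ampProj H j)
      (if i = j then t i else 0) := by
    intro i j
    obtain ⟨s, h1, h2⟩ := ((h i j).comp_right (ampProj H j)).exists_trace_comm (ampIncl H i)
    have e : (M i j ∘L ampProj H j) ∘L ampIncl H i = if i = j then M i j else 0 := by
      ext x
      by_cases hij : i = j
      · simp [ampProj_apply, ampIncl_apply, hij]
      · simp [ampProj_apply, ampIncl_apply, hij, Ne.symm hij]
    rw [e] at h2
    convert h1 using 1
    split_ifs at h2 ⊢ with hij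
    · subst hij
      exact (ht i).unique h2
    · exact hasNuclearTrace_zero.unique h2
  rw [blockOp_eq_sum]
  convert HasNuclearTrace.sum Finset.univ fun i =>
    HasNuclearTrace.sum Finset.univ fun j => key i j using 1
  simp

end Block

section DirectSumModule

variable {E : Type} [NormedAddCommGroup E] [InnerProductSpace ℂ E]

/-- The first inclusion into `E ⊕ E`. -/
def inclFst (E : Type) [NormedAddCommGroup E] [InnerProductSpace ℂ E] :
    E →L[ℂ] WithLp 2 (E × E) :=
  (WithLp.prodContinuousLinearEquiv 2 ℂ E E).symm.toContinuousLinearMap ∘L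
    ContinuousLinearMap.inl ℂ E E

/-- The second inclusion into `E ⊕ E`. -/
def inclSnd (E : Type) [NormedAddCommGroup E] [InnerProductSpace ℂ E] :
    E →L[ℂ] WithLp 2 (E × E) :=
  (WithLp.prodContinuousLinearEquiv 2 ℂ E E).symm.toContinuousLinearMap ∘L
    ContinuousLinearMap.inr ℂ E E

/-- The first projection of `E ⊕ E`. -/
def projFst (E : Type) [NormedAddCommGroup E] [InnerProductSpace ℂ E] :
    WithLp 2 (E × E) →L[ℂ] E :=
  ContinuousLinearMap.fst ℂ E E ∘L
    (WithLp.prodContinuousLinearEquiv 2 ℂ E E).toContinuousLinearMap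

/-- The second projection of `E ⊕ E`. -/
def projSnd (E : Type) [NormedAddCommGroup E] [InnerProductSpace ℂ E] :
    WithLp 2 (E × E) →L[ℂ] E :=
  ContinuousLinearMap.snd ℂ E E ∘L
    (WithLp.prodContinuousLinearEquiv 2 ℂ E E).toContinuousLinearMap

theorem clm_prod_ext {X : Type*} [AddCommMonoid X] [Module ℂ X] [TopologicalSpace X]
    {S T : X →L[ℂ] WithLp 2 (E × E)} (h : ∀ v, (S v).fst = (T v).fst)
    (h' : ∀ v, (S v).snd = (T v).snd) : S = T :=
  ContinuousLinearMap.ext fun v => WithLp.ofLp_injective 2 (Prod.ext (h v) (h' v))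

theorem inclFst_apply (x : E) : inclFst E x = WithLp.toLp 2 (x, 0) := rfl
theorem inclSnd_apply (x : E) : inclSnd E x = WithLp.toLp 2 (0, x) := rfl
theorem projFst_apply (v : WithLp 2 (E × E)) : projFst E v = v.fst := rfl
theorem projSnd_apply (v : WithLp 2 (E × E)) : projSnd E v = v.snd := rfl
theorem flipOp_apply (v : WithLp 2 (E × E)) : flipOp E v = WithLp.toLp 2 (v.snd, v.fst) := rfl

theorem diagOp_eq (S T : E →L[ℂ] E) :
    diagOp S T = inclFst E ∘L S ∘L projFst E + inclSnd E ∘L T ∘L projSnd E := by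
  refine clm_prod_ext (fun v => ?_) (fun v => ?_) <;> simp [diagOp_apply, inclFst_apply, inclSnd_apply, projFst_apply, projSnd_apply]

theorem flipOp_mul_self : flipOp E * flipOp E = 1 := by
  refine clm_prod_ext (fun v => ?_) (fun v => ?_) <;> simp [flipOp_apply]

theorem gradingOp_mul_self : gradingOp E * gradingOp E = 1 := by
  refine clm_prod_ext (fun v => ?_) (fun v => ?_) <;> simp [gradingOp, diagOp_apply]

theorem gradingOp_mul_flipOp : gradingOp E * flipOp E = -(flipOp E * gradingOp E) := by
  refine clm_prod_ext (fun v => ?_) (fun v => ?_) <;> simp [gradingOp, diagOp_apply, flipOp_apply]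

theorem gradingOp_mul_diagOp (S T : E →L[ℂ] E) :
    gradingOp E * diagOp S T = diagOp S T * gradingOp E := by
  refine clm_prod_ext (fun v => ?_) (fun v => ?_) <;> simp [gradingOp, diagOp_apply]

variable [CompleteSpace E]

theorem star_flipOp : star (flipOp E) = flipOp E := by
  symm
  rw [ContinuousLinearMap.star_eq_adjoint (flipOp E), ContinuousLinearMap.eq_adjoint_iff]
  intro v w
  simp [flipOp_apply, WithLp.prod_inner_apply, add_comm]

theorem star_gradingOp : star (gradingOp E) = gradingOp E := by
  rw [gradingOp, star_diagOp]
  simp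

theorem isSmooth_diagOp {T : E →L[ℂ] E} (h : IsSmooth T) : IsSmooth (diagOp T T) := by
  rw [diagOp_eq]
  exact ((h.comp_right _).comp_left _).add ((h.comp_right _).comp_left _)

theorem hasNuclearTrace_diagOp {T : E →L[ℂ] E} {t : ℂ} (h : HasNuclearTrace T t) :
    HasNuclearTrace (diagOp T T) (2 * t) := by
  obtain ⟨s, h1, h2⟩ := (h.isNuclear.comp_right (projFst E)).exists_trace_comm (inclFst E)
  obtain ⟨s', h1', h2'⟩ := (h.isNuclear.comp_right (projSnd E)).exists_trace_comm (inclSnd E)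
  have e : (T ∘L projFst E) ∘L inclFst E = T := rfl
  have e' : (T ∘L projSnd E) ∘L inclSnd E = T := rfl
  rw [e] at h2
  rw [e'] at h2'
  rw [diagOp_eq, two_mul]
  rw [h2.unique h] at h1
  rw [h2'.unique h] at h1'
  exact h1.add h1'

variable {A : Type*} [Ring A] [StarRing A] [Algebra ℂ A] {ρ₁ ρ₂ : A →⋆ₐ[ℂ] (E →L[ℂ] E)}

theorem directSumRep_apply (a : A) : directSumRep ρ₁ ρ₂ a = diagOp (ρ₁ a) (ρ₂ a) := rfl

theorem commutator_eq (a : A) :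
    flipOp E * directSumRep ρ₁ ρ₂ a - directSumRep ρ₁ ρ₂ a * flipOp E =
      inclSnd E ∘L (ρ₁ a - ρ₂ a) ∘L projFst E - inclFst E ∘L (ρ₁ a - ρ₂ a) ∘L projSnd E := by
  refine clm_prod_ext (fun v => ?_) (fun v => ?_) <;> simp [directSumRep_apply, diagOp_apply, flipOp_apply, inclFst_apply, inclSnd_apply,
    projFst_apply, projSnd_apply]

theorem grading_flip_commutator (a : A) :
    gradingOp E * (directSumRep ρ₁ ρ₂ a - flipOp E * directSumRep ρ₁ ρ₂ a * flipOp E) =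
      diagOp (ρ₁ a - ρ₂ a) (ρ₁ a - ρ₂ a) := by
  refine clm_prod_ext (fun v => ?_) (fun v => ?_) <;> simp [directSumRep_apply, diagOp_apply, flipOp_apply, gradingOp]

theorem isSmooth_commutator {a : A} (h : IsSmooth (ρ₁ a - ρ₂ a)) :
    IsSmooth (flipOp E * directSumRep ρ₁ ρ₂ a - directSumRep ρ₁ ρ₂ a * flipOp E) := by
  rw [commutator_eq]
  exact ((h.comp_right _).comp_left _).sub ((h.comp_right _).comp_left _)

/-- Leibniz rule: `ρ₁(ab) - ρ₂(ab) = ρ₁(a)(ρ₁(b) - ρ₂(b)) + (ρ₁(a) - ρ₂(a))ρ₂(b)`. -/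
theorem isSmooth_sub_mul {a b : A} (ha : IsSmooth (ρ₁ a - ρ₂ a)) (hb : IsSmooth (ρ₁ b - ρ₂ b)) :
    IsSmooth (ρ₁ (a * b) - ρ₂ (a * b)) := by
  convert (hb.comp_left (ρ₁ a)).add (ha.comp_right (ρ₂ b)) using 1
  rw [map_mul, map_mul]
  change _ = ρ₁ a * (ρ₁ b - ρ₂ b) + (ρ₁ a - ρ₂ a) * ρ₂ b
  noncomm_ring

theorem isSmooth_sub_add {a b : A} (ha : IsSmooth (ρ₁ a - ρ₂ a)) (hb : IsSmooth (ρ₁ b - ρ₂ b)) :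
    IsSmooth (ρ₁ (a + b) - ρ₂ (a + b)) := by
  convert ha.add hb using 1
  rw [map_add, map_add]
  abel

theorem isSmooth_sub_star {a : A} (ha : IsSmooth (ρ₁ a - ρ₂ a)) :
    IsSmooth (ρ₁ (star a) - ρ₂ (star a)) := by
  rw [map_star, map_star, ← star_sub]
  exact ha.adjoint

theorem isSmooth_sub_algebraMap (c : ℂ) :
    IsSmooth (ρ₁ (algebraMap ℂ A c) - ρ₂ (algebraMap ℂ A c)) := by
  rw [AlgHomClass.commutes, AlgHomClass.commutes, sub_self]
  exact isSmooth_zero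

theorem not_finiteDimensional_prod (hE : ¬FiniteDimensional ℂ E) :
    ¬FiniteDimensional ℂ (WithLp 2 (E × E)) := fun _ =>
  hE (FiniteDimensional.of_injective (inclFst E).toLinearMap fun _ _ h =>
    congrArg (projFst E) h)

theorem not_finiteDimensional_amplified {H : Type} [NormedAddCommGroup H] [InnerProductSpace ℂ H]
    {N : ℕ} [NeZero N] (hH : ¬FiniteDimensional ℂ H) :
    ¬FiniteDimensional ℂ (Amplified H N) := fun _ =>
  hH (FiniteDimensional.of_injective (ampIncl H (0 : Fin N)).toLinearMap fun x y h => by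
    simpa [ampProj_apply, ampIncl_apply] using congrArg (ampProj H (0 : Fin N)) h)

theorem isEvenFredholmModule_directSumRep (h : ∀ a, IsSmooth (ρ₁ a - ρ₂ a)) :
    IsEvenFredholmModule (directSumRep ρ₁ ρ₂) (flipOp E) (gradingOp E) where
  selfAdjoint := star_flipOp
  sq_eq_one := flipOp_mul_self
  compact_commutator a := (isSmooth_commutator (h a)).2.isCompactOperator
  grading_selfAdjoint := star_gradingOp
  grading_sq := gradingOp_mul_self
  grading_commute _ := gradingOp_mul_diagOp _ _
  grading_anticommute := gradingOp_mul_flipOp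

theorem isPSummable_directSumRep (hE : ¬FiniteDimensional ℂ E) (h : ∀ a, IsSmooth (ρ₁ a - ρ₂ a)) :
    IsPSummable 1 (directSumRep ρ₁ ρ₂) (flipOp E) :=
  ⟨le_rfl, fun a => (isSmooth_commutator (h a)).2.isSchatten (not_finiteDimensional_prod hE)⟩

section Pairing

variable {N : ℕ} (e : Matrix (Fin N) (Fin N) A)

theorem matRep_sub_conj : matRep (directSumRep ρ₁ ρ₂) e -
      ampOp N (flipOp E) * matRep (directSumRep ρ₁ ρ₂) e * ampOp N (flipOp E) =
    blockOp (e.map fun a =>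
      directSumRep ρ₁ ρ₂ a - flipOp E * directSumRep ρ₁ ρ₂ a * flipOp E) := by
  rw [matRep, ampOp, ← blockOp_mul, ← blockOp_mul, ← blockOp_sub]
  congr 1
  ext1 i j
  simp [Matrix.diagonal_mul, Matrix.mul_diagonal]

theorem ampOp_flip_mul_self : ampOp N (flipOp E) * ampOp N (flipOp E) = 1 := by
  rw [ampOp, ← blockOp_mul, Matrix.diagonal_mul_diagonal, flipOp_mul_self]
  simp [blockOp_one]

theorem ampOp_grading_mul_self : ampOp N (gradingOp E) * ampOp N (gradingOp E) = 1 := by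
  rw [ampOp, ← blockOp_mul, Matrix.diagonal_mul_diagonal, gradingOp_mul_self]
  simp [blockOp_one]

theorem ampOp_grading_mul_flip :
    ampOp N (gradingOp E) * ampOp N (flipOp E) = -(ampOp N (flipOp E) * ampOp N (gradingOp E)) := by
  rw [ampOp, ampOp, ← blockOp_mul, ← blockOp_mul, ← blockOp_neg, Matrix.diagonal_mul_diagonal,
    Matrix.diagonal_mul_diagonal, gradingOp_mul_flipOp, Matrix.diagonal_neg]

theorem ampOp_grading_mul_matRep : ampOp N (gradingOp E) * matRep (directSumRep ρ₁ ρ₂) e =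
    matRep (directSumRep ρ₁ ρ₂) e * ampOp N (gradingOp E) := by
  rw [ampOp, matRep, ← blockOp_mul, ← blockOp_mul]
  congr 1
  ext1 i j
  simp [Matrix.diagonal_mul, Matrix.mul_diagonal, directSumRep_apply, gradingOp_mul_diagOp]

theorem matRep_mul_self (he : IsIdempotentElem e) :
    matRep (directSumRep ρ₁ ρ₂) e * matRep (directSumRep ρ₁ ρ₂) e =
      matRep (directSumRep ρ₁ ρ₂) e := by
  rw [matRep, ← blockOp_mul, ← Matrix.map_mul, he.eq]

theorem pairingOp_eq_mul : pairingOp (directSumRep ρ₁ ρ₂) (flipOp E) (gradingOp E) e =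
    ampOp N (gradingOp E) * (matRep (directSumRep ρ₁ ρ₂) e -
      ampOp N (flipOp E) * matRep (directSumRep ρ₁ ρ₂) e * ampOp N (flipOp E)) := by
  rw [pairingOp, mul_assoc, mul_sub (ampOp N (flipOp E)), ← mul_assoc (ampOp N (flipOp E)),
    ampOp_flip_mul_self, one_mul, ← mul_assoc (ampOp N (flipOp E))]

/-- Conjugation by the flip exchanges the two representations, and the grading turns `(ρ₁ - ρ₂, ρ₂ -
ρ₁)` into `(ρ₁ - ρ₂, ρ₁ - ρ₂)`. Hence the trace is twice that of `ρ₁ - ρ₂`, and the factor `½` of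
the index formula cancels. -/
theorem pairingOp_eq : pairingOp (directSumRep ρ₁ ρ₂) (flipOp E) (gradingOp E) e =
    blockOp (e.map fun a => diagOp (ρ₁ a - ρ₂ a) (ρ₁ a - ρ₂ a)) := by
  rw [pairingOp_eq_mul, matRep_sub_conj, ampOp, ← blockOp_mul]
  congr 1
  ext1 i j
  simp [Matrix.diagonal_mul, grading_flip_commutator]

theorem index_pairing_directSumRep [NeZero N] (hE : ¬FiniteDimensional ℂ E)
    (h : ∀ a, IsSmooth (ρ₁ a - ρ₂ a)) (he : IsIdempotentElem e) {t : ℂ}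
    (ht : HasNuclearTrace (ρ₁ e.trace - ρ₂ e.trace) t) :
    HasTrace (pairingOp (directSumRep ρ₁ ρ₂) (flipOp E) (gradingOp E) e) (2 * t) ∧
    (fredholmPlus (directSumRep ρ₁ ρ₂) (flipOp E) (gradingOp E) e).IsFredholm ∧
    (fredholmIndex (fredholmPlus (directSumRep ρ₁ ρ₂) (flipOp E) (gradingOp E) e) : ℂ) = t := by
  have hb : IsSmooth (pairingOp (directSumRep ρ₁ ρ₂) (flipOp E) (gradingOp E) e) := by
    rw [pairingOp_eq]
    exact isSmooth_blockOp fun i j => isSmooth_diagOp (h _)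
  have hτ : HasNuclearTrace (pairingOp (directSumRep ρ₁ ρ₂) (flipOp E) (gradingOp E) e)
      (2 * t) := by
    choose s hs using fun i => (h (e i i)).1.exists_trace
    have hst : ∑ i, s i = t := by
      refine HasNuclearTrace.unique ?_ ht
      convert HasNuclearTrace.sum Finset.univ hs using 1
      rw [Matrix.trace, map_sum, map_sum, ← Finset.sum_sub_distrib]
      rfl
    rw [pairingOp_eq, ← hst, Finset.mul_sum]
    exact hasNuclearTrace_blockOp (fun i j => (isSmooth_diagOp (h _)).1)
      fun i => hasNuclearTrace_diagOp (hs i)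
  have hB : IsNuclear (matRep (directSumRep ρ₁ ρ₂) e -
      ampOp N (flipOp E) * matRep (directSumRep ρ₁ ρ₂) e * ampOp N (flipOp E)) := by
    have := hb.1.comp_left (ampOp N (gradingOp E))
    rw [pairingOp_eq_mul] at this
    change IsNuclear (ampOp N (gradingOp E) * (ampOp N (gradingOp E) * _)) at this
    rwa [← mul_assoc, ampOp_grading_mul_self, one_mul] at this
  have hτ' := hτ
  rw [pairingOp_eq_mul] at hτ'
  have key := fredholmIndex_graded (matRep_mul_self (ρ₁ := ρ₁) (ρ₂ := ρ₂) e he)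
    (ampOp_grading_mul_matRep e)
    ampOp_flip_mul_self ampOp_grading_mul_self ampOp_grading_mul_flip hB hτ' rfl rfl
    (T := fredholmPlus (directSumRep ρ₁ ρ₂) (flipOp E) (gradingOp E) e) (fun _ => rfl)
  refine ⟨⟨hb.2.isSchatten (not_finiteDimensional_amplified (not_finiteDimensional_prod hE)),
    fun ι b => hτ.hasSum_inner b⟩, key.1, key.2.trans (by ring)⟩

end Pairing

end DirectSumModule
end

/-! ### The idempotent and its matrix trace -/

noncomputable section
namespace QuantumSphere

section Idempotent

variable (q : ℝ)

theorem x_mul_x {i j : Fin 3} (h : i < j) : x q i * x q j = ((q : ℂ) ^ 2) • (x q j * x q i) := by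
  have := mk_rel (Rel.comm (q := q) i j h)
  rwa [map_mul, map_smul, map_mul] at this

theorem star_x_mul_star_x {i j : Fin 3} (h : i < j) :
    star (x q j) * star (x q i) = ((q : ℂ) ^ 2) • (star (x q i) * star (x q j)) := by
  simpa [star_x] using mk_rel (Rel.comm_adj (q := q) i j h)

theorem star_x_mul_x {i j : Fin 3} (h : i ≠ j) :
    star (x q i) * x q j = ((q : ℂ) ^ 2) • (x q j * star (x q i)) := by
  have := mk_rel (Rel.cross (q := q) i j h)
  rw [map_mul, map_smul, map_mul] at this
  rw [star_x]
  exact this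

theorem star_x_one_mul_self : star (x q 1) * x q 1 =
    x q 1 * star (x q 1) + (1 - (q : ℂ) ^ 4) • (x q 0 * x q 0) := by
  have := mk_rel (Rel.u1 (q := q))
  rw [map_sub, map_mul, map_mul, map_smul, map_mul, sub_eq_iff_eq_add'] at this
  rw [star_x]
  exact this

theorem star_x_two_mul_self : star (x q 2) * x q 2 =
    x q 2 * star (x q 2) + (star (x q 1) * x q 1 - (q : ℂ) ^ 4 • (x q 1 * star (x q 1))) := by
  have := mk_rel (Rel.u2 (q := q))
  simp only [map_sub, map_mul, map_smul, sub_eq_iff_eq_add'] at this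
  rw [star_x, star_x]
  exact this

theorem x_zero_mul_self : x q 0 * x q 0 =
    1 - x q 1 * star (x q 1) - x q 2 * star (x q 2) := by
  have := mk_rel (Rel.radius (q := q))
  simp only [map_add, map_mul, map_one] at this
  rw [star_x, star_x, sub_sub, eq_sub_iff_add_eq, ← add_assoc]
  exact this

/-- The relations serve as rewriting rules to a normal order; comparing coefficients of the ordered
monomials then settles all sixteen entries. -/
theorem isIdempotentElem_instanton {R : Type*} [Ring R] [Algebra ℂ R] {c : ℂ} (hc : c ≠ 0)
    {x₀ x₁ y₁ x₂ y₂ : R} (r01 : x₀ * x₁ = c ^ 2 • (x₁ * x₀)) (r02 : x₀ * x₂ = c ^ 2 • (x₂ * x₀))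
    (r12 : x₁ * x₂ = c ^ 2 • (x₂ * x₁)) (a12 : y₂ * y₁ = c ^ 2 • (y₁ * y₂))
    (c10 : y₁ * x₀ = c ^ 2 • (x₀ * y₁)) (c20 : y₂ * x₀ = c ^ 2 • (x₀ * y₂))
    (c12 : y₁ * x₂ = c ^ 2 • (x₂ * y₁)) (c21 : y₂ * x₁ = c ^ 2 • (x₁ * y₂))
    (u1 : y₁ * x₁ = x₁ * y₁ + (1 - c ^ 4) • (x₀ * x₀))
    (u2 : y₂ * x₂ = x₂ * y₂ + (y₁ * x₁ - c ^ 4 • (x₁ * y₁)))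
    (u0 : x₀ * x₀ = 1 - x₁ * y₁ - x₂ * y₂) :
    IsIdempotentElem ((1 / 2 : ℂ) •
      !![1 + x₀, c ^ (3 : ℤ) • x₂, -(c ^ (1 : ℤ) • x₁), 0;
        c ^ (-3 : ℤ) • y₂, 1 - c ^ (2 : ℤ) • x₀, 0, c ^ (3 : ℤ) • x₁;
        -(c ^ (-1 : ℤ) • y₁), 0, 1 - c ^ (2 : ℤ) • x₀, c ^ (3 : ℤ) • x₂;
        0, c ^ (1 : ℤ) • y₁, c ^ (-3 : ℤ) • y₂, 1 + c ^ (4 : ℤ) • x₀]) := by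
  -- The rules are first made terminating: `x₀²` is eliminated, so that `y₁x₁` and `y₂x₂` become
  -- combinations of `1`, `x₁y₁` and `x₂y₂`.
  rw [u1] at u2
  rw [u0] at u1 u2
  refine Matrix.ext fun i j => ?_
  rw [Matrix.mul_apply, Fin.sum_univ_four]
  fin_cases i <;> fin_cases j <;>
  simp [mul_add, add_mul, mul_sub, sub_mul, r01, r02, r12, a12, c10, c20, c12, c21, u0, u1, u2,
    zpow_neg] <;>
  match_scalars <;> field_simp <;> ring

theorem isIdempotentElem_e (h0 : q ≠ 0) : IsIdempotentElem (e q) :=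
  isIdempotentElem_instanton (by exact_mod_cast h0)
    (x_mul_x q (show (0 : Fin 3) < 1 by decide)) (x_mul_x q (show (0 : Fin 3) < 2 by decide))
    (x_mul_x q (show (1 : Fin 3) < 2 by decide))
    (star_x_mul_star_x q (show (1 : Fin 3) < 2 by decide))
    (star_x_mul_x q (show (1 : Fin 3) ≠ 0 by decide))
    (star_x_mul_x q (show (2 : Fin 3) ≠ 0 by decide))
    (star_x_mul_x q (show (1 : Fin 3) ≠ 2 by decide))
    (star_x_mul_x q (show (2 : Fin 3) ≠ 1 by decide))
    (star_x_one_mul_self q) (star_x_two_mul_self q) (x_zero_mul_self q)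

/-- The constant does not contribute to the difference of two unital representations, so the pairing
only sees `x₀`. -/
theorem trace_e : (e q).trace = algebraMap ℂ (S4 q) 2 + ((1 - (q : ℂ) ^ 2) ^ 2 / 2) • x q 0 := by
  rw [Matrix.trace, Fin.sum_univ_four]
  simp [e, Algebra.algebraMap_eq_smul_one]
  match_scalars <;> ring

end Idempotent
end QuantumSphere
end

/-! ### Exponential bounds for the coefficients -/

noncomputable section
namespace QuantumSphere

section Estimates

variable {q : ℝ}

theorem zpow_le_zpow_of_le (h0 : 0 < q) (h1 : q < 1) {m n : ℤ} (h : m ≤ n) : q ^ n ≤ q ^ m :=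
  zpow_le_zpow_right_of_le_one₀ h0 h1.le h

/-- The constant in the upper bound for `[n]`. -/
def qK (q : ℝ) : ℝ := q / (1 - q ^ 2)

theorem one_sub_sq_pos (h0 : 0 < q) (h1 : q < 1) : 0 < 1 - q ^ 2 := by nlinarith

theorem qK_pos (h0 : 0 < q) (h1 : q < 1) : 0 < qK q := div_pos h0 (one_sub_sq_pos h0 h1)

theorem qi_eq (h0 : 0 < q) (h1 : q < 1) (n : ℤ) : qi q n = qK q * (q ^ (-n) - q ^ n) := by
  have h2 := (one_sub_sq_pos h0 h1).ne'
  have h3 : q - q⁻¹ = -((1 - q ^ 2) / q) := by field_simp; ring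
  rw [qi, br, h3, qK, zpow_neg]
  field_simp
  ring

theorem qi_le (h0 : 0 < q) (h1 : q < 1) (n : ℤ) : qi q n ≤ qK q * q ^ (-n) := by
  rw [qi_eq h0 h1]
  have := zpow_pos h0 n
  exact mul_le_mul_of_nonneg_left (by linarith) (qK_pos h0 h1).le

/-- `[n]` is at least `q ^ (1 - n)`: in `[n] = K(q⁻ⁿ - qⁿ)` one has `qⁿ ≤ q² q⁻ⁿ` for `n ≥ 1`, and
`K(1 - q²) = q`. -/
theorem inv_qi_le (h0 : 0 < q) (h1 : q < 1) {n : ℤ} (hn : 1 ≤ n) : (qi q n)⁻¹ ≤ q ^ (n - 1) := by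
  refine inv_le_of_inv_le₀ (zpow_pos h0 _) ?_
  have h2 := one_sub_sq_pos h0 h1
  have h3 : q ^ n ≤ q ^ 2 * q ^ (-n) := by
    rw [← zpow_natCast, ← zpow_add₀ h0.ne']
    exact zpow_le_zpow_of_le h0 h1 (by push_cast; omega)
  have h4 : (q ^ (n - 1))⁻¹ = qK q * ((1 - q ^ 2) * q ^ (-n)) := by
    rw [qK, ← zpow_neg, neg_sub, sub_eq_add_neg, zpow_add₀ h0.ne', zpow_one]
    field_simp
  rw [qi_eq h0 h1, h4]
  exact mul_le_mul_of_nonneg_left (by linarith) (qK_pos h0 h1).le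

theorem sqrt_qi_mul_qi_le (h0 : 0 < q) (h1 : q < 1) {a b c : ℤ} (hb : 0 ≤ b)
    (h : a + b ≤ 2 * c) : √(qi q a * qi q b) ≤ qK q * q ^ (-c) := by
  have hK := qK_pos h0 h1
  refine Real.sqrt_le_iff.2 ⟨by positivity, ?_⟩
  calc qi q a * qi q b ≤ (qK q * q ^ (-a)) * (qK q * q ^ (-b)) :=
        mul_le_mul (qi_le h0 h1 a) (qi_le h0 h1 b) (qi_nonneg h0 h1 hb) (by positivity)
    _ = qK q ^ 2 * q ^ (-a + -b) := by rw [zpow_add₀ h0.ne']; ring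
    _ ≤ qK q ^ 2 * q ^ (-c + -c) :=
        mul_le_mul_of_nonneg_left (zpow_le_zpow_of_le h0 h1 (by omega)) (by positivity)
    _ = (qK q * q ^ (-c)) ^ 2 := by rw [zpow_add₀ h0.ne']; ring

theorem bound_one (h0 : 0 < q) (h1 : q < 1) {a b c u m E : ℤ} {r R : ℝ} (hr0 : 0 ≤ r)
    (hr : r ≤ R * q ^ u) (ha : 0 ≤ a) (hb : 0 ≤ b) (h : a + b ≤ 2 * c) (hm : 1 ≤ m)
    (hE : E ≤ u - c + (m - 1)) :
    |r * √(qi q a * qi q b) / qi q m| ≤ R * qK q * q ^ E := by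
  have hK := qK_pos h0 h1
  have hR : 0 ≤ R := nonneg_of_mul_nonneg_left (hr0.trans hr) (zpow_pos h0 u)
  have hq := qi_pos h0 h1 (show 0 < m by omega)
  rw [abs_of_nonneg (by positivity), div_eq_mul_inv]
  calc r * √(qi q a * qi q b) * (qi q m)⁻¹
      ≤ R * q ^ u * (qK q * q ^ (-c)) * q ^ (m - 1) :=
        mul_le_mul (mul_le_mul hr (sqrt_qi_mul_qi_le h0 h1 hb h) (Real.sqrt_nonneg _)
          (by positivity)) (inv_qi_le h0 h1 hm) (by positivity) (by positivity)
    _ = R * qK q * q ^ (u + -c + (m - 1)) := by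
        rw [zpow_add₀ h0.ne' (u + -c), zpow_add₀ h0.ne' u]; ring
    _ ≤ R * qK q * q ^ E :=
        mul_le_mul_of_nonneg_left (zpow_le_zpow_of_le h0 h1 (by omega)) (by positivity)

theorem bound_two (h0 : 0 < q) (h1 : q < 1) {a b c u m m' E : ℤ} {r R : ℝ} (hr0 : 0 ≤ r)
    (hr : r ≤ R * q ^ u) (ha : 0 ≤ a) (hb : 0 ≤ b) (h : a + b ≤ 2 * c) (hm : 1 ≤ m) (hm' : 1 ≤ m')
    (hE : E ≤ u - c + (m - 1) + (m' - 1)) :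
    |r * √(qi q a * qi q b) / (qi q m * qi q m')| ≤ R * qK q * q ^ E := by
  have hK := qK_pos h0 h1
  have hR : 0 ≤ R := nonneg_of_mul_nonneg_left (hr0.trans hr) (zpow_pos h0 u)
  have hq := qi_pos h0 h1 (show 0 < m' by omega)
  rw [← div_div, abs_div, abs_of_pos hq, div_eq_mul_inv]
  calc |r * √(qi q a * qi q b) / qi q m| * (qi q m')⁻¹
      ≤ R * qK q * q ^ (u - c + (m - 1)) * q ^ (m' - 1) :=
        mul_le_mul (bound_one h0 h1 hr0 hr ha hb h hm le_rfl) (inv_qi_le h0 h1 hm') (by positivity)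
          (by positivity)
    _ = R * qK q * q ^ (u - c + (m - 1) + (m' - 1)) := by
        rw [zpow_add₀ h0.ne' (u - c + (m - 1))]; ring
    _ ≤ R * qK q * q ^ E :=
        mul_le_mul_of_nonneg_left (zpow_le_zpow_of_le h0 h1 hE) (by positivity)

theorem sqrt_le_one_of (h1 : q < 1) : √q ≤ 1 := Real.sqrt_le_one.2 h1.le

theorem zpow_mul_sqrt_le (h0 : 0 < q) (h1 : q < 1) (u : ℤ) : q ^ u * √q ≤ 1 * q ^ u := by
  rw [one_mul]
  exact mul_le_of_le_one_right (zpow_pos h0 u).le (sqrt_le_one_of h1)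

theorem zpow_mul_sqrt_nonneg (h0 : 0 < q) (u : ℤ) : 0 ≤ q ^ u * √q := by positivity

/-- The ranges for `J` and `M` are one step wider than admissible, because the representation also
uses this coefficient at `J - 1`. -/
theorem abs_Ap_le (h0 : 0 < q) (h1 : q < 1) {J M : ℤ} (hJ : -1 ≤ J) (hM : -J - 2 ≤ M)
    (hM' : M ≤ J + 1) : |Ap q J M| ≤ qK q * q ^ (-3 : ℤ) := by
  rw [Ap_eq h0, ← one_mul (qK q)]
  exact bound_one h0 h1 (c := J + 2) (u := M - 1) (zpow_mul_sqrt_nonneg h0 _)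
    (zpow_mul_sqrt_le h0 h1 _) (by omega) (by omega) (by omega) (by omega) (by omega)

theorem abs_Bp_le (h0 : 0 < q) (h1 : q < 1) {J M : ℤ} (hJ : -1 ≤ J) (hM : -J - 2 ≤ M) :
    |Bp q J M| ≤ qK q * q ^ (-3 : ℤ) := by
  rw [Bp_eq h0, ← one_mul (qK q)]
  exact bound_one h0 h1 (c := J + M + 3) (u := M - J - 1) (zpow_mul_sqrt_nonneg h0 _)
    (zpow_mul_sqrt_le h0 h1 _) (by omega) (by omega) (by omega) (by omega) (by omega)

theorem abs_Bm_le (h0 : 0 < q) (h1 : q < 1) {J M : ℤ} (hJ : 0 ≤ J) (h : MAdm M J) :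
    |Bm q J M| ≤ qK q * q ^ (-3 : ℤ) := by
  obtain ⟨hM, hM'⟩ := h
  have hK := qK_pos h0 h1
  rw [Bm_eq h0, abs_neg]
  -- At `M = J` the radicand is `[0][-1]`; the general bound needs non-negative arguments, but there
  -- the coefficient is zero.
  rcases hM'.eq_or_lt with rfl | hM'
  · rw [sub_self, qi_zero, zero_mul, Real.sqrt_zero, mul_zero, zero_div, abs_zero]
    positivity
  · rw [← one_mul (qK q)]
    exact bound_one h0 h1 (c := J - M) (u := J + M + 1) (zpow_mul_sqrt_nonneg h0 _)
      (zpow_mul_sqrt_le h0 h1 _) (by omega) (by omega) (by omega) (by omega) (by omega)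

theorem abs_B0_le (h0 : 0 < q) (h1 : q < 1) {J M : ℤ} (hJ : 0 ≤ J) (h : MAdm M J) :
    |B0 q J M| ≤ 2 * qK q * q ^ (2 * J) := by
  obtain ⟨hM, hM'⟩ := h
  rw [B0_eq h0]
  refine bound_two h0 h1 (c := J + 1) (u := M) (by positivity) ?_ (by omega) (by omega) (by omega)
    (by omega) (by omega) (by omega)
  have : q ^ 2 ≤ 1 := pow_le_one₀ h0.le h1.le
  exact mul_le_mul_of_nonneg_right (by linarith) (zpow_pos h0 M).le

/-- Decay in `j` only. The missing decay in `l - j` comes from `H⁰`, bounded by `q ^ (2L - 2J - 2)`,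
so that the product is of order `q ^ (2L)`. -/
theorem abs_A0_le (h0 : 0 < q) (h1 : q < 1) {J M : ℤ} (hJ : 0 ≤ J) (h : MAdm M J) :
    |A0 q J M| ≤ (qK q ^ 2 + qK q) * q ^ (2 * J - 2) := by
  obtain ⟨hM, hM'⟩ := h
  have hK := qK_pos h0 h1
  have hq1 := qi_pos h0 h1 (show 0 < 2 * J + 1 by omega)
  have hq2 := qi_pos h0 h1 (show 0 < 2 * J + 3 by omega)
  have hq3 := qi_nonneg h0 h1 (show 0 ≤ J - M by omega)
  have hq4 := qi_nonneg h0 h1 (show (0 : ℤ) ≤ 2 by omega)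
  have e1 : q ^ (J + M + 2) * qi q 2 * qi q (J - M) ≤ qK q ^ 2 * q ^ (-2 * J - 2) := by
    calc q ^ (J + M + 2) * qi q 2 * qi q (J - M)
        ≤ q ^ (J + M + 2) * (qK q * q ^ (-2 : ℤ)) * (qK q * q ^ (-(J - M))) :=
          mul_le_mul (mul_le_mul_of_nonneg_left (qi_le h0 h1 2) (zpow_pos h0 _).le)
            (qi_le h0 h1 _) hq3 (by positivity)
      _ = qK q ^ 2 * q ^ (J + M + 2 + -2 + -(J - M)) := by
          rw [zpow_add₀ h0.ne' (J + M + 2 + -2), zpow_add₀ h0.ne' (J + M + 2)]; ring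
      _ ≤ _ := mul_le_mul_of_nonneg_left (zpow_le_zpow_of_le h0 h1 (by omega)) (by positivity)
  have e2 : qi q (2 * J + 1) ≤ qK q * q ^ (-2 * J - 2) :=
    (qi_le h0 h1 _).trans
      (mul_le_mul_of_nonneg_left (zpow_le_zpow_of_le h0 h1 (by omega)) hK.le)
  have e3 : |q ^ (J + M + 2) * qi q 2 * qi q (J - M) - qi q (2 * J + 1)| ≤
      (qK q ^ 2 + qK q) * q ^ (-2 * J - 2) := by
    have : 0 ≤ q ^ (J + M + 2) * qi q 2 * qi q (J - M) := by positivity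
    have p1 : 0 ≤ qK q ^ 2 * q ^ (-2 * J - 2) := by positivity
    have p2 : 0 ≤ qK q * q ^ (-2 * J - 2) := by positivity
    rw [abs_le, add_mul]
    constructor <;> linarith
  rw [A0_eq h0, abs_div, abs_mul, abs_of_pos (zpow_pos h0 (-2)), abs_mul (qi q (2 * J + 1)),
    abs_of_pos hq1, abs_of_pos hq2, div_eq_mul_inv, mul_inv]
  calc _ ≤ q ^ (-2 : ℤ) * ((qK q ^ 2 + qK q) * q ^ (-2 * J - 2)) *
        (q ^ (2 * J + 1 - 1) * q ^ (2 * J + 3 - 1)) :=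
        mul_le_mul (mul_le_mul_of_nonneg_left e3 (zpow_pos h0 _).le)
          (mul_le_mul (inv_qi_le h0 h1 (by omega)) (inv_qi_le h0 h1 (by omega)) (by positivity)
            (by positivity)) (by positivity) (by positivity)
    _ = (qK q ^ 2 + qK q) * q ^ (-2 + (-2 * J - 2) + (2 * J + 1 - 1) + (2 * J + 3 - 1)) := by
        rw [zpow_add₀ h0.ne' (-2 + (-2 * J - 2) + (2 * J + 1 - 1)),
          zpow_add₀ h0.ne' (-2 + (-2 * J - 2)), zpow_add₀ h0.ne' (-2)]; ring
    _ = _ := by congr 2; ring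

theorem abs_C0_le (h0 : 0 < q) (h1 : q < 1) {L J M : ℤ} (hJ : -1 ≤ J) (hL : 0 ≤ L)
    (h : VAdm L M J) : |C0 q L J M| ≤ qK q ^ 2 * q ^ (2 * L - 4) := by
  obtain ⟨hM, hM'⟩ := h
  have hq2 := qi_nonneg h0 h1 (show (0 : ℤ) ≤ 2 by omega)
  have key : ∀ u : ℤ, qi q 2 * (q ^ u * √q) ≤ qK q * q ^ (u - 2) := by
    intro u
    calc qi q 2 * (q ^ u * √q) ≤ (qK q * q ^ (-2 : ℤ)) * (1 * q ^ u) :=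
          mul_le_mul (qi_le h0 h1 2) (zpow_mul_sqrt_le h0 h1 u) (by positivity)
            (mul_nonneg (qK_pos h0 h1).le (by positivity))
      _ = qK q * q ^ (u - 2) := by rw [sub_eq_add_neg, zpow_add₀ h0.ne']; ring
  rw [sq]
  by_cases hp : par L J M
  · rw [C0_of_par h0 hp, gU]
    exact bound_two h0 h1 (c := L - M + 2) (by positivity) (key (L + M + 1)) (by omega) (by omega)
      (by omega) (by omega) (by omega) (by omega)
  · rw [C0_of_not_par h0 hp, gW, abs_neg]
    exact bound_two h0 h1 (c := L + M + 3) (by positivity) (key (-L + M - 3)) (by omega)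
      (by omega) (by omega) (by omega) (by omega) (by omega)

theorem abs_D0_le (h0 : 0 < q) (h1 : q < 1) {L J M : ℤ} (hJ : 0 ≤ J) (hL : 0 ≤ L)
    (h : VAdm L M J) : |D0 q L J M| ≤ qK q ^ 2 * q ^ (2 * L - 4) := by
  obtain ⟨hM, hM'⟩ := h
  have hq2 := qi_nonneg h0 h1 (show (0 : ℤ) ≤ 2 by omega)
  have key : qi q 2 * q ^ (M + 1) ≤ qK q * q ^ (M - 1) := by
    calc qi q 2 * q ^ (M + 1) ≤ (qK q * q ^ (-2 : ℤ)) * q ^ (M + 1) :=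
          mul_le_mul_of_nonneg_right (qi_le h0 h1 2) (zpow_pos h0 _).le
      _ = qK q * q ^ (M - 1) := by
        rw [show M - 1 = -2 + (M + 1) by ring, zpow_add₀ h0.ne' (-2)]; ring
  rw [sq, D0_eq h0]
  obtain ⟨_, hn⟩ | ⟨_, hn⟩ := nn_cases L J M <;> rw [hn]
  · exact bound_two h0 h1 (c := L - J + 1) (by positivity) key (by omega) (by omega)
      (by omega) (by omega) (by omega) (by omega)
  · exact bound_two h0 h1 (c := L + J + 3) (by positivity) key (by omega)
      (by omega) (by omega) (by omega) (by omega) (by omega)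

theorem qi_mul_qi_le (h0 : 0 < q) (h1 : q < 1) {a b c : ℤ} (hb : 0 ≤ b)
    (h : a + b ≤ c) : qi q a * qi q b ≤ qK q ^ 2 * q ^ (-c) := by
  have hK := qK_pos h0 h1
  calc qi q a * qi q b ≤ (qK q * q ^ (-a)) * (qK q * q ^ (-b)) :=
        mul_le_mul (qi_le h0 h1 a) (qi_le h0 h1 b) (qi_nonneg h0 h1 hb) (by positivity)
    _ = qK q ^ 2 * q ^ (-a + -b) := by rw [zpow_add₀ h0.ne']; ring
    _ ≤ _ := mul_le_mul_of_nonneg_left (zpow_le_zpow_of_le h0 h1 (by omega)) (by positivity)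

theorem abs_H0_le (h0 : 0 < q) (h1 : q < 1) {L J M : ℤ} (hJ : 0 ≤ J) (hL : 0 ≤ L)
    (h : VAdm L M J) : |H0 q L J M| ≤ qK q ^ 2 * q ^ (2 * L - 2 * J - 2) := by
  obtain ⟨hM, hM'⟩ := h
  have hK := qK_pos h0 h1
  have hq1 := qi_pos h0 h1 (show 0 < 2 * L + 3 by omega)
  have hq2 := qi_pos h0 h1 (show 0 < 2 * L + 5 by omega)
  have hn : nn L J M = J + 1 ∨ nn L J M = -(J + 1) := by
    obtain ⟨_, hn⟩ | ⟨_, hn⟩ := nn_cases L J M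
    exacts [.inl hn, .inr hn]
  have b1 : 0 ≤ L - M - nn L J M + 1 := by
    obtain ⟨_, hn⟩ | ⟨_, hn⟩ := nn_cases L J M <;> rw [hn] <;> omega
  have b2 : 0 ≤ L + M - nn L J M + 3 := by omega
  have b3 : 0 ≤ L - M + nn L J M + 2 := by omega
  have b4 : 0 ≤ L + M + nn L J M + 2 := by omega
  have e1 : qi q (L - M - nn L J M + 1) * qi q (L + M - nn L J M + 3) ≤
      qK q ^ 2 * q ^ (-(2 * L + 2 * J + 6)) := qi_mul_qi_le h0 h1 b2 (by omega)
  have e2 : q ^ (-2 : ℤ) * (qi q (L - M + nn L J M + 2) * qi q (L + M + nn L J M + 2)) ≤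
      qK q ^ 2 * q ^ (-(2 * L + 2 * J + 8)) := by
    calc _ ≤ q ^ (-2 : ℤ) * (qK q ^ 2 * q ^ (-(2 * L + 2 * J + 6))) :=
          mul_le_mul_of_nonneg_left (qi_mul_qi_le h0 h1 b4 (by omega)) (zpow_pos h0 _).le
      _ = qK q ^ 2 * q ^ (-(2 * L + 2 * J + 8)) := by
        rw [show -(2 * L + 2 * J + 8) = -2 + -(2 * L + 2 * J + 6) by ring, zpow_add₀ h0.ne' (-2)]
        ring
  have e3 : |qi q (L - M - nn L J M + 1) * qi q (L + M - nn L J M + 3) -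
      q ^ (-2 : ℤ) * (qi q (L - M + nn L J M + 2) * qi q (L + M + nn L J M + 2))| ≤
      qK q ^ 2 * q ^ (-(2 * L + 2 * J + 8)) := by
    have p1 := mul_nonneg (qi_nonneg h0 h1 b1) (qi_nonneg h0 h1 b2)
    have p2 := mul_nonneg (zpow_pos h0 (-2)).le
      (mul_nonneg (qi_nonneg h0 h1 b3) (qi_nonneg h0 h1 b4))
    have p3 : qK q ^ 2 * q ^ (-(2 * L + 2 * J + 6)) ≤ qK q ^ 2 * q ^ (-(2 * L + 2 * J + 8)) :=
      mul_le_mul_of_nonneg_left (zpow_le_zpow_of_le h0 h1 (by omega)) (by positivity)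
    rw [abs_le]
    constructor <;> linarith
  rw [H0_eq h0, abs_div, abs_mul (qi q (2 * L + 3)), abs_of_pos hq1, abs_of_pos hq2,
    div_eq_mul_inv, mul_inv]
  calc _ ≤ (qK q ^ 2 * q ^ (-(2 * L + 2 * J + 8))) * (q ^ (2 * L + 3 - 1) * q ^ (2 * L + 5 - 1)) :=
        mul_le_mul e3
          (mul_le_mul (inv_qi_le h0 h1 (by omega)) (inv_qi_le h0 h1 (by omega)) (by positivity)
            (by positivity)) (by positivity) (by positivity)
    _ = qK q ^ 2 * q ^ (-(2 * L + 2 * J + 8) + (2 * L + 3 - 1) + (2 * L + 5 - 1)) := by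
        rw [zpow_add₀ h0.ne' (-(2 * L + 2 * J + 8) + (2 * L + 3 - 1)),
          zpow_add₀ h0.ne' (-(2 * L + 2 * J + 8))]; ring
    _ = _ := by congr 2; ring

end Estimates
end QuantumSphere
end

/-! ### The difference of the two representations is of trace class -/

noncomputable section
namespace QuantumSphere

section Differences

variable {q : ℝ} {ρp ρm : S4 q →⋆ₐ[ℂ] (Spinors →L[ℂ] Spinors)}

/-- The terms that change `l` do not depend on the sign and cancel; those that keep `l` are doubled.
-/
theorem sub_x_zero_ket (hp : IsChiralRep q 1 ρp) (hm : IsChiralRep q (-1) ρm) {L M₁ M₂ J : ℤ}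
    (h : Admissible L M₁ M₂ J) : (ρp (x q 0) - ρm (x q 0)) (ket L M₁ M₂ J) =
      termKet (-(2 * (Ap q J M₁ * C0 q L J M₂))) L M₁ M₂ (J + 1)
    + termKet (2 * (A0 q J M₁ * H0 q L J M₂)) L M₁ M₂ J
    + termKet (-(2 * (Ap q (J - 1) M₁ * C0 q L (J - 1) M₂))) L M₁ M₂ (J - 1) := by
  rw [sub_apply, hp.x0_ket _ _ _ _ h, hm.x0_ket _ _ _ _ h]
  simp only [termKet]
  push_cast
  module

theorem sub_x_one_ket (hp : IsChiralRep q 1 ρp) (hm : IsChiralRep q (-1) ρm) {L M₁ M₂ J : ℤ}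
    (h : Admissible L M₁ M₂ J) : (ρp (x q 1) - ρm (x q 1)) (ket L M₁ M₂ J) =
      termKet (-(2 * (Bp q J M₁ * C0 q L J M₂))) L (M₁ + 1) M₂ (J + 1)
    + termKet (2 * (B0 q J M₁ * H0 q L J M₂)) L (M₁ + 1) M₂ J
    + termKet (-(2 * (Bm q J M₁ * C0 q L (J - 1) M₂))) L (M₁ + 1) M₂ (J - 1) := by
  rw [sub_apply, hp.x1_ket _ _ _ _ h, hm.x1_ket _ _ _ _ h]
  simp only [termKet]
  push_cast
  module

theorem sub_x_two_ket (hp : IsChiralRep q 1 ρp) (hm : IsChiralRep q (-1) ρm) {L M₁ M₂ J : ℤ}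
    (h : Admissible L M₁ M₂ J) : (ρp (x q 2) - ρm (x q 2)) (ket L M₁ M₂ J) =
      termKet (2 * D0 q L J M₂) L M₁ (M₂ + 1) J := by
  rw [sub_apply, hp.x2_ket _ _ _ _ h, hm.x2_ket _ _ _ _ h]
  simp only [termKet]
  push_cast
  module

theorem norm_ket_le (L M₁ M₂ J : ℤ) : ‖ket L M₁ M₂ J‖ ≤ 1 := by
  by_cases h : Admissible L M₁ M₂ J
  · have := ketBasis.orthonormal.1 ⟨(L, M₁, M₂, J), h⟩
    rw [ketBasis_apply] at this
    exact this.le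
  · rw [ket_of_not_adm h, norm_zero]
    exact zero_le_one

theorem norm_termKet_le (r : ℝ) (L M₁ M₂ J : ℤ) : ‖termKet r L M₁ M₂ J‖ ≤ |r| := by
  rw [termKet, norm_smul, Complex.norm_real, Real.norm_eq_abs]
  exact mul_le_of_le_one_right (abs_nonneg r) (norm_ket_le _ _ _ _)

theorem abs_mul_le_zpow (h0 : 0 < q) (h1 : q < 1) {a b A B : ℝ} {m n k : ℤ} (ha : |a| ≤ A * q ^ m)
    (hb : |b| ≤ B * q ^ n) (h : k ≤ m + n) : |a * b| ≤ A * B * q ^ k := by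
  have hA : 0 ≤ A := nonneg_of_mul_nonneg_left ((abs_nonneg a).trans ha) (zpow_pos h0 m)
  have hB : 0 ≤ B := nonneg_of_mul_nonneg_left ((abs_nonneg b).trans hb) (zpow_pos h0 n)
  rw [abs_mul]
  calc |a| * |b| ≤ (A * q ^ m) * (B * q ^ n) := mul_le_mul ha hb (abs_nonneg b) (by positivity)
    _ = A * B * q ^ (m + n) := by rw [zpow_add₀ h0.ne']; ring
    _ ≤ _ := mul_le_mul_of_nonneg_left (zpow_le_zpow_of_le h0 h1 h) (by positivity)

theorem abs_two_mul_le {a A : ℝ} (h : |a| ≤ A) : |2 * a| ≤ 2 * A := by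
  rw [abs_mul, abs_two]
  linarith

/-- The exponent `2L - 7` is the worst case: `-3` from `A^±` or `B^±` and `2L - 4` from `C⁰`. -/
theorem exists_norm_sub_x_le (h0 : 0 < q) (h1 : q < 1) (hp : IsChiralRep q 1 ρp)
    (hm : IsChiralRep q (-1) ρm) (i : Fin 3) : ∃ C, 0 ≤ C ∧ ∀ L M₁ M₂ J, Admissible L M₁ M₂ J →
      ‖(ρp (x q i) - ρm (x q i)) (ket L M₁ M₂ J)‖ ≤ C * q ^ (2 * L - 7) := by
  have hK := qK_pos h0 h1
  have three : ∀ {a b c : Spinors} {A B C : ℝ}, ‖a‖ ≤ A → ‖b‖ ≤ B → ‖c‖ ≤ C →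
      ‖a + b + c‖ ≤ A + B + C := fun ha hb hc =>
    norm_add₃_le.trans (add_le_add (add_le_add ha hb) hc)
  have c0 : ∀ {L M₁ M₂ J}, Admissible L M₁ M₂ J → |C0 q L J M₂| ≤ qK q ^ 2 * q ^ (2 * L - 4) ∧
      |C0 q L (J - 1) M₂| ≤ qK q ^ 2 * q ^ (2 * L - 4) := by
    intro L M₁ M₂ J h
    obtain ⟨hJ, hL, -, h2, h3⟩ := h
    exact ⟨abs_C0_le h0 h1 (by omega) (by omega) ⟨h2, h3⟩,
      abs_C0_le h0 h1 (by omega) (by omega) ⟨by omega, by omega⟩⟩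
  fin_cases i
  · refine ⟨2 * (qK q * qK q ^ 2) + 2 * ((qK q ^ 2 + qK q) * qK q ^ 2) + 2 * (qK q * qK q ^ 2),
      by positivity, fun L M₁ M₂ J h => ?_⟩
    obtain ⟨h2, h3⟩ := c0 h
    have hA := (admissible_iff.1 h).1
    have hV := (admissible_iff.1 h).2
    have ⟨hJ, hL, ⟨hM, hM'⟩, _⟩ := h
    refine (congrArg norm (sub_x_zero_ket hp hm h)).le.trans ?_
    rw [add_mul, add_mul, mul_assoc 2, mul_assoc 2]
    refine three ((norm_termKet_le _ _ _ _ _).trans ?_) ((norm_termKet_le _ _ _ _ _).trans ?_)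
      ((norm_termKet_le _ _ _ _ _).trans ?_)
    · rw [abs_neg]
      exact abs_two_mul_le (abs_mul_le_zpow h0 h1
        (abs_Ap_le h0 h1 (by omega) (by omega) (by omega)) h2 (by omega))
    · exact abs_two_mul_le (abs_mul_le_zpow h0 h1 (abs_A0_le h0 h1 hJ hA)
        (abs_H0_le h0 h1 hJ (by omega) hV) (by omega))
    · rw [abs_neg]
      exact abs_two_mul_le (abs_mul_le_zpow h0 h1
        (abs_Ap_le h0 h1 (by omega) (by omega) (by omega)) h3 (by omega))
  · refine ⟨2 * (qK q * qK q ^ 2) + 2 * (2 * qK q * qK q ^ 2) + 2 * (qK q * qK q ^ 2),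
      by positivity, fun L M₁ M₂ J h => ?_⟩
    obtain ⟨h2, h3⟩ := c0 h
    have hA := (admissible_iff.1 h).1
    have hV := (admissible_iff.1 h).2
    have ⟨hJ, hL, ⟨hM, hM'⟩, _⟩ := h
    refine (congrArg norm (sub_x_one_ket hp hm h)).le.trans ?_
    rw [add_mul, add_mul, mul_assoc 2, mul_assoc 2]
    refine three ((norm_termKet_le _ _ _ _ _).trans ?_) ((norm_termKet_le _ _ _ _ _).trans ?_)
      ((norm_termKet_le _ _ _ _ _).trans ?_)
    · rw [abs_neg]
      exact abs_two_mul_le (abs_mul_le_zpow h0 h1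
        (abs_Bp_le h0 h1 (by omega) (by omega)) h2 (by omega))
    · exact abs_two_mul_le (abs_mul_le_zpow h0 h1 (abs_B0_le h0 h1 hJ hA)
        (abs_H0_le h0 h1 hJ (by omega) hV) (by omega))
    · rw [abs_neg]
      exact abs_two_mul_le (abs_mul_le_zpow h0 h1
        (abs_Bm_le h0 h1 hJ hA) h3 (by omega))
  · refine ⟨2 * qK q ^ 2, by positivity, fun L M₁ M₂ J h => ?_⟩
    have hV := (admissible_iff.1 h).2
    have ⟨hJ, hL, _⟩ := h
    refine (congrArg norm (sub_x_two_ket hp hm h)).le.trans ?_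
    rw [mul_assoc 2]
    refine (norm_termKet_le _ _ _ _ _).trans (abs_two_mul_le
      ((abs_D0_le h0 h1 hJ (by omega) hV).trans ?_))
    exact mul_le_mul_of_nonneg_left (zpow_le_zpow_of_le h0 h1 (by omega)) (by positivity)

theorem summable_pow_natAbs {r : ℝ} (h0 : 0 ≤ r) (h1 : r < 1) :
    Summable fun n : ℤ => r ^ n.natAbs :=
  Summable.of_nat_of_neg (by simpa using summable_geometric_of_lt_one h0 h1)
    (by simpa using summable_geometric_of_lt_one h0 h1)

theorem summable_pow_label {r : ℝ} (h0 : 0 ≤ r) (h1 : r < 1) : Summable fun v : Label =>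
    r ^ v.1.1.natAbs * (r ^ v.1.2.1.natAbs * (r ^ v.1.2.2.1.natAbs * r ^ v.1.2.2.2.natAbs)) := by
  have h := summable_pow_natAbs h0 h1
  have hn : ∀ n : ℤ, 0 ≤ r ^ n.natAbs := fun n => pow_nonneg h0 _
  have h2 := h.mul_of_nonneg h hn hn
  have h3 := h.mul_of_nonneg h2 hn fun p => mul_nonneg (hn _) (hn _)
  have h4 := h.mul_of_nonneg h3 hn fun p => mul_nonneg (hn _) (mul_nonneg (hn _) (hn _))
  exact h4.comp_injective Subtype.val_injective

theorem isSmooth_of_ket_bound (h0 : 0 < q) (h1 : q < 1) {T : Spinors →L[ℂ] Spinors} {C : ℝ}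
    (hC : 0 ≤ C) (h : ∀ L M₁ M₂ J, Admissible L M₁ M₂ J →
      ‖T (ket L M₁ M₂ J)‖ ≤ C * q ^ (2 * L - 7)) : IsSmooth T := by
  -- On admissible labels `|L| + |M₁| + |M₂| + |J| ≤ 3L + 2`, so the cube of the summable weight has
  -- exponent at most `9L + 6 ≤ 12L + 6`, and `r ^ (12L + 6) = q ^ (2L + 1)`.
  set r : ℝ := q ^ (1 / 6 : ℝ) with hr
  have hr0 : 0 < r := Real.rpow_pos_of_pos h0 _
  have hr1 : r < 1 := Real.rpow_lt_one h0.le h1 (by norm_num)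
  have hr6 : r ^ 6 = q := by
    rw [hr, ← Real.rpow_natCast, ← Real.rpow_mul h0.le]
    norm_num
  -- The summand 1 ensures `D ≥ 1`, hence `D ≤ D ^ 3`.
  set D : ℝ := C * q ^ (-8 : ℤ) + 1 with hD
  have hD1 : 1 ≤ D := by
    have : 0 ≤ C * q ^ (-8 : ℤ) := by positivity
    linarith
  have hs := (summable_pow_label hr0.le hr1).mul_left D
  refine isSmooth_of_basis ketBasis hs (fun v => by positivity) fun v => ?_
  obtain ⟨⟨L, M₁, M₂, J⟩, hv⟩ := v
  rw [ketBasis_apply]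
  refine (h L M₁ M₂ J hv).trans ?_
  obtain ⟨hJ, hL, h2, h3⟩ := hv
  simp only at hJ hL h2 h3 ⊢
  have e1 : q ^ (2 * L - 7) = q ^ (-8 : ℤ) * r ^ (12 * L.toNat + 6) := by
    rw [show 12 * L.toNat + 6 = 6 * (2 * L.toNat + 1) by ring, pow_mul, hr6, ← zpow_natCast,
      ← zpow_add₀ h0.ne']
    congr 1
    push_cast
    omega
  have e2 : r ^ (12 * L.toNat + 6) ≤
      r ^ ((L.natAbs + (M₁.natAbs + (M₂.natAbs + J.natAbs))) * 3) :=
    pow_le_pow_of_le_one hr0.le hr1.le (by omega)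
  rw [← pow_add, ← pow_add, ← pow_add, mul_pow, ← pow_mul, e1, ← mul_assoc]
  refine mul_le_mul ?_ e2 (by positivity) (by positivity)
  calc C * q ^ (-8 : ℤ) ≤ D := by linarith
    _ ≤ D ^ 3 := le_self_pow₀ hD1 (by norm_num)

theorem isSmooth_sub (h0 : 0 < q) (h1 : q < 1) (hp : IsChiralRep q 1 ρp)
    (hm : IsChiralRep q (-1) ρm) (a : S4 q) : IsSmooth (ρp a - ρm a) := by
  refine S4.induction (p := fun a => IsSmooth (ρp a - ρm a)) (fun c => ?_) (fun i => ?_)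
    (fun a ha => ?_) (fun a b ha hb => ?_) (fun a b ha hb => ?_) a
  · have key := @isSmooth_sub_algebraMap Spinors _ _ _ (S4 q) _ _ _ ρp ρm
    exact key c
  · obtain ⟨C, hC, h⟩ := exists_norm_sub_x_le h0 h1 hp hm i
    exact isSmooth_of_ket_bound h0 h1 hC h
  · have key := @isSmooth_sub_star Spinors _ _ _ (S4 q) _ _ _ ρp ρm
    exact key ha
  · have key := @isSmooth_sub_add Spinors _ _ _ (S4 q) _ _ _ ρp ρm
    exact key ha hb
  · have key := @isSmooth_sub_mul Spinors _ _ _ (S4 q) _ _ _ ρp ρm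
    exact key ha hb

end Differences
end QuantumSphere
end

/-! ### Telescoping sums of `A⁰` and `H⁰` -/

noncomputable section
namespace QuantumSphere

section Telescoping

theorem HasSum.eq_of_telescoping {g U : ℕ → ℝ} {s c : ℝ} (hs : HasSum g s)
    (hg : ∀ n, g n = c * (U n - U (n + 1))) (hU : Filter.Tendsto U Filter.atTop (nhds 0)) :
    s = c * U 0 := by
  refine tendsto_nhds_unique hs.tendsto_sum_nat ?_
  have : (fun n => ∑ i ∈ Finset.range n, g i) = fun n => c * (U 0 - U n) := by
    funext n
    simp only [hg, ← Finset.mul_sum, Finset.sum_range_sub']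
  rw [this]
  simpa using (hU.const_sub (U 0)).const_mul c

variable {q : ℝ}

theorem tendsto_div_qi (h0 : 0 < q) (h1 : q < 1) (a b : ℝ) {k : ℤ} (hk : 1 ≤ k) :
    Filter.Tendsto (fun n : ℕ => (a * n + b) / qi q (2 * n + k)) Filter.atTop (nhds 0) := by
  have h2 : Filter.Tendsto (fun n : ℕ => |a| * (n * q ^ n) + |b| * q ^ n) Filter.atTop (nhds 0) := by
    simpa using ((tendsto_self_mul_const_pow_of_lt_one h0.le h1).const_mul |a|).add
      ((tendsto_pow_atTop_nhds_zero_of_lt_one h0.le h1).const_mul |b|)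
  refine squeeze_zero_norm (fun n => ?_) h2
  have hq := qi_pos h0 h1 (show 0 < 2 * (n : ℤ) + k by omega)
  rw [Real.norm_eq_abs, abs_div, abs_of_pos hq, div_eq_mul_inv, ← mul_assoc, ← add_mul]
  refine mul_le_mul ?_ ?_ (by positivity) (by positivity)
  · refine (abs_add_le _ _).trans ?_
    rw [abs_mul, Nat.abs_cast]
  · refine (inv_qi_le h0 h1 (by omega)).trans ?_
    rw [← zpow_natCast]
    exact zpow_le_zpow_of_le h0 h1 (by omega)

/-- At `m₁ = j - a` the non-constant part of the numerator is proportional to `q ^ (-2a) - 1`, so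
the sum is geometric plus linear in `k`. -/
theorem sum_A0 (h0 : 0 < q) (h1 : q < 1) (J : ℤ) (k : ℕ) :
    ∑ a ∈ Finset.range k, A0 q J (J - a) =
      q ^ (-2 : ℤ) * (qi q 2 * q ^ (2 * J + 2) * qK q *
        (q ^ 2 * ((q ^ (2 * k))⁻¹ - 1) / (1 - q ^ 2) - k) - k * qi q (2 * J + 1)) /
      (qi q (2 * J + 1) * qi q (2 * J + 3)) := by
  have hq := h0.ne'
  have h2 := (one_sub_sq_pos h0 h1).ne'
  induction k with
  | zero => simp
  | succ k ih =>
    rw [Finset.sum_range_succ, ih, A0_eq h0, ← add_div, ← mul_add]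
    congr 2
    have e : q ^ (J + (J - (k : ℤ)) + 2) * qi q 2 * qi q (J - (J - (k : ℤ))) =
        qi q 2 * q ^ (2 * J + 2) * qK q * ((q ^ (2 * k))⁻¹ - 1) := by
      rw [sub_sub_cancel, qi_eq h0 h1 k, show J + (J - (k : ℤ)) + 2 = 2 * J + 2 + -(k : ℤ) by ring,
        zpow_add₀ hq (2 * J + 2), zpow_neg, zpow_natCast, pow_mul', sq]
      field_simp
    rw [e]
    push_cast
    rw [show 2 * (k + 1) = 2 * k + 2 by ring, pow_add]
    field_simp
    ring

/-- The sum over all `m₁` is a difference of consecutive values of `2j/[2j]`. -/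
theorem sum_A0_eq_sub (h0 : 0 < q) (h1 : q < 1) (J : ℕ) :
    ∑ a ∈ Finset.range (2 * J + 2), A0 q J (J - a) =
      -(1 - q ^ 2)⁻¹ * ((2 * (J : ℝ) + 1) / qi q (2 * J + 1) -
        (2 * ((J + 1 : ℕ) : ℝ) + 1) / qi q (2 * (J + 1 : ℕ) + 1)) := by
  have hq := h0.ne'
  have h2 := (one_sub_sq_pos h0 h1).ne'
  have n1 := qi_ne_zero h0 h1 (show 2 * (J : ℤ) + 1 ≠ 0 by omega)
  have n2 := qi_ne_zero h0 h1 (show 2 * (J : ℤ) + 3 ≠ 0 by omega)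
  rw [sum_A0 h0 h1, show 2 * ((J + 1 : ℕ) : ℤ) + 1 = 2 * J + 3 by push_cast; ring]
  rw [div_sub_div _ _ n1 n2, mul_div_assoc', div_left_inj' (mul_ne_zero n1 n2)]
  have e1 : ∀ c : ℕ, q ^ (2 * (J : ℤ) + c) = (q ^ J) ^ 2 * q ^ c := fun c => by
    rw [zpow_add₀ hq, two_mul, zpow_add₀ hq]; norm_cast; ring
  have e2 : ∀ c : ℕ, qi q (2 * (J : ℤ) + c) =
      qK q * (((q ^ J) ^ 2 * q ^ c)⁻¹ - (q ^ J) ^ 2 * q ^ c) := fun c => by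
    rw [qi_eq h0 h1, zpow_neg, e1]
  have e3 : qi q 2 = qK q * ((q ^ 2)⁻¹ - q ^ 2) := by
    rw [qi_eq h0 h1, zpow_neg]; norm_cast
  have e4 : q ^ (2 * (2 * J + 2)) = (q ^ J) ^ 4 * q ^ 4 := by ring
  have f1 := e2 1
  have f2 := e2 3
  have f3 := e1 2
  push_cast at f1 f2 f3
  rw [f1, f2, f3, e3, e4, qK, zpow_neg]
  norm_cast
  have hu : q ^ J ≠ 0 := pow_ne_zero _ hq
  generalize q ^ J = u at hu ⊢
  push_cast
  field_simp
  ring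

/-- The numerator splits into a part independent of `m₂` and a multiple of `q ^ (2M)`. -/
theorem H0_num_eq (h0 : 0 < q) (h1 : q < 1) (L M n : ℤ) :
    qi q (L - M - n + 1) * qi q (L + M - n + 3) -
      q ^ (-2 : ℤ) * (qi q (L - M + n + 2) * qi q (L + M + n + 2)) =
    qK q ^ 2 * (q ^ (2 * n - 2 * L - 4) + q ^ (2 * L - 2 * n + 4) - q ^ (-2 * L - 2 * n - 6) -
      q ^ (2 * L + 2 * n + 2) + ((q ^ 2)⁻¹ - q ^ 2) * q ^ (2 * M)) := by
  have hq := h0.ne'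
  have hL := zpow_ne_zero L hq
  have hM := zpow_ne_zero M hq
  have hn := zpow_ne_zero n hq
  simp only [qi_eq h0 h1, zpow_neg, neg_mul, two_mul, zpow_add₀ hq, zpow_sub₀ hq]
  norm_cast
  generalize q ^ L = u at *
  generalize q ^ M = v at *
  generalize q ^ n = w at *
  field_simp
  ring

/-- The sign `ε` alternates with `m₂`, so terms are added in pairs with `n = J + 1` and `n = -(J +
1)`. Each pair has the same part independent of `m₂`, which produces the factor `m`; the rest is
geometric. -/
theorem sum_H0 (h0 : 0 < q) (h1 : q < 1) (J d : ℤ) (m : ℕ) :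
    ∑ b ∈ Finset.range (2 * m), H0 q (J + d) J (d - b) =
      qK q ^ 2 * (m * ((q ^ (2 * J + 2) + (q ^ (2 * J + 2))⁻¹) * (q - q⁻¹) *
          ((q ^ (2 * (J + d) + 5))⁻¹ + q ^ (2 * (J + d) + 3))) +
        ((q ^ 2)⁻¹ - q ^ 2) * q ^ (2 * d) * (q ^ 2 * ((q ^ (4 * m))⁻¹ - 1) / (1 - q ^ 2))) /
      (qi q (2 * (J + d) + 3) * qi q (2 * (J + d) + 5)) := by
  have hq := h0.ne'
  have h2 := (one_sub_sq_pos h0 h1).ne'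
  induction m with
  | zero => simp
  | succ m ih =>
    have hp1 : nn (J + d) J (d - (2 * m : ℕ)) = J + 1 := by
      obtain ⟨h, hn⟩ | ⟨h, hn⟩ := nn_cases (J + d) J (d - (2 * m : ℕ))
      · exact hn
      · push_cast at h; omega
    have hp2 : nn (J + d) J (d - (2 * m + 1 : ℕ)) = -(J + 1) := by
      obtain ⟨h, hn⟩ | ⟨h, hn⟩ := nn_cases (J + d) J (d - (2 * m + 1 : ℕ))
      · push_cast at h; omega
      · exact hn
    rw [show 2 * (m + 1) = 2 * m + 1 + 1 by ring, Finset.sum_range_succ, Finset.sum_range_succ, ih,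
      H0_eq h0, H0_eq h0, hp1, hp2, H0_num_eq h0 h1, H0_num_eq h0 h1, ← add_div, ← add_div,
      ← mul_add, ← mul_add]
    congr 2
    have hJ := zpow_ne_zero J hq
    have hd := zpow_ne_zero d hq
    have hm := pow_ne_zero m hq
    push_cast
    simp only [show 4 * (m + 1) = m + m + m + m + 4 by ring, show 4 * m = m + m + m + m by ring,
      pow_add, zpow_neg, neg_mul, two_mul, zpow_add₀ hq, zpow_sub₀ hq, zpow_natCast]
    norm_cast
    push_cast
    generalize q ^ J = u at *
    generalize q ^ d = v at *
    generalize q ^ m = w at *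
    field_simp
    ring

theorem sum_H0_eq_sub (h0 : 0 < q) (h1 : q < 1) (J d : ℕ) :
    ∑ b ∈ Finset.range (2 * d + 2), H0 q (J + d) J (d - b) =
      -(1 - q ^ 2)⁻¹ *
        (((q ^ (2 * J + 2) + (q ^ (2 * J + 2))⁻¹) * d + qi q (2 * J + 3)) /
            qi q (2 * d + (2 * J + 3)) -
          ((q ^ (2 * J + 2) + (q ^ (2 * J + 2))⁻¹) * (d + 1 : ℕ) + qi q (2 * J + 3)) /
            qi q (2 * (d + 1 : ℕ) + (2 * J + 3))) := by
  have hq := h0.ne'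
  have h2 := (one_sub_sq_pos h0 h1).ne'
  have n1 := qi_ne_zero h0 h1 (show 2 * ((J : ℤ) + d) + 3 ≠ 0 by omega)
  have n2 := qi_ne_zero h0 h1 (show 2 * ((J : ℤ) + d) + 5 ≠ 0 by omega)
  rw [show 2 * d + 2 = 2 * (d + 1) by ring, sum_H0 h0 h1,
    show 2 * ((d + 1 : ℕ) : ℤ) + (2 * J + 3) = 2 * (J + d) + 5 by push_cast; ring,
    show 2 * (d : ℤ) + (2 * J + 3) = 2 * (J + d) + 3 by ring]
  rw [div_sub_div _ _ n1 n2, ← mul_div_assoc (-(1 - q ^ 2)⁻¹), div_left_inj' (mul_ne_zero n1 n2)]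
  have hJ := pow_ne_zero J hq
  have hd := pow_ne_zero d hq
  simp only [show 4 * (d + 1) = d + d + d + d + 4 by ring, qi_eq h0 h1, qK, pow_add, zpow_neg,
    two_mul, zpow_add₀ hq, zpow_natCast]
  norm_cast
  push_cast
  generalize q ^ J = u at *
  generalize q ^ d = v at *
  field_simp
  ring

end Telescoping
end QuantumSphere
end

/-! ### The trace of `ρ₊(x₀) - ρ₋(x₀)` -/

noncomputable section
namespace QuantumSphere

section TraceX0

variable {q : ℝ}

/-- The label with `j = J + 1/2`, `l = j + d`, `m₁ = j - a` and `m₂ = d + 1/2 - b`. -/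
def toLabel (p : Σ J : ℕ, Σ d : ℕ, Fin (2 * J + 2) × Fin (2 * d + 2)) : Label :=
  ⟨((p.1 + p.2.1 : ℤ), (p.1 - (p.2.2.1 : ℕ) : ℤ), (p.2.1 - (p.2.2.2 : ℕ) : ℤ), (p.1 : ℤ)), by
    have h1 := p.2.2.1.2
    have h2 := p.2.2.2.2
    simp only [Admissible]
    omega⟩

theorem toLabel_bijective : Function.Bijective toLabel := by
  constructor
  · rintro ⟨J, d, a, b⟩ ⟨J', d', a', b'⟩ h
    simp only [toLabel, Subtype.mk.injEq, Prod.mk.injEq] at h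
    obtain ⟨h1, h2, h3, h4⟩ := h
    obtain rfl : J = J' := by omega
    obtain rfl : d = d' := by omega
    obtain rfl : a = a' := Fin.ext (by omega)
    obtain rfl : b = b' := Fin.ext (by omega)
    rfl
  · rintro ⟨⟨L, M₁, M₂, J⟩, h⟩
    have ⟨h1, h2, h3, h4⟩ := h
    simp only at h1 h2 h3 h4
    refine ⟨⟨J.toNat, (L - J).toNat, ⟨(J - M₁).toNat, by omega⟩, ⟨(L - J - M₂).toNat, by omega⟩⟩, ?_⟩
    refine Subtype.ext ?_
    simp only [toLabel, Prod.mk.injEq]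
    omega

/-- For fixed `j`, the sum of `H⁰` over `m₂` and `l` telescopes to `-1/(1 - q²)`, independently of
`j`. The remaining sum of `A⁰` over `m₁` and `j` telescopes to the same value. -/
theorem hasSum_A0_mul_H0 (h0 : 0 < q) (h1 : q < 1) {s : ℝ}
    (hs : HasSum (fun v : Label =>
      2 * (A0 q v.1.2.2.2 v.1.2.1 * H0 q v.1.1 v.1.2.2.2 v.1.2.2.1)) s) :
    s = 2 / (1 - q ^ 2) ^ 2 := by
  have h2 := (one_sub_sq_pos h0 h1).ne'
  have hs' := (Equiv.ofBijective _ toLabel_bijective).hasSum_iff.2 hs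
  set f : (Σ J : ℕ, Σ d : ℕ, Fin (2 * J + 2) × Fin (2 * d + 2)) → ℝ := fun p =>
    2 * (A0 q p.1 (p.1 - (p.2.2.1 : ℕ)) * H0 q (p.1 + p.2.1) p.1 (p.2.1 - (p.2.2.2 : ℕ))) with hf
  have hs2 : HasSum f s := hs'
  have hfin : ∀ J d : ℕ, HasSum (fun c : Fin (2 * J + 2) × Fin (2 * d + 2) => f ⟨J, d, c⟩)
      (2 * (∑ a ∈ Finset.range (2 * J + 2), A0 q J (J - a)) *
        ∑ b ∈ Finset.range (2 * d + 2), H0 q (J + d) J (d - b)) := by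
    intro J d
    convert hasSum_fintype _ using 1
    rw [Fintype.sum_prod_type, Finset.sum_range, Finset.sum_range, mul_assoc, Finset.sum_mul_sum,
      Finset.mul_sum]
    simp only [hf, Finset.mul_sum]
  have hJ : ∀ J : ℕ, HasSum (fun p : Σ d : ℕ, Fin (2 * J + 2) × Fin (2 * d + 2) => f ⟨J, p⟩)
      (-(1 - q ^ 2)⁻¹ * (2 * ∑ a ∈ Finset.range (2 * J + 2), A0 q J (J - a))) := by
    intro J
    have hsum := (hs2.summable.sigma_factor J).hasSum
    have hd := hsum.sigma (hfin J)
    have := HasSum.eq_of_telescoping (U := fun d : ℕ =>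
      ((q ^ (2 * J + 2) + (q ^ (2 * J + 2))⁻¹) * d + qi q (2 * J + 3)) /
            qi q (2 * d + (2 * J + 3)))
      (c := 2 * (∑ a ∈ Finset.range (2 * J + 2), A0 q J (J - a)) * -(1 - q ^ 2)⁻¹) hd
      (fun d => by rw [sum_H0_eq_sub h0 h1, mul_assoc (2 * _)])
      (tendsto_div_qi h0 h1 _ _ (by omega))
    have n1 := qi_ne_zero h0 h1 (show 2 * (J : ℤ) + 3 ≠ 0 by omega)
    -- At `d = 0` the telescoping function is `[2J+3]/[2J+3] = 1`, which removes the dependence on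
    -- `j`.
    have hU : ((q ^ (2 * J + 2) + (q ^ (2 * J + 2))⁻¹) * (0 : ℕ) + qi q (2 * J + 3)) /
        qi q (2 * (0 : ℕ) + (2 * J + 3)) = 1 := by
      rw [Nat.cast_zero, Nat.cast_zero, mul_zero, mul_zero, zero_add, zero_add, div_self n1]
    beta_reduce at this
    rw [hU, mul_one] at this
    exact (congrArg (HasSum _) (this.trans (mul_comm _ _))).mp hsum
  have hT := hs2.sigma hJ
  have := HasSum.eq_of_telescoping (U := fun J : ℕ => (2 * (J : ℝ) + 1) / qi q (2 * J + 1))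
    (c := -(1 - q ^ 2)⁻¹ * (2 * -(1 - q ^ 2)⁻¹)) hT
    (fun J => by rw [sum_A0_eq_sub h0 h1]; ring) (tendsto_div_qi h0 h1 2 1 le_rfl)
  rw [this]
  have n1 := qi_ne_zero h0 h1 (show (1 : ℤ) ≠ 0 by omega)
  have n2 : qi q 1 = 1 := by
    have := h0.ne'
    rw [qi_eq h0 h1, qK, zpow_neg, zpow_one]
    field_simp
  rw [Nat.cast_zero, Nat.cast_zero, mul_zero, mul_zero, zero_add, zero_add, n2]
  field_simp

variable {ρp ρm : S4 q →⋆ₐ[ℂ] (Spinors →L[ℂ] Spinors)}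

theorem inner_ket_sub_x_zero_ket (hp : IsChiralRep q 1 ρp) (hm : IsChiralRep q (-1) ρm)
    (v : Label) : ⟪ketBasis v, (ρp (x q 0) - ρm (x q 0)) (ketBasis v)⟫_ℂ =
      ((2 * (A0 q v.1.2.2.2 v.1.2.1 * H0 q v.1.1 v.1.2.2.2 v.1.2.2.1) : ℝ) : ℂ) := by
  obtain ⟨⟨L, M₁, M₂, J⟩, h⟩ := v
  have h' : Admissible L M₁ M₂ J := h
  have e : ∀ {a b c d : Spinors}, ⟪a, b + c + d⟫_ℂ = ⟪a, b⟫_ℂ + ⟪a, c⟫_ℂ + ⟪a, d⟫_ℂ := by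
    intro a b c d
    rw [inner_add_right, inner_add_right]
  rw [ketBasis_apply]
  refine (congrArg (fun w : Spinors => ⟪ket L M₁ M₂ J, w⟫_ℂ) (sub_x_zero_ket hp hm h')).trans ?_
  simp only [e, termKet, inner_smul_right]
  rw [inner_ket_of_ne (by simp), inner_ket_self h', inner_ket_of_ne (by simp; omega)]
  simp

theorem hasNuclearTrace_sub_x_zero (h0 : 0 < q) (h1 : q < 1) (hp : IsChiralRep q 1 ρp)
    (hm : IsChiralRep q (-1) ρm) :
    HasNuclearTrace (ρp (x q 0) - ρm (x q 0)) ((2 / (1 - q ^ 2) ^ 2 : ℝ) : ℂ) := by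
  obtain ⟨t, ht⟩ := (isSmooth_sub h0 h1 hp hm (x q 0)).1.exists_trace
  have hs := ht.hasSum_inner ketBasis
  have hs' : HasSum (fun v : Label => ((2 * (A0 q v.1.2.2.2 v.1.2.1 *
      H0 q v.1.1 v.1.2.2.2 v.1.2.2.1) : ℝ) : ℂ)) t := by
    convert hs using 2 with v
    exact (inner_ket_sub_x_zero_ket hp hm v).symm
  have hr := (Complex.hasSum_re hs')
  simp only [Complex.ofReal_re] at hr
  have h3 := hasSum_A0_mul_H0 h0 h1 hr
  have h4 := (Complex.hasSum_ofReal.2 hr).unique hs'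
  rw [← h3, h4]
  exact ht

/-- The constant part of `tr e` cancels, and its coefficient of `x₀` is the inverse of the trace
found above. -/
theorem hasNuclearTrace_sub_trace_e (h0 : 0 < q) (h1 : q < 1) (hp : IsChiralRep q 1 ρp)
    (hm : IsChiralRep q (-1) ρm) :
    HasNuclearTrace (ρp (e q).trace - ρm (e q).trace) 1 := by
  have h := (hasNuclearTrace_sub_x_zero h0 h1 hp hm).smul ((1 - (q : ℂ) ^ 2) ^ 2 / 2)
  have h2 : (1 - (q : ℂ) ^ 2) ≠ 0 := by exact_mod_cast (one_sub_sq_pos h0 h1).ne'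
  have e1 : (1 - (q : ℂ) ^ 2) ^ 2 / 2 * ((2 / (1 - q ^ 2) ^ 2 : ℝ) : ℂ) = 1 := by
    push_cast
    field_simp
  rw [e1] at h
  convert h using 1
  rw [trace_e, map_add, map_add, AlgHomClass.commutes, AlgHomClass.commutes, map_smul, map_smul,
    add_sub_add_left_eq_sub, smul_sub]

theorem not_finiteDimensional_spinors : ¬FiniteDimensional ℂ Spinors := by
  intro h
  have hl := ketBasis.orthonormal.linearIndependent
  have hf : Finite Label := hl.finite
  have hinj : Function.Injective fun n : ℕ => (⟨(n, 0, 0, 0), by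
      simp only [Admissible]; omega⟩ : Label) := fun m n h => by
    simpa using h
  exact not_injective_infinite_finite _ hinj

end TraceX0
end QuantumSphere
end

theorem mainTheorem7 (q : ℝ) (hq0 : 0 < q) (hq1 : q < 1) :
    (∃! ρ, QuantumSphere.IsChiralRep q 1 ρ) ∧
    (∃! ρ, QuantumSphere.IsChiralRep q (-1) ρ) ∧
    ∀ ρp ρm : QuantumSphere.S4 q →⋆ₐ[ℂ] (QuantumSphere.Spinors →L[ℂ] QuantumSphere.Spinors),
      QuantumSphere.IsChiralRep q 1 ρp → QuantumSphere.IsChiralRep q (-1) ρm →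
      IsEvenFredholmModule (directSumRep ρp ρm) QuantumSphere.F QuantumSphere.γ ∧
      IsPSummable 1 (directSumRep ρp ρm) QuantumSphere.F ∧
      IsNontrivialModule (directSumRep ρp ρm) QuantumSphere.F QuantumSphere.γ ∧
      IsIdempotentElem (QuantumSphere.e q) ∧
      (fredholmPlus (directSumRep ρp ρm) QuantumSphere.F QuantumSphere.γ
        (QuantumSphere.e q)).IsFredholm ∧
      ∃ τ : ℂ,
        HasTrace (pairingOp (directSumRep ρp ρm) QuantumSphere.F QuantumSphere.γ
          (QuantumSphere.e q)) τ ∧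
        (fredholmIndex (fredholmPlus (directSumRep ρp ρm) QuantumSphere.F QuantumSphere.γ
          (QuantumSphere.e q)) : ℂ) = 1 / 2 * τ ∧
        fredholmIndex (fredholmPlus (directSumRep ρp ρm) QuantumSphere.F QuantumSphere.γ
          (QuantumSphere.e q)) = 1 := by
  refine ⟨QuantumSphere.existsUnique_isChiralRep hq0 hq1 (by norm_num),
    QuantumSphere.existsUnique_isChiralRep hq0 hq1 (by norm_num), fun ρp ρm hp hm => ?_⟩
  have he := QuantumSphere.isIdempotentElem_e q hq0.ne'
  have hs : ∀ a, IsSmooth (ρp a - ρm a) := QuantumSphere.isSmooth_sub hq0 hq1 hp hm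
  obtain ⟨h1, h2, h3⟩ := index_pairing_directSumRep (QuantumSphere.e q)
    QuantumSphere.not_finiteDimensional_spinors hs he
    (QuantumSphere.hasNuclearTrace_sub_trace_e hq0 hq1 hp hm)
  have h4 : fredholmIndex (fredholmPlus (directSumRep ρp ρm) QuantumSphere.F QuantumSphere.γ
      (QuantumSphere.e q)) = 1 := by exact_mod_cast h3
  refine ⟨isEvenFredholmModule_directSumRep hs,
    isPSummable_directSumRep QuantumSphere.not_finiteDimensional_spinors hs,
    ⟨4, QuantumSphere.e q, he, h2, by rw [h4]; exact one_ne_zero⟩, he, h2, 2 * 1, h1, ?_, h4⟩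
  rw [h4]
  norm_num
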